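/- Let $p,q:\mathbb R\to\mathbb C$ be $\pi$-periodic and of bounded variation on $[0,\pi]$, let $J=\begin{pmatrix}0&1\\-1&0\end{pmatrix}$ and $Q=\begin{pmatrix}p&q\\q&-p\end{pmatrix}$. For $t\in\mathbb C$ let $L_t(Q)$ be the operator in $L_2([0,\pi];\mathbb C^2)$ generated by $J\mathbf y'+Q\mathbf y$ and the boundary condition $\mathbf y(\pi)=e^{i\pi t}\mathbf y(0)$; its adjoint is $L_{\bar t}(\overline Q)$. Let $\mathbf c(x,\lambda)=(c_1,c_2)$ and $\mathbf s(x,\lambda)=(s_1,s_2)$ be the absolutely continuous solutions of $J\mathbf y'+Q\mathbf y=\lambda\mathbf y$ with $\mathbf c(0,\lambda)=(1,0)$, $\mathbf s(0,\lambda)=(0,1)$, and put $F(\lambda)=c_1(\pi,\lambda)+s_2(\pi,\lambda)$ and $\Delta(\lambda,t)=\det\begin{pmatrix}c_1(\pi,\lambda)-e^{i\pi t}&s_1(\pi,\lambda)\\c_2(\pi,\lambda)&s_2(\pi,\lambda)-e^{i\pi t}\end{pmatrix}$. The eigenvalues of $L_t(Q)$ are the zeros of $\Delta(\cdot,t)$,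 counted with their multiplicity as zeros. For a set $S\subset\mathbb C$, a Bloch system along $S$ consists of functions $\lambda_{n,j}$ ($n\in\mathbb Z$, $j=1,2$), continuous on $S$, such that for every $t\in S$ the numbers $\lambda_{n,j}(t)$ are the eigenvalues of $L_t(Q)$ counted with multiplicity, and, for those $t\in S$ at which $\lambda_{n,j}(t)$ is a simple eigenvalue, of an eigenfunction $\Psi_{n,j,t}$ of $L_t(Q)$ for $\lambda_{n,j}(t)$ with $\|e^{-itx}\Psi_{n,j,t}\|=1$ and an eigenfunction $\Psi^*_{n,j,t}$ of $L_{\bar t}(\overline Q)$ for $\overline{\lambda_{n,j}(t)}$ with $\|e^{-i\bar tx}\Psi^*_{n,j,t}\|=1$. Here $(u,v)=\int_0^\pi (u_1\overline{v_1}+u_2\overline{v_2})\,dx$ and $\|\cdot\|$ is the corresponding norm. Put $\alpha_{n,j}(t)=(\Psi_{n,j,t},\Psi^*_{n,j,t})$. For real $t_0$, a number $\lambda_0$ is an essential spectral singularity (ESS) at $t_0$ if there are $n,j$ with $\lambda_{n,j}(t_0)=\lambda_0$ such that for every $\varepsilon>0$ the function $1/\alpha_{n,j}$ is not integrable on $(t_0-\varepsilon,t_0+\varepsilon)$.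 Let $0<h<1/10$ and $D_h=\{t\in\mathbb C:|\operatorname{Im}t|\le 2h,\ -h\le\operatorname{Re}t\le 2-h\}$. Let $A$ be the set of $t\in D_h$ for which $L_t(Q)$ has an eigenvalue $\lambda$ with $F'(\lambda)=0$ or $s_1(\pi,\lambda)=0$. For $a=0,1$ let $\gamma(a,h)=\{t\in\mathbb C:|t-a|=h,\ \operatorname{Im}t\ge 0\}$, and assume $(\gamma(0,h)\cup\gamma(1,h))\cap A=\varnothing$. Let $E(h)=([h,1-h]\cup[1+h,2-h])\setminus A$. Let $f:\mathbb R\to\mathbb C^2$ be continuous with compact support, let $f_t(x)=\sum_{k\in\mathbb Z}f(x+k\pi)e^{-ik\pi t}$, and let $$a_{k,j}(t)\Psi_{k,j,t}(x)=\frac1{\alpha_{k,j}(t)}\,(f_t,\Psi^*_{k,j,t})\,\Psi_{k,j,t}(x).$$ Then for all $k\in\mathbb Z$, $j\in\{1,2\}$ and $x\in[0,\pi]$: 1. For each of the sets $S=E(h)$, $S=\gamma(0,h)$, $S=\gamma(1,h)$ and every Bloch system along $S$, the function $t\mapsto a_{k,j}(t)\Psi_{k,j,t}(x)$ is integrable over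 $S$. 2. For every Bloch system along $(-h,h)$ for which $\lambda_{k,j}(0)$ is not an ESS at $0$, this function is integrable over $(-h,h)$. 3. For every Bloch system along $(1-h,1+h)$ for which $\lambda_{k,j}(1)$ is not an ESS at $1$, this function is integrable over $(1-h,1+h)$. -/

import Mathlib

open MeasureTheory Set
open scoped Matrix ComplexConjugate

noncomputable section

namespace Dirac

/-- The potential `Q(x)` with rows `(p, q)` and `(q, -p)`. -/
def potential (p q : ℝ → ℂ) (x : ℝ) : Matrix (Fin 2) (Fin 2) ℂ :=
  !![p x, q x; q x, -p x]

/-- The constant matrix with rows `(0, 1)` and `(-1, 0)`. -/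
def J : Matrix (Fin 2) (Fin 2) ℂ := !![0, 1; -1, 0]

/-- `y` is an (absolutely continuous) solution on `[0, π]` of `J y' + Q y = mu y`. -/
structure IsSolution (p q : ℝ → ℂ) (mu : ℂ) (y : ℝ → Fin 2 → ℂ) : Prop where
  ac : AbsolutelyContinuousOnInterval y 0 Real.pi
  eqn : ∀ᵐ x ∂(volume.restrict (Icc 0 Real.pi)),
    ∃ y' : Fin 2 → ℂ, HasDerivAt y y' x ∧ J *ᵥ y' + potential p q x *ᵥ y x = mu • y x

/-- The solution of `J y' + Q y = mu y` on `[0, π]` with initial value `y 0 = v`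
(it exists and is unique on `[0, π]` for integrable coefficients). -/
def solution (p q : ℝ → ℂ) (mu : ℂ) (v : Fin 2 → ℂ) : ℝ → Fin 2 → ℂ :=
  Classical.epsilon fun y => IsSolution p q mu y ∧ y 0 = v

/-- `c(x, mu)`, the solution with `c₁(0) = 1`, `c₂(0) = 0`. -/
def cSol (p q : ℝ → ℂ) (mu : ℂ) : ℝ → Fin 2 → ℂ := solution p q mu ![1, 0]

/-- `s(x, mu)`, the solution with `s₁(0) = 0`, `s₂(0) = 1`. -/
def sSol (p q : ℝ → ℂ) (mu : ℂ) : ℝ → Fin 2 → ℂ := solution p q mu ![0, 1]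

/-- `F(mu) = c₁(π, mu) + s₂(π, mu)`. -/
def discriminant (p q : ℝ → ℂ) (mu : ℂ) : ℂ :=
  cSol p q mu Real.pi 0 + sSol p q mu Real.pi 1

/-- The multiplier `e^{iπt}` of the quasimomentum `t`. -/
def multiplier (t : ℂ) : ℂ := Complex.exp (Complex.I * Real.pi * t)

/-- The characteristic determinant `Δ(mu, t)` of `L_t(Q)`. -/
def charDet (p q : ℝ → ℂ) (mu t : ℂ) : ℂ :=
  Matrix.det !![cSol p q mu Real.pi 0 - multiplier t, sSol p q mu Real.pi 0;
    cSol p q mu Real.pi 1, sSol p q mu Real.pi 1 - multiplier t]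

/-- The multiplicity of `mu` as an eigenvalue of `L_t(Q)`: its multiplicity as a root of
`Δ(·, t)`; it is `0` when `mu` is not an eigenvalue. -/
def multiplicity (p q : ℝ → ℂ) (t mu : ℂ) : ℕ∞ :=
  analyticOrderAt (fun z => charDet p q z t) mu

/-- The inner product of `L²([0, π]; ℂ²)`, linear in the first argument. -/
def ip (u v : ℝ → Fin 2 → ℂ) : ℂ :=
  ∫ x in (0 : ℝ)..Real.pi, ∑ i, u x i * conj (v x i)

/-- `y` is an eigenfunction of `L_t(Q)` for the eigenvalue `mu`, normalized by
`‖e^{-itx} y‖ = 1` in `L²([0, π]; ℂ²)`. -/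
structure IsNormalizedEigenfunction (p q : ℝ → ℂ) (t mu : ℂ) (y : ℝ → Fin 2 → ℂ) : Prop where
  sol : IsSolution p q mu y
  bdry : y Real.pi = multiplier t • y 0
  norm_eq : ∫ x in (0 : ℝ)..Real.pi,
    ∑ i, ‖Complex.exp (-(Complex.I * t * x)) * y x i‖ ^ 2 = 1

/-- A numbering `lam n j t` of the Bloch eigenvalues along a set `S` of quasimomenta, with
normalized eigenfunctions `Psi n j t` of `L_t(Q)` and `PsiStar n j t` of the adjoint operator
`L_{conj t}(conj Q)`. The eigenvalues are counted with multiplicity and depend continuously on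
`t` along `S`; the eigenfunctions are those at simple eigenvalues, with arbitrary phases. -/
structure IsBlochSystem (p q : ℝ → ℂ) (S : Set ℂ) (lam : ℤ → Fin 2 → ℂ → ℂ)
    (Psi PsiStar : ℤ → Fin 2 → ℂ → ℝ → Fin 2 → ℂ) : Prop where
  enum : ∀ t ∈ S, ∀ mu : ℂ,
    {nj : ℤ × Fin 2 | lam nj.1 nj.2 t = mu}.encard = multiplicity p q t mu
  cont : ∀ n j, ContinuousOn (lam n j) S
  eigen : ∀ n j, ∀ t ∈ S, multiplicity p q t (lam n j t) = 1 →
    IsNormalizedEigenfunction p q t (lam n j t) (Psi n j t)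
  eigenStar : ∀ n j, ∀ t ∈ S, multiplicity p q t (lam n j t) = 1 →
    IsNormalizedEigenfunction (fun x => conj (p x)) (fun x => conj (q x))
      (conj t) (conj (lam n j t)) (PsiStar n j t)

/-- `mu0` is an essential spectral singularity at the real quasimomentum `t0`:
for some `(n, j)` with `lam n j t0 = mu0`, the function `1 / α_{n,j}`, where
`α_{n,j}(t) = (Psi_{n,j,t}, PsiStar_{n,j,t})`, is not integrable on any interval
`(t0 - ε, t0 + ε)`. Absolute values make this independent of the phases. -/
def IsESS (lam : ℤ → Fin 2 → ℂ → ℂ) (Psi PsiStar : ℤ → Fin 2 → ℂ → ℝ → Fin 2 → ℂ)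
    (t0 : ℝ) (mu0 : ℂ) : Prop :=
  ∃ (n : ℤ) (j : Fin 2), lam n j t0 = mu0 ∧ ∀ ε : ℝ, 0 < ε →
    ¬ IntegrableOn (fun t : ℝ => ‖(ip (Psi n j t) (PsiStar n j t))⁻¹‖)
      (Ioo (t0 - ε) (t0 + ε))

/-- The Gelfand transform `f_t(x) = ∑ₖ f(x + kπ) e^{-ikπt}`. -/
def gelfand (f : ℝ → Fin 2 → ℂ) (t : ℂ) (x : ℝ) : Fin 2 → ℂ :=
  ∑' k : ℤ, Complex.exp (-(Complex.I * k * Real.pi * t)) • f (x + k * Real.pi)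

/-- The value at `x` of `a Ψ = (1 / α) (f_t, Ψ*) Ψ`, where `α = (Ψ, Ψ*)`. -/
def expansionTerm (f : ℝ → Fin 2 → ℂ) (t : ℂ) (psi psiStar : ℝ → Fin 2 → ℂ) (x : ℝ) :
    Fin 2 → ℂ :=
  ((ip psi psiStar)⁻¹ * ip (gelfand f t) psiStar) • psi x

/-- The strip piece `D_h`. -/
def stripD (h : ℝ) : Set ℂ := {t | |t.im| ≤ 2 * h ∧ -h ≤ t.re ∧ t.re ≤ 2 - h}

/-- The set `A` of exceptional quasimomenta in `D_h`: `L_t(Q)` has an eigenvalue at which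
`F'` or `s₁(π, ·)` vanishes. -/
def exceptional (p q : ℝ → ℂ) (h : ℝ) : Set ℂ :=
  {t | t ∈ stripD h ∧ ∃ mu : ℂ, charDet p q mu t = 0 ∧
    (deriv (discriminant p q) mu = 0 ∨ sSol p q mu Real.pi 0 = 0)}

/-- The semicircle `γ(a, h)` in the closed upper half plane. -/
def semicircle (a h : ℝ) : Set ℂ := {t | ‖t - a‖ = h ∧ 0 ≤ t.im}

/-- `g` is integrable over `γ(a, h)`, parametrized by `t = a + h e^{iθ}`, `0 ≤ θ ≤ π`. -/
def SemicircleIntegrable (g : ℂ → Fin 2 → ℂ) (a h : ℝ) : Prop :=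
  IntervalIntegrable (fun θ : ℝ => g (circleMap a h θ)) volume 0 Real.pi

/-- `E(h)`: the set `B(h) = [h, 1 - h] ∪ [1 + h, 2 - h]` without its exceptional points. -/
def setE (p q : ℝ → ℂ) (h : ℝ) : Set ℝ :=
  {t | t ∈ Icc h (1 - h) ∪ Icc (1 + h) (2 - h) ∧ (t : ℂ) ∉ exceptional p q h}

end Dirac

end

noncomputable section

namespace Dirac

open Filter Topology

/-! ### Absolute continuity, linear integral equations and a uniform Riemann–Lebesgue estimate -/

section Toolkit

/-! Every eigenvalue satisfies `F(λ(t)) = 2 cos πt`, where `F` is the discriminant, an entire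
function. At a simple eigenvalue with `F'(λ) ≠ 0` and `t` not an integer, the two Floquet
eigenvectors (multipliers `e^{iπt}` and `e^{-iπt}`) can be eliminated: phases and normalizations
cancel, and the expansion term equals `F'(λ)⁻¹ • residueTerm`, with `residueTerm` jointly continuous
in `(λ, t)` (`expansionTerm_eq`, resting on `floquet_algebra`). All singular behaviour is therefore
that of `1 / F'(λ(t))`.

On a semicircle avoiding the exceptional set, `F'(λ(t))` never vanishes and the term is continuous
on a compact arc.

Near a real non-integer `a`, the function `λ` is only known to be continuous on one side, perhaps
with `a` itself removed. It still has a one-sided limit `l` with `F(l) = 2 cos πa`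
(`IsCosineType.exists_tendsto_right`). This needs `F(z) = 2 cos πz + o(e^{π|Im z|})`: then `|F| ≤ 2`
confines `λ` to a horizontal strip, and far vertical lines `Re z = n` act as barriers that a
continuous branch cannot cross. If `F'` vanishes to order `m` at `l`, then `F - F(l)` vanishes to
order `m + 1`, so `|F'(λ)|` is at least a constant times `|F(λ) - F(l)|^θ` with `θ = m/(m+1)`. Since
`cos πt` has non-zero derivative at `a`, this gives `1/|F'(λ(t))| ≤ C |t - a|^{-θ}`, which is
integrable as `θ < 1` (`IsCosineType.exists_integrableOn_right`). Exceptional points are isolated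
away from the integers (`RegularCoeff.eventually_notMem_exceptional`), so `E(h)` looks like a full
or an empty interval on each side of each point, and compactness finishes the argument.

At an integer `cos πt` is stationary and the exponent estimate fails. There the absence of an ESS
makes `1/α` integrable nearby, while `(f_t, Ψ*)` and `Ψ(x)` stay bounded
(`IsBlochSystem.integrableAtFilter_of_not_isESS`); the formula with `F'` is then used only for
measurability. -/

theorem absolutelyContinuousOnInterval_of_dist_le {X Y : Type*} [PseudoMetricSpace X]
    [PseudoMetricSpace Y] {f : ℝ → X} {g : ℝ → Y} {a b : ℝ}
    (hg : AbsolutelyContinuousOnInterval g a b)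
    (h : ∀ x ∈ uIcc a b, ∀ y ∈ uIcc a b, dist (f x) (f y) ≤ dist (g x) (g y)) :
    AbsolutelyContinuousOnInterval f a b := by
  rw [absolutelyContinuousOnInterval_iff] at hg ⊢
  intro ε hε
  obtain ⟨δ, hδ, H⟩ := hg ε hε
  refine ⟨δ, hδ, fun I hI hI2 => lt_of_le_of_lt ?_ (H I hI hI2)⟩
  exact Finset.sum_le_sum fun i hi => h _ (hI.1 i hi).1 _ (hI.1 i hi).2

variable {E : Type*} [NormedAddCommGroup E] [NormedSpace ℝ E]

theorem absolutelyContinuousOnInterval_integral {f : ℝ → E} {a b : ℝ}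
    (hf : IntervalIntegrable f volume a b) :
    AbsolutelyContinuousOnInterval (fun x => ∫ s in a..x, f s) a b := by
  refine absolutelyContinuousOnInterval_of_dist_le
    (hf.norm.absolutelyContinuousOnInterval_intervalIntegral (c := a) left_mem_uIcc)
    fun x hx y hy => ?_
  have hs : ∀ z ∈ uIcc a b, IntervalIntegrable f volume a z := fun z hz =>
    hf.mono_set (uIcc_subset_uIcc left_mem_uIcc hz)
  rw [dist_eq_norm, Real.dist_eq, intervalIntegral.integral_interval_sub_left (hs x hx) (hs y hy),
    intervalIntegral.integral_interval_sub_left (hs x hx).norm (hs y hy).norm]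
  exact intervalIntegral.norm_integral_le_abs_integral_norm

variable [CompleteSpace E]

/-- The difference between `f` and the primitive of `f'` is absolutely continuous with derivative
zero almost everywhere, hence constant. -/
theorem eq_add_integral_of_absolutelyContinuous {f f' : ℝ → E} {a b : ℝ}
    (hf : AbsolutelyContinuousOnInterval f a b)
    (hd : ∀ᵐ x, x ∈ uIcc a b → HasDerivAt f (f' x) x)
    (hi : IntervalIntegrable f' volume a b) {x : ℝ} (hx : x ∈ uIcc a b) :
    f x = f a + ∫ s in a..x, f' s := by
  have hac := absolutelyContinuousOnInterval_integral hi
  have g_ac : AbsolutelyContinuousOnInterval (f - fun x => ∫ s in a..x, f' s) a b := hf.sub hac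
  have g0 : ∀ᵐ x, x ∈ uIcc a b → HasDerivAt (f - fun x => ∫ s in a..x, f' s) 0 x := by
    filter_upwards [hd, hi.ae_hasDerivAt_integral] with x h1 h2 h3
    have := (h1 h3).sub (h2 h3 a (by simp))
    simpa using this
  obtain ⟨C, hC⟩ := g_ac.const_of_ae_hasDerivAt_zero g0
  have h1 := hC a (by simp)
  have h2 := hC x hx
  simp only [Pi.sub_apply, intervalIntegral.integral_same, sub_zero] at h1 h2
  rw [← h1] at h2
  rw [← h2]; abel

/-- Integral Gronwall inequality: the right-hand side of the hypothesis is differentiable from the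
right with derivative `K φ`, which is at most `K` times itself, so the differential form applies to
it. -/
theorem le_mul_exp_of_le_add_integral {φ : ℝ → ℝ} {b c K : ℝ}
    (hφ : ContinuousOn φ (Icc 0 b)) (hK : 0 ≤ K)
    (h : ∀ x ∈ Icc 0 b, φ x ≤ c + K * ∫ s in 0..x, φ s) :
    ∀ x ∈ Icc 0 b, φ x ≤ c * Real.exp (K * x) := by
  intro x hx
  have hb : 0 ≤ b := hx.1.trans hx.2
  have hint : IntervalIntegrable φ volume 0 b := by
    apply ContinuousOn.intervalIntegrable; rwa [uIcc_of_le hb]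
  have hG : ContinuousOn (fun x => c + K * ∫ s in 0..x, φ s) (Icc 0 b) := by
    have := intervalIntegral.continuousOn_primitive_interval (a := 0) (b := b) (f := φ)
      (μ := volume) (by rw [uIcc_of_le hb]; exact hφ.integrableOn_compact isCompact_Icc)
    rw [uIcc_of_le hb] at this
    fun_prop
  have key := le_gronwallBound_of_liminf_deriv_right_le (f := fun x => c + K * ∫ s in 0..x, φ s)
    (f' := fun x => K * φ x) (δ := c) (K := K) (ε := 0) (a := 0) (b := b) hG ?_ (by simp) ?_ x hx
  · rw [gronwallBound_ε0, sub_zero] at key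
    exact (h x hx).trans key
  · intro y hy r hr
    have hd : HasDerivWithinAt (fun x => c + K * ∫ s in 0..x, φ s) (K * φ y) (Ici y) y := by
      have h1 : HasDerivWithinAt (fun x => ∫ s in 0..x, φ s) (φ y) (Ici y) y := by
        apply intervalIntegral.integral_hasDerivWithinAt_right (t := Ioi y)
        · exact hint.mono_set (by rw [uIcc_of_le hy.1, uIcc_of_le hb]; exact Icc_subset_Icc le_rfl hy.2.le)
        · refine ⟨Icc y b, ?_, ?_⟩
          · exact mem_of_superset (Ioc_mem_nhdsGT hy.2) Ioc_subset_Icc_self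
          · exact (hφ.mono (Icc_subset_Icc hy.1 le_rfl)).aestronglyMeasurable measurableSet_Icc
        · have := (hφ y ⟨hy.1, hy.2.le⟩)
          exact this.mono_of_mem_nhdsWithin
            (mem_of_superset (Ioc_mem_nhdsGT hy.2) (fun z hz => ⟨hy.1.trans hz.1.le, hz.2⟩))
      exact (h1.const_mul K).const_add c
    have := (hasDerivWithinAt_iff_tendsto_slope' (by simp)).1 (hd.mono Ioi_subset_Ici_self)
    have ev := this.eventually (gt_mem_nhds hr)
    refine ev.frequently.mono ?_
    intro z hz
    simpa [slope_def_field, div_eq_inv_mul] using hz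
  · intro y hy
    have := h y ⟨hy.1, hy.2.le⟩
    rw [add_zero]
    exact mul_le_mul_of_nonneg_left this hK

/-- Picard iterates of the linear integral equation `y = v + ∫ A y`. -/
def picardIterate (A : ℝ → E →L[ℝ] E) (v : E) : ℕ → ℝ → E
  | 0 => fun _ => v
  | n + 1 => fun x => ∫ s in 0..x, A s (picardIterate A v n s)

theorem exists_linear_integral_equation {A : ℝ → E →L[ℝ] E} {b C : ℝ} (hb : 0 ≤ b)
    (hA : AEStronglyMeasurable A (volume.restrict (Icc 0 b)))
    (hC : ∀ x ∈ Icc 0 b, ‖A x‖ ≤ C) (v : E) :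
    ∃ y : ℝ → E, ContinuousOn y (Icc 0 b) ∧
      ∀ x ∈ Icc 0 b, y x = v + ∫ s in 0..x, A s (y s) := by
  have hC0 : 0 ≤ C := (norm_nonneg _).trans (hC 0 ⟨le_rfl, hb⟩)
  set u := picardIterate A v with hu
  have hAu : ∀ w : ℝ → E, ContinuousOn w (Icc 0 b) →
      IntegrableOn (fun s => A s (w s)) (Icc 0 b) := by
    intro w hw
    obtain ⟨M, hM⟩ := isCompact_Icc.exists_bound_of_continuousOn hw
    refine IntegrableOn.of_bound (C := C * M) (by simp) ?_ ?_
    · exact (isBoundedBilinearMap_apply (𝕜 := ℝ) (E := E) (F := E)).continuous.comp_aestronglyMeasurable₂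
        (g := fun (L : E →L[ℝ] E) (w : E) => L w) hA (hw.aestronglyMeasurable measurableSet_Icc)
    · refine (ae_restrict_iff' measurableSet_Icc).2 (Eventually.of_forall fun x hx => ?_)
      exact ((A x).le_opNorm _).trans (mul_le_mul (hC x hx) (hM x hx) (norm_nonneg _) hC0)
  have hcont : ∀ n, ContinuousOn (u n) (Icc 0 b) := by
    intro n
    induction n with
    | zero => exact continuousOn_const
    | succ n ih =>
      have := intervalIntegral.continuousOn_primitive_interval (a := 0) (b := b)
        (f := fun s => A s (u n s)) (μ := volume) (by rw [uIcc_of_le hb]; exact hAu _ ih)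
      rwa [uIcc_of_le hb] at this
  -- The `u n` are the successive terms of the Neumann series, not its partial sums; the factorial
  -- decay makes the series converge uniformly, and its sum is the solution.
  have hbd : ∀ n, ∀ x ∈ Icc 0 b, ‖u n x‖ ≤ ‖v‖ * ((C * x) ^ n / n.factorial) := by
    intro n
    induction n with
    | zero => intro x _; simp [hu, picardIterate]
    | succ n ih =>
      intro x hx
      have h1 : ‖∫ s in 0..x, A s (u n s)‖ ≤
          ∫ s in 0..x, C * (‖v‖ * ((C * s) ^ n / n.factorial)) := by
        apply intervalIntegral.norm_integral_le_of_norm_le hx.1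
        · refine Eventually.of_forall fun s hs => ?_
          have hs' : s ∈ Icc 0 b := ⟨hs.1.le, hs.2.trans hx.2⟩
          exact ((A s).le_opNorm _).trans (mul_le_mul (hC s hs') (ih s hs') (norm_nonneg _) hC0)
        · apply Continuous.intervalIntegrable; fun_prop
      refine h1.trans (le_of_eq ?_)
      have : (fun s : ℝ => C * (‖v‖ * ((C * s) ^ n / n.factorial))) =
          fun s => (C * ‖v‖ * C ^ n / n.factorial) * s ^ n := by
        ext s; rw [mul_pow]; ring
      rw [this, intervalIntegral.integral_const_mul, integral_pow, Nat.factorial_succ]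
      have hn : (n.factorial : ℝ) ≠ 0 := by positivity
      have hn1 : (n : ℝ) + 1 ≠ 0 := by positivity
      push_cast
      field_simp
      ring
  have hsum : Summable fun n : ℕ => ‖v‖ * ((C * b) ^ n / n.factorial) :=
    (Real.summable_pow_div_factorial (C * b)).mul_left _
  have hbd' : ∀ n, ∀ x ∈ Icc 0 b, ‖u n x‖ ≤ ‖v‖ * ((C * b) ^ n / n.factorial) := by
    intro n x hx
    refine (hbd n x hx).trans ?_
    have := mul_le_mul_of_nonneg_left hx.2 hC0
    have h0 : 0 ≤ C * x := mul_nonneg hC0 hx.1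
    gcongr
  have hsx : ∀ x ∈ Icc 0 b, Summable fun n => u n x := fun x hx =>
    Summable.of_norm_bounded hsum (fun n => hbd' n x hx)
  refine ⟨fun x => ∑' n, u n x, continuousOn_tsum hcont hsum hbd', fun x hx => ?_⟩
  have hHS : HasSum (fun n => ∫ s in 0..x, A s (u n s)) (∫ s in 0..x, A s (∑' n, u n s)) := by
    apply intervalIntegral.hasSum_integral_of_dominated_convergence
      (fun n _ => C * (‖v‖ * ((C * b) ^ n / n.factorial)))
    · intro n
      rw [uIoc_of_le hx.1]
      exact ((hAu _ (hcont n)).mono_set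
        (fun s hs => ⟨hs.1.le, hs.2.trans hx.2⟩)).aestronglyMeasurable
    · intro n
      refine Eventually.of_forall fun s hs => ?_
      rw [uIoc_of_le hx.1] at hs
      have hs' : s ∈ Icc 0 b := ⟨hs.1.le, hs.2.trans hx.2⟩
      exact ((A s).le_opNorm _).trans (mul_le_mul (hC s hs') (hbd' n s hs') (norm_nonneg _) hC0)
    · exact Eventually.of_forall fun s _ => hsum.mul_left _
    · exact intervalIntegrable_const
    · refine Eventually.of_forall fun s hs => ?_
      rw [uIoc_of_le hx.1] at hs
      have hs' : s ∈ Icc 0 b := ⟨hs.1.le, hs.2.trans hx.2⟩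
      exact (A s).hasSum (hsx s hs').hasSum
  have h0 := (hsx x hx).tsum_eq_zero_add
  beta_reduce
  rw [h0]
  congr 1
  exact hHS.tsum_eq

theorem intervalIntegrable_of_boundedVariationOn {f : ℝ → ℂ} {a b : ℝ} (hab : a ≤ b)
    (hf : BoundedVariationOn f (Icc a b)) : IntervalIntegrable f volume a b := by
  have aux : ∀ g : ℝ → ℝ, BoundedVariationOn g (Icc a b) → IntervalIntegrable g volume a b := by
    intro g hg
    obtain ⟨u, w, hu, hw, rfl⟩ := hg.locallyBoundedVariationOn.exists_monotoneOn_sub_monotoneOn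
    rw [← uIcc_of_le hab] at hu hw
    exact hu.intervalIntegrable.sub hw.intervalIntegrable
  have hre : BoundedVariationOn (fun x => (f x).re) (Icc a b) :=
    Complex.reCLM.lipschitz.comp_boundedVariationOn hf
  have him : BoundedVariationOn (fun x => (f x).im) (Icc a b) :=
    Complex.imCLM.lipschitz.comp_boundedVariationOn hf
  have h1 : IntervalIntegrable (fun x => ((f x).re : ℂ)) volume a b := 
    ⟨(aux _ hre).1.ofReal, (aux _ hre).2.ofReal⟩
  have h2 : IntervalIntegrable (fun x => ((f x).im : ℂ)) volume a b := 
    ⟨(aux _ him).1.ofReal, (aux _ him).2.ofReal⟩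
  have := h1.add (h2.mul_const Complex.I)
  simpa only [Complex.re_add_im] using this

theorem exists_bound_of_boundedVariationOn {f : ℝ → ℂ} {s : Set ℝ}
    (hf : BoundedVariationOn f s) : ∃ K, ∀ x ∈ s, ‖f x‖ ≤ K := by
  rcases s.eq_empty_or_nonempty with rfl | ⟨a, ha⟩
  · exact ⟨0, by simp⟩
  · refine ⟨‖f a‖ + (eVariationOn f s).toReal, fun x hx => ?_⟩
    have := hf.dist_le hx ha
    rw [dist_eq_norm] at this
    have h2 := norm_sub_norm_le (f x) (f a)
    linarith

/-- Riemann–Lebesgue for complex frequencies, uniform in the subinterval: replace `a` by a smooth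
`g` close to it in `L¹`, then integrate by parts and gain `1/‖c‖`. The exponential need only be
bounded by `1` on the interval of integration; the shift `d` is there so that kernels such as
`e^{2iλ(x-s)}` qualify. -/
theorem exists_norm_integral_exp_mul_le {a : ℝ → ℂ} {b ε : ℝ} (hb : 0 ≤ b) (hε : 0 < ε)
    (ha : IntervalIntegrable a volume 0 b) :
    ∃ R > 0, ∀ c d : ℂ, R ≤ ‖c‖ → ∀ s x : ℝ, 0 ≤ s → s ≤ x → x ≤ b →
      (∀ r ∈ Icc s x, ‖Complex.exp (c * r + d)‖ ≤ 1) →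
      ‖∫ r in s..x, Complex.exp (c * r + d) * a r‖ ≤ ε := by
  have haI : Integrable (indicator (Ioc 0 b) a) volume :=
    (integrable_indicator_iff measurableSet_Ioc).2 ha.1
  obtain ⟨g, hg1, hg2, hg3⟩ := (memLp_one_iff_integrable.2 haI).exist_eLpNorm_sub_le
    ENNReal.one_ne_top le_rfl (half_pos hε)
  have hgd : Differentiable ℝ g := hg2.differentiable (by simp)
  have hgc : Continuous g := hg2.continuous
  have hg'c : Continuous (deriv g) := hg2.continuous_deriv (by simp)
  obtain ⟨G, hG⟩ := isCompact_Icc.exists_bound_of_continuousOn (s := Icc 0 b) hgc.continuousOn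
  obtain ⟨G', hG'⟩ := isCompact_Icc.exists_bound_of_continuousOn (s := Icc 0 b) hg'c.continuousOn
  have hG0 : 0 ≤ G := (norm_nonneg _).trans (hG 0 ⟨le_rfl, hb⟩)
  have hG'0 : 0 ≤ G' := (norm_nonneg _).trans (hG' 0 ⟨le_rfl, hb⟩)
  have hdI : Integrable (indicator (Ioc 0 b) a - g) volume :=
    haI.sub (hgc.integrable_of_hasCompactSupport hg1)
  have hL1 : ∫ x, ‖(indicator (Ioc 0 b) a - g) x‖ ≤ ε / 2 := by
    rw [eLpNorm_one_eq_lintegral_enorm] at hg3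
    rw [integral_norm_eq_lintegral_enorm hdI.aestronglyMeasurable]
    exact ENNReal.toReal_le_of_le_ofReal (half_pos hε).le hg3
  -- Integration by parts leaves `(2G + bG') / ‖c‖`, which must be at most `ε / 2`; the added `1`
  -- only keeps the threshold positive.
  refine ⟨2 * (2 * G + b * G') / ε + 1, by positivity, ?_⟩
  intro c d hc s x hs hsx hxb hexp
  have hc0 : 0 < ‖c‖ := lt_of_lt_of_le (by positivity) hc
  have hcne : c ≠ 0 := norm_pos_iff.1 hc0
  have hIcc : Icc s x ⊆ Icc 0 b := Icc_subset_Icc hs hxb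
  have hai : IntervalIntegrable a volume s x := ha.mono_set (by
    rw [uIcc_of_le hsx, uIcc_of_le hb]; exact hIcc)
  have hgi : IntervalIntegrable g volume s x := hgc.intervalIntegrable _ _
  have hEc : Continuous fun r : ℝ => Complex.exp (c * r + d) := by fun_prop
  have hsplit : ∫ r in s..x, Complex.exp (c * r + d) * a r =
      (∫ r in s..x, Complex.exp (c * r + d) * (a r - g r)) +
        ∫ r in s..x, Complex.exp (c * r + d) * g r := by
    rw [← intervalIntegral.integral_add ((hai.sub hgi).continuousOn_mul hEc.continuousOn)
      (hgi.continuousOn_mul hEc.continuousOn)]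
    congr 1; ext r; ring
  have h1 : ‖∫ r in s..x, Complex.exp (c * r + d) * (a r - g r)‖ ≤ ε / 2 := by
    have e1 : ‖∫ r in s..x, Complex.exp (c * r + d) * (a r - g r)‖ ≤
        ∫ r in s..x, ‖a r - g r‖ := by
      apply intervalIntegral.norm_integral_le_of_norm_le hsx
      · refine Eventually.of_forall fun r hr => ?_
        rw [norm_mul]
        exact mul_le_of_le_one_left (norm_nonneg _) (hexp r ⟨hr.1.le, hr.2⟩)
      · exact (hai.sub hgi).norm
    refine e1.trans (le_trans ?_ hL1)
    rw [intervalIntegral.integral_of_le hsx]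
    have : ∫ r in Ioc s x, ‖a r - g r‖ = ∫ r in Ioc s x, ‖(indicator (Ioc 0 b) a - g) r‖ := by
      refine setIntegral_congr_fun measurableSet_Ioc fun r hr => ?_
      have : r ∈ Ioc 0 b := ⟨hs.trans_lt hr.1, hr.2.trans hxb⟩
      simp [this]
    rw [this]
    exact setIntegral_le_integral hdI.norm (Eventually.of_forall fun _ => norm_nonneg _)
  have hEd : ∀ r : ℝ, HasDerivAt (fun r : ℝ => Complex.exp (c * r + d) / c)
      (Complex.exp (c * r + d)) r := by
    intro r
    have h0 : HasDerivAt (fun r : ℝ => c * (r : ℂ) + d) c r := by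
      simpa using ((Complex.ofRealCLM.hasDerivAt (x := r)).const_mul c).add_const d
    have := (h0.cexp).div_const c
    rwa [mul_div_assoc, div_self hcne, mul_one] at this
  have h2 : ∫ r in s..x, Complex.exp (c * r + d) * g r =
      Complex.exp (c * x + d) / c * g x - Complex.exp (c * s + d) / c * g s -
        ∫ r in s..x, Complex.exp (c * r + d) / c * deriv g r := by
    have := intervalIntegral.integral_mul_deriv_eq_deriv_mul (a := s) (b := x)
      (u := g) (u' := deriv g) (fun r _ => (hgd r).hasDerivAt) (fun r _ => hEd r)
      (hg'c.intervalIntegrable _ _) (hEc.intervalIntegrable _ _)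
    simpa only [mul_comm] using this
  have h3 : ‖∫ r in s..x, Complex.exp (c * r + d) * g r‖ ≤ (2 * G + b * G') / ‖c‖ := by
    have bE : ∀ r ∈ Icc s x, ‖Complex.exp (c * r + d) / c‖ ≤ 1 / ‖c‖ := by
      intro r hr
      rw [norm_div]
      exact div_le_div_of_nonneg_right (hexp r hr) hc0.le
    have b1 : ∀ r ∈ Icc s x, ‖Complex.exp (c * r + d) / c * g r‖ ≤ 1 / ‖c‖ * G := by
      intro r hr
      rw [norm_mul]
      exact mul_le_mul (bE r hr) (hG r (hIcc hr)) (norm_nonneg _) (by positivity)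
    have b2 : ‖∫ r in s..x, Complex.exp (c * r + d) / c * deriv g r‖ ≤
        1 / ‖c‖ * G' * |x - s| := by
      apply intervalIntegral.norm_integral_le_of_norm_le_const
      intro r hr
      rw [uIoc_of_le hsx] at hr
      have hr' : r ∈ Icc s x := ⟨hr.1.le, hr.2⟩
      rw [norm_mul]
      exact mul_le_mul (bE r hr') (hG' r (hIcc hr')) (norm_nonneg _) (by positivity)
    have b3 : 1 / ‖c‖ * G' * |x - s| ≤ 1 / ‖c‖ * G' * b := by
      rw [abs_of_nonneg (by linarith)]
      have : x - s ≤ b := by linarith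
      gcongr
    rw [h2]
    have t1 := norm_sub_le (Complex.exp (c * x + d) / c * g x - Complex.exp (c * s + d) / c * g s)
      (∫ r in s..x, Complex.exp (c * r + d) / c * deriv g r)
    have t2 := norm_sub_le (Complex.exp (c * x + d) / c * g x) (Complex.exp (c * s + d) / c * g s)
    have t3 := b1 x ⟨hsx, le_rfl⟩
    have t4 := b1 s ⟨le_rfl, hsx⟩
    have : (2 * G + b * G') / ‖c‖ = 1 / ‖c‖ * G + 1 / ‖c‖ * G + 1 / ‖c‖ * G' * b := by ring
    rw [this]
    linarith
  have h4 : (2 * G + b * G') / ‖c‖ ≤ ε / 2 := by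
    rw [div_le_iff₀ hc0]
    have : 2 * (2 * G + b * G') / ε ≤ ‖c‖ := by linarith
    rw [div_le_iff₀ hε] at this
    linarith
  rw [hsplit]
  exact (norm_add_le _ _).trans (by linarith)

end Toolkit

/-! ### Existence, uniqueness and the Lagrange identity for the Dirac system -/

section Solutions

/-- Interval integrable and bounded coefficients on `[0, π]`. -/
structure RegularCoeff (p q : ℝ → ℂ) : Prop where
  intervalIntegrable_p : IntervalIntegrable p volume 0 Real.pi
  intervalIntegrable_q : IntervalIntegrable q volume 0 Real.pi
  bound_p : ∃ K, ∀ x ∈ Icc 0 Real.pi, ‖p x‖ ≤ K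
  bound_q : ∃ K, ∀ x ∈ Icc 0 Real.pi, ‖q x‖ ≤ K

theorem regularCoeff_of_boundedVariationOn {p q : ℝ → ℂ}
    (hp : BoundedVariationOn p (Icc 0 Real.pi)) (hq : BoundedVariationOn q (Icc 0 Real.pi)) :
    RegularCoeff p q :=
  ⟨intervalIntegrable_of_boundedVariationOn Real.pi_pos.le hp,
    intervalIntegrable_of_boundedVariationOn Real.pi_pos.le hq,
    exists_bound_of_boundedVariationOn hp, exists_bound_of_boundedVariationOn hq⟩

/-- The real-linear operator of multiplication by a complex matrix. -/
def matrixCLM (M : Matrix (Fin 2) (Fin 2) ℂ) : (Fin 2 → ℂ) →L[ℝ] (Fin 2 → ℂ) :=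
  LinearMap.toContinuousLinearMap ((Matrix.toLin' M).restrictScalars ℝ)

theorem matrixCLM_apply (M : Matrix (Fin 2) (Fin 2) ℂ) (v : Fin 2 → ℂ) :
    matrixCLM M v = M *ᵥ v := by
  simp [matrixCLM]

/-- The operator `v ↦ -J (mu - Q(x)) v`: solutions satisfy `y' = coeff y`. -/
def coeff (p q : ℝ → ℂ) (mu : ℂ) (x : ℝ) : (Fin 2 → ℂ) →L[ℝ] (Fin 2 → ℂ) :=
  p x • matrixCLM !![0, -1; -1, 0] + q x • matrixCLM !![1, 0; 0, -1] +
    mu • matrixCLM !![0, -1; 1, 0]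

theorem coeff_apply (p q : ℝ → ℂ) (mu : ℂ) (x : ℝ) (v : Fin 2 → ℂ) :
    coeff p q mu x v =
      ![-mu * v 1 + q x * v 0 - p x * v 1, mu * v 0 - p x * v 0 - q x * v 1] := by
  ext i
  fin_cases i <;> simp [coeff, matrixCLM_apply, dotProduct, Fin.sum_univ_two] <;> ring

theorem eqn_iff (p q : ℝ → ℂ) (mu : ℂ) (x : ℝ) (v v' : Fin 2 → ℂ) :
    J *ᵥ v' + potential p q x *ᵥ v = mu • v ↔ v' = coeff p q mu x v := by
  rw [coeff_apply]
  constructor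
  · intro h
    have h0 := congrFun h 0
    have h1 := congrFun h 1
    simp [J, potential, dotProduct, Fin.sum_univ_two] at h0 h1
    ext i
    fin_cases i
    · simp; linear_combination -h1
    · simp; linear_combination h0
  · rintro rfl
    ext i
    fin_cases i <;> simp [J, potential, dotProduct, Fin.sum_univ_two] <;> ring

variable {p q : ℝ → ℂ}

theorem norm_smul_add_smul_add_smul_le {V : Type*} [SeminormedAddCommGroup V] [NormedSpace ℂ V]
    {a b c : ℂ} {A B : ℝ} (u v w : V) (ha : ‖a‖ ≤ A) (hb : ‖b‖ ≤ B) :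
    ‖a • u + b • v + c • w‖ ≤ (A * ‖u‖ + B * ‖v‖ + ‖w‖ + 1) * (1 + ‖c‖) := by
  have h := norm_add₃_le (a := a • u) (b := b • v) (c := c • w)
  rw [norm_smul, norm_smul, norm_smul] at h
  have h1 := mul_le_mul_of_nonneg_right ha (norm_nonneg u)
  have h2 := mul_le_mul_of_nonneg_right hb (norm_nonneg v)
  have h3 : 0 ≤ (A * ‖u‖ + B * ‖v‖) * ‖c‖ := by
    have := (norm_nonneg a).trans ha
    have := (norm_nonneg b).trans hb
    positivity
  nlinarith [norm_nonneg c, norm_nonneg w]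

theorem RegularCoeff.exists_norm_coeff_le (hpq : RegularCoeff p q) :
    ∃ κ > 0, ∀ mu : ℂ, ∀ x ∈ Icc 0 Real.pi, ‖coeff p q mu x‖ ≤ κ * (1 + ‖mu‖) := by
  obtain ⟨K, hK⟩ := hpq.bound_p
  obtain ⟨L, hL⟩ := hpq.bound_q
  refine ⟨|K| * ‖matrixCLM !![0, -1; -1, 0]‖ + |L| * ‖matrixCLM !![1, 0; 0, -1]‖ +
    ‖matrixCLM !![0, -1; 1, 0]‖ + 1, ?_, fun mu x hx => ?_⟩
  · have := norm_nonneg (matrixCLM !![0, -1; -1, 0])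
    have := norm_nonneg (matrixCLM !![1, 0; 0, -1])
    have := norm_nonneg (matrixCLM !![0, -1; 1, 0])
    positivity
  · exact norm_smul_add_smul_add_smul_le _ _ _ ((hK x hx).trans (le_abs_self _))
      ((hL x hx).trans (le_abs_self _))

theorem RegularCoeff.aestronglyMeasurable_coeff (hpq : RegularCoeff p q) (mu : ℂ) :
    AEStronglyMeasurable (coeff p q mu) (volume.restrict (Icc 0 Real.pi)) := by
  have h : ∀ f : ℝ → ℂ, IntervalIntegrable f volume 0 Real.pi →
      AEStronglyMeasurable f (volume.restrict (Icc 0 Real.pi)) := by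
    intro f hf
    rw [intervalIntegrable_iff_integrableOn_Icc_of_le Real.pi_pos.le] at hf
    exact hf.aestronglyMeasurable
  exact (((h p hpq.1).smul_const _).add ((h q hpq.2).smul_const _)).add aestronglyMeasurable_const

theorem RegularCoeff.intervalIntegrable_coeff_apply (hpq : RegularCoeff p q) (mu : ℂ)
    {y : ℝ → Fin 2 → ℂ} (hy : ContinuousOn y (Icc 0 Real.pi)) :
    IntervalIntegrable (fun s => coeff p q mu s (y s)) volume 0 Real.pi := by
  obtain ⟨κ, hκ, hb⟩ := hpq.exists_norm_coeff_le
  obtain ⟨M, hM⟩ := isCompact_Icc.exists_bound_of_continuousOn hy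
  rw [intervalIntegrable_iff_integrableOn_Icc_of_le Real.pi_pos.le]
  refine IntegrableOn.of_bound (C := κ * (1 + ‖mu‖) * M) (by simp) ?_ ?_
  · exact (isBoundedBilinearMap_apply (𝕜 := ℝ) (E := Fin 2 → ℂ)
      (F := Fin 2 → ℂ)).continuous.comp_aestronglyMeasurable₂
        (g := fun (L : (Fin 2 → ℂ) →L[ℝ] (Fin 2 → ℂ)) (w : Fin 2 → ℂ) => L w)
        (hpq.aestronglyMeasurable_coeff mu) (hy.aestronglyMeasurable measurableSet_Icc)
  · refine (ae_restrict_iff' measurableSet_Icc).2 (Eventually.of_forall fun x hx => ?_)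
    exact ((coeff p q mu x).le_opNorm _).trans
      (mul_le_mul (hb mu x hx) (hM x hx) (norm_nonneg _) (by positivity))

theorem IsSolution.continuousOn {mu : ℂ} {y : ℝ → Fin 2 → ℂ} (hy : IsSolution p q mu y) :
    ContinuousOn y (Icc 0 Real.pi) := by
  have := hy.ac.continuousOn
  rwa [uIcc_of_le Real.pi_pos.le] at this

theorem IsSolution.ae_hasDerivAt {mu : ℂ} {y : ℝ → Fin 2 → ℂ} (hy : IsSolution p q mu y) :
    ∀ᵐ x, x ∈ uIcc 0 Real.pi → HasDerivAt y (coeff p q mu x (y x)) x := by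
  have := (ae_restrict_iff' measurableSet_Icc).1 hy.eqn
  rw [uIcc_of_le Real.pi_pos.le]
  filter_upwards [this] with x hx hx'
  obtain ⟨y', h1, h2⟩ := hx hx'
  rwa [← (eqn_iff p q mu x (y x) y').1 h2]

theorem IsSolution.eq_add_integral {mu : ℂ} {y : ℝ → Fin 2 → ℂ} (hpq : RegularCoeff p q)
    (hy : IsSolution p q mu y) {x : ℝ} (hx : x ∈ Icc 0 Real.pi) :
    y x = y 0 + ∫ s in 0..x, coeff p q mu s (y s) :=
  eq_add_integral_of_absolutelyContinuous hy.ac hy.ae_hasDerivAt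
    (hpq.intervalIntegrable_coeff_apply mu hy.continuousOn)
    (by rwa [uIcc_of_le Real.pi_pos.le])

theorem isSolution_of_eq_add_integral {mu : ℂ} {y : ℝ → Fin 2 → ℂ} {v : Fin 2 → ℂ}
    (hpq : RegularCoeff p q) (hy : ContinuousOn y (Icc 0 Real.pi))
    (h : ∀ x ∈ Icc 0 Real.pi, y x = v + ∫ s in 0..x, coeff p q mu s (y s)) :
    IsSolution p q mu y := by
  have hi := hpq.intervalIntegrable_coeff_apply mu hy
  constructor
  · refine absolutelyContinuousOnInterval_of_dist_le
      (absolutelyContinuousOnInterval_integral hi) fun a ha b hb => ?_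
    rw [uIcc_of_le Real.pi_pos.le] at ha hb
    rw [h a ha, h b hb, dist_add_left]
  -- The integral equation says nothing about `y` outside `[0, π]`, while `HasDerivAt` is two-sided;
  -- discarding the two endpoints costs only a null set.
  · have hne : ∀ c : ℝ, ∀ᵐ x : ℝ, x ≠ c := fun c => by simp [ae_iff, measure_singleton]
    rw [ae_restrict_iff' measurableSet_Icc]
    filter_upwards [hi.ae_hasDerivAt_integral, hne 0, hne Real.pi] with x hx h0 hpi hxI
    have hxo : x ∈ Ioo 0 Real.pi := ⟨lt_of_le_of_ne hxI.1 h0.symm, lt_of_le_of_ne hxI.2 hpi⟩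
    refine ⟨_, ?_, (eqn_iff p q mu x (y x) _).2 rfl⟩
    have hd := (hx (by rwa [uIcc_of_le Real.pi_pos.le]) 0 left_mem_uIcc).const_add v
    refine hd.congr_of_eventuallyEq ?_
    filter_upwards [Ioo_mem_nhds hxo.1 hxo.2] with z hz
    exact h z ⟨hz.1.le, hz.2.le⟩

theorem RegularCoeff.exists_isSolution (hpq : RegularCoeff p q) (mu : ℂ) (v : Fin 2 → ℂ) :
    ∃ y, IsSolution p q mu y ∧ y 0 = v := by
  obtain ⟨κ, hκ, hb⟩ := hpq.exists_norm_coeff_le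
  obtain ⟨y, hy, h⟩ := exists_linear_integral_equation Real.pi_pos.le
    (hpq.aestronglyMeasurable_coeff mu) (hb mu) v
  refine ⟨y, isSolution_of_eq_add_integral hpq hy h, ?_⟩
  rw [h 0 ⟨le_rfl, Real.pi_pos.le⟩]
  simp

theorem RegularCoeff.exists_norm_solution_le (hpq : RegularCoeff p q) :
    ∃ κ > 0, ∀ (mu : ℂ) (y : ℝ → Fin 2 → ℂ), IsSolution p q mu y → ∀ x ∈ Icc 0 Real.pi,
      ‖y x‖ ≤ ‖y 0‖ * Real.exp (κ * (1 + ‖mu‖)) := by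
  obtain ⟨κ, hκ, hb⟩ := hpq.exists_norm_coeff_le
  refine ⟨κ * Real.pi, mul_pos hκ Real.pi_pos, fun mu y hy x hx => ?_⟩
  have hnc : ContinuousOn (fun x => ‖y x‖) (Icc 0 Real.pi) := hy.continuousOn.norm
  have := le_mul_exp_of_le_add_integral (K := κ * (1 + ‖mu‖)) (c := ‖y 0‖) hnc (by positivity)
    (fun x hx => ?_) x hx
  · refine this.trans ?_
    have : κ * (1 + ‖mu‖) * x ≤ κ * (1 + ‖mu‖) * Real.pi :=
      mul_le_mul_of_nonneg_left hx.2 (by positivity)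
    exact mul_le_mul_of_nonneg_left (Real.exp_le_exp.2 (by linarith)) (norm_nonneg _)
  · rw [hy.eq_add_integral hpq hx]
    refine (norm_add_le _ _).trans ?_
    gcongr
    rw [← intervalIntegral.integral_const_mul]
    apply intervalIntegral.norm_integral_le_of_norm_le hx.1
    · refine Eventually.of_forall fun s hs => ?_
      exact ((coeff p q mu s).le_opNorm _).trans (mul_le_mul_of_nonneg_right
        (hb mu s ⟨hs.1.le, hs.2.trans hx.2⟩) (norm_nonneg _))
    · apply ContinuousOn.intervalIntegrable
      rw [uIcc_of_le hx.1]
      exact (hnc.mono (Icc_subset_Icc le_rfl hx.2)).const_mul _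

theorem IsSolution.add {mu : ℂ} {y z : ℝ → Fin 2 → ℂ} (hy : IsSolution p q mu y)
    (hz : IsSolution p q mu z) : IsSolution p q mu (fun x => y x + z x) := by
  refine ⟨hy.ac.add hz.ac, ?_⟩
  filter_upwards [hy.eqn, hz.eqn] with x ⟨y', h1, h2⟩ ⟨z', h3, h4⟩
  refine ⟨y' + z', h1.add h3, ?_⟩
  rw [Matrix.mulVec_add, Matrix.mulVec_add, smul_add, ← h2, ← h4]
  abel

theorem IsSolution.smul {mu : ℂ} {y : ℝ → Fin 2 → ℂ} (c : ℂ) (hy : IsSolution p q mu y) :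
    IsSolution p q mu (fun x => c • y x) := by
  refine ⟨hy.ac.const_smul c, ?_⟩
  filter_upwards [hy.eqn] with x ⟨y', h1, h2⟩
  refine ⟨c • y', h1.const_smul c, ?_⟩
  rw [Matrix.mulVec_smul, Matrix.mulVec_smul, ← smul_add, h2, smul_comm]

/-- The difference solves the same system with zero initial value, and the Gronwall bound forces it
to vanish. -/
theorem IsSolution.eqOn (hpq : RegularCoeff p q) {mu : ℂ} {y z : ℝ → Fin 2 → ℂ}
    (hy : IsSolution p q mu y) (hz : IsSolution p q mu z) (h : y 0 = z 0) :
    EqOn y z (Icc 0 Real.pi) := by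
  obtain ⟨κ, -, hb⟩ := hpq.exists_norm_solution_le
  intro x hx
  have := hb mu _ (hy.add (hz.smul (-1))) x hx
  rw [h] at this
  simp only [neg_smul, one_smul, add_neg_cancel, norm_zero, zero_mul, norm_le_zero_iff] at this
  exact add_neg_eq_zero.1 this

theorem RegularCoeff.solution_spec (hpq : RegularCoeff p q) (mu : ℂ) (v : Fin 2 → ℂ) :
    IsSolution p q mu (solution p q mu v) ∧ solution p q mu v 0 = v :=
  Classical.epsilon_spec (hpq.exists_isSolution mu v)

theorem RegularCoeff.isSolution_cSol (hpq : RegularCoeff p q) (mu : ℂ) :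
    IsSolution p q mu (cSol p q mu) := (hpq.solution_spec mu _).1

theorem RegularCoeff.isSolution_sSol (hpq : RegularCoeff p q) (mu : ℂ) :
    IsSolution p q mu (sSol p q mu) := (hpq.solution_spec mu _).1

theorem RegularCoeff.cSol_zero (hpq : RegularCoeff p q) (mu : ℂ) :
    cSol p q mu 0 = ![1, 0] := (hpq.solution_spec mu _).2

theorem RegularCoeff.sSol_zero (hpq : RegularCoeff p q) (mu : ℂ) :
    sSol p q mu 0 = ![0, 1] := (hpq.solution_spec mu _).2

theorem IsSolution.eq_smul_add_smul (hpq : RegularCoeff p q) {mu : ℂ} {y : ℝ → Fin 2 → ℂ}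
    (hy : IsSolution p q mu y) {x : ℝ} (hx : x ∈ Icc 0 Real.pi) :
    y x = y 0 0 • cSol p q mu x + y 0 1 • sSol p q mu x := by
  refine hy.eqOn hpq (((hpq.isSolution_cSol mu).smul (y 0 0)).add
    ((hpq.isSolution_sSol mu).smul (y 0 1))) ?_ hx
  ext i
  fin_cases i <;> simp [hpq.cSol_zero, hpq.sSol_zero]

theorem AbsolutelyContinuousOnInterval.apply_fin {y : ℝ → Fin 2 → ℂ} {a b : ℝ}
    (hy : AbsolutelyContinuousOnInterval y a b) (i : Fin 2) :
    AbsolutelyContinuousOnInterval (fun x => y x i) a b :=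
  absolutelyContinuousOnInterval_of_dist_le hy fun _ _ _ _ => dist_le_pi_dist _ _ i

/-- Because `Q` is symmetric, it cancels from the derivative of the Wronskian, leaving only the
difference of the spectral parameters. -/
theorem IsSolution.lagrange_identity {la mu : ℂ} {y z : ℝ → Fin 2 → ℂ}
    (hy : IsSolution p q la y) (hz : IsSolution p q mu z) {x : ℝ} (hx : x ∈ Icc 0 Real.pi) :
    y x 0 * z x 1 - y x 1 * z x 0 = y 0 0 * z 0 1 - y 0 1 * z 0 0 +
      (mu - la) * ∫ s in 0..x, (y s 0 * z s 0 + y s 1 * z s 1) := by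
  have acy := fun i => AbsolutelyContinuousOnInterval.apply_fin hy.ac i
  have acz := fun i => AbsolutelyContinuousOnInterval.apply_fin hz.ac i
  have ac : AbsolutelyContinuousOnInterval (fun x => y x 0 * z x 1 - y x 1 * z x 0) 0 Real.pi :=
    ((acy 0).smul (acz 1)).sub ((acy 1).smul (acz 0))
  rw [← intervalIntegral.integral_const_mul]
  refine eq_add_integral_of_absolutelyContinuous
    (f' := fun s => (mu - la) * (y s 0 * z s 0 + y s 1 * z s 1)) ac ?_ ?_
    (by rwa [uIcc_of_le Real.pi_pos.le])
  · filter_upwards [hy.ae_hasDerivAt, hz.ae_hasDerivAt] with s h1 h2 hs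
    have d1 := fun i => hasDerivAt_pi.1 (h1 hs) i
    have d2 := fun i => hasDerivAt_pi.1 (h2 hs) i
    have := ((d1 0).mul (d2 1)).sub ((d1 1).mul (d2 0))
    refine this.congr_deriv ?_
    simp only [coeff_apply, Matrix.cons_val_zero, Matrix.cons_val_one]
    ring
  · apply ContinuousOn.intervalIntegrable
    rw [uIcc_of_le Real.pi_pos.le]
    have cy := fun i => continuousOn_pi.1 hy.continuousOn i
    have cz := fun i => continuousOn_pi.1 hz.continuousOn i
    exact (((cy 0).mul (cz 0)).add ((cy 1).mul (cz 1))).const_mul _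

/-- This brings eigenfunctions of the adjoint back to solutions of the original system, so that
inner products against them become bilinear pairings of solutions with one common parameter. -/
theorem IsSolution.conj {mu : ℂ} {y : ℝ → Fin 2 → ℂ}
    (hy : IsSolution (fun x => conj (p x)) (fun x => conj (q x)) (conj mu) y) :
    IsSolution p q mu (fun x i => conj (y x i)) := by
  constructor
  · refine absolutelyContinuousOnInterval_of_dist_le hy.ac fun a _ b _ => le_of_eq ?_
    simp only [dist_pi_def]
    congr 2
    ext i
    simp [nndist_eq_nnnorm, ← map_sub]
  · filter_upwards [hy.eqn] with x ⟨y', h1, h2⟩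
    refine ⟨fun i => conj (y' i), ?_, ?_⟩
    · rw [hasDerivAt_pi] at h1 ⊢
      exact fun i => (h1 i).star
    · have h2' := (eqn_iff _ _ _ _ _ _).1 h2
      rw [eqn_iff, h2']
      ext i
      fin_cases i <;> simp [coeff_apply]

end Solutions

/-! ### Dependence on the spectral parameter, the discriminant and multiplicities -/

section Floquet

variable {p q : ℝ → ℂ}

/-- The bilinear pairing of two vector functions over `[0, x]`. -/
def pairing (y z : ℝ → Fin 2 → ℂ) (x : ℝ) : ℂ :=
  ∫ s in 0..x, (y s 0 * z s 0 + y s 1 * z s 1)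

theorem pairing_comm (y z : ℝ → Fin 2 → ℂ) (x : ℝ) : pairing y z x = pairing z y x := by
  simp only [pairing, mul_comm]

theorem RegularCoeff.wronskian_eq_one (hpq : RegularCoeff p q) (mu : ℂ) {x : ℝ}
    (hx : x ∈ Icc 0 Real.pi) :
    cSol p q mu x 0 * sSol p q mu x 1 - cSol p q mu x 1 * sSol p q mu x 0 = 1 := by
  have := (hpq.isSolution_cSol mu).lagrange_identity (hpq.isSolution_sSol mu) hx
  simpa [hpq.cSol_zero, hpq.sSol_zero] using this

/-- The Lagrange identity against `c(·, la)` and `s(·, la)` gives two linear equations for `y x`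
with determinant one. The result is an exact difference formula in the parameter, from which both
Lipschitz continuity and differentiability are read off. -/
theorem IsSolution.variation_of_constants (hpq : RegularCoeff p q) {la mu : ℂ}
    {y : ℝ → Fin 2 → ℂ} (hy : IsSolution p q mu y) {x : ℝ} (hx : x ∈ Icc 0 Real.pi) :
    y x = y 0 0 • cSol p q la x + y 0 1 • sSol p q la x + (mu - la) •
      (pairing (cSol p q la) y x • sSol p q la x - pairing (sSol p q la) y x • cSol p q la x) := by
  have h1 := (hpq.isSolution_cSol la).lagrange_identity hy hx
  have h2 := (hpq.isSolution_sSol la).lagrange_identity hy hx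
  have hW := hpq.wronskian_eq_one la hx
  simp only [hpq.cSol_zero, hpq.sSol_zero, Matrix.cons_val_zero, Matrix.cons_val_one] at h1 h2
  change _ = _ + _ * pairing (cSol p q la) y x at h1
  change _ = _ + _ * pairing (sSol p q la) y x at h2
  ext i
  fin_cases i
  · simp
    linear_combination sSol p q la x 0 * h1 - cSol p q la x 0 * h2 - y x 0 * hW
  · simp
    linear_combination sSol p q la x 1 * h1 - cSol p q la x 1 * h2 - y x 1 * hW

theorem norm_pairing_le {y z : ℝ → Fin 2 → ℂ} {B C x : ℝ} (hB : 0 ≤ B)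
    (hy : ∀ s ∈ Icc 0 Real.pi, ‖y s‖ ≤ B) (hz : ∀ s ∈ Icc 0 Real.pi, ‖z s‖ ≤ C)
    (hx : x ∈ Icc 0 Real.pi) : ‖pairing y z x‖ ≤ 2 * B * C * Real.pi := by
  have hC : 0 ≤ C := (norm_nonneg _).trans (hz x hx)
  refine (intervalIntegral.norm_integral_le_of_norm_le_const (C := 2 * B * C) ?_).trans ?_
  · intro s hs
    rw [uIoc_of_le hx.1] at hs
    have hs' : s ∈ Icc 0 Real.pi := ⟨hs.1.le, hs.2.trans hx.2⟩
    have hm : ∀ i, ‖y s i * z s i‖ ≤ B * C := fun i => by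
      rw [norm_mul]
      exact mul_le_mul ((norm_le_pi_norm _ i).trans (hy s hs'))
        ((norm_le_pi_norm _ i).trans (hz s hs')) (norm_nonneg _) hB
    have := norm_add_le (y s 0 * z s 0) (y s 1 * z s 1)
    linarith [hm 0, hm 1]
  · rw [sub_zero, abs_of_nonneg hx.1]
    exact mul_le_mul_of_nonneg_left hx.2 (by positivity)

theorem RegularCoeff.exists_norm_solution_bound (hpq : RegularCoeff p q) (R : ℝ) :
    ∃ B > 0, ∀ (mu : ℂ), ‖mu‖ ≤ R → ∀ (y : ℝ → Fin 2 → ℂ), IsSolution p q mu y →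
      ∀ x ∈ Icc 0 Real.pi, ‖y x‖ ≤ ‖y 0‖ * B := by
  obtain ⟨κ, hκ, hb⟩ := hpq.exists_norm_solution_le
  refine ⟨Real.exp (κ * (1 + R)), Real.exp_pos _, fun mu hmu y hy x hx => ?_⟩
  refine (hb mu y hy x hx).trans (mul_le_mul_of_nonneg_left (Real.exp_le_exp.2 ?_) (norm_nonneg _))
  gcongr

theorem RegularCoeff.exists_norm_fundamental_le (hpq : RegularCoeff p q) (R : ℝ) :
    ∃ B > 0, ∀ (mu : ℂ), ‖mu‖ ≤ R → ∀ x ∈ Icc 0 Real.pi,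
      ‖cSol p q mu x‖ ≤ B ∧ ‖sSol p q mu x‖ ≤ B := by
  obtain ⟨B, hB, hb⟩ := hpq.exists_norm_solution_bound R
  have h1 : ‖(![1, 0] : Fin 2 → ℂ)‖ = 1 := by
    simp [Pi.norm_def, Fin.univ_succ]
  have h2 : ‖(![0, 1] : Fin 2 → ℂ)‖ = 1 := by
    simp [Pi.norm_def, Fin.univ_succ]
  refine ⟨B, hB, fun mu hmu x hx => ⟨?_, ?_⟩⟩
  · simpa [hpq.cSol_zero, h1] using hb mu hmu _ (hpq.isSolution_cSol mu) x hx
  · simpa [hpq.sSol_zero, h2] using hb mu hmu _ (hpq.isSolution_sSol mu) x hx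

theorem RegularCoeff.exists_norm_solution_sub_le (hpq : RegularCoeff p q) (v : Fin 2 → ℂ) (R : ℝ) :
    ∃ C > 0, ∀ la mu : ℂ, ‖la‖ ≤ R → ‖mu‖ ≤ R → ∀ x ∈ Icc 0 Real.pi,
      ‖solution p q mu v x - solution p q la v x‖ ≤ C * ‖mu - la‖ := by
  obtain ⟨B, hB, hb⟩ := hpq.exists_norm_solution_bound R
  obtain ⟨D, hD, hd⟩ := hpq.exists_norm_fundamental_le R
  refine ⟨2 * (2 * D * (‖v‖ * B) * Real.pi * D) + 1, by positivity, fun la mu hla hmu x hx => ?_⟩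
  obtain ⟨hs, h0⟩ := hpq.solution_spec mu v
  obtain ⟨hs', h0'⟩ := hpq.solution_spec la v
  have e1 := hs.variation_of_constants hpq (la := la) hx
  have e2 := hs'.eq_smul_add_smul hpq hx
  rw [h0] at e1
  rw [h0'] at e2
  rw [e1, e2, add_sub_cancel_left, norm_smul, mul_comm]
  refine mul_le_mul_of_nonneg_right ?_ (norm_nonneg _)
  have hyb : ∀ s ∈ Icc 0 Real.pi, ‖solution p q mu v s‖ ≤ ‖v‖ * B := fun s hs2 => by
    simpa [h0] using hb mu hmu _ hs s hs2
  have p1 := norm_pairing_le hD.le (fun s hs => (hd la hla s hs).1) hyb hx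
  have p2 := norm_pairing_le hD.le (fun s hs => (hd la hla s hs).2) hyb hx
  refine (norm_sub_le _ _).trans ?_
  rw [norm_smul, norm_smul]
  have := mul_le_mul p1 (hd la hla x hx).2 (norm_nonneg _) (by positivity)
  have := mul_le_mul p2 (hd la hla x hx).1 (norm_nonneg _) (by positivity)
  linarith

/-- The nearest point of `[0, π]`. -/
def clamp (x : ℝ) : ℝ := projIcc 0 Real.pi Real.pi_pos.le x

theorem continuous_clamp : Continuous clamp := continuous_subtype_val.comp continuous_projIcc

theorem clamp_mem (x : ℝ) : clamp x ∈ Icc 0 Real.pi := (projIcc 0 Real.pi Real.pi_pos.le x).2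

theorem clamp_of_mem {x : ℝ} (hx : x ∈ Icc 0 Real.pi) : clamp x = x := by
  simp [clamp, projIcc_of_mem _ hx]

/-- Clamping the space variable gives a function continuous on all of `ℂ × ℝ`, as the continuity
theorem for parametric integrals demands, without changing any integral over `[0, π]`. The proof
combines the Lipschitz bound in the parameter with continuity in space at a fixed parameter. -/
theorem RegularCoeff.continuous_solution_clamp (hpq : RegularCoeff p q) (v : Fin 2 → ℂ) :
    Continuous fun z : ℂ × ℝ => solution p q z.1 v (clamp z.2) := by
  rw [continuous_iff_continuousAt]
  rintro ⟨la, x⟩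
  obtain ⟨C, hC, hb⟩ := hpq.exists_norm_solution_sub_le v (‖la‖ + 1)
  rw [ContinuousAt, tendsto_iff_norm_sub_tendsto_zero]
  have hcl : Continuous fun z : ℂ × ℝ => solution p q la v (clamp z.2) :=
    (hpq.solution_spec la v).1.continuousOn.comp_continuous (continuous_clamp.comp continuous_snd)
      fun _ => clamp_mem _
  have hlim : Tendsto (fun z : ℂ × ℝ => C * ‖z.1 - la‖ +
      ‖solution p q la v (clamp z.2) - solution p q la v (clamp x)‖) (𝓝 (la, x)) (𝓝 0) := by
    have : Continuous fun z : ℂ × ℝ => C * ‖z.1 - la‖ +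
      ‖solution p q la v (clamp z.2) - solution p q la v (clamp x)‖ := by fun_prop
    simpa using this.tendsto (la, x)
  have hev : ∀ᶠ z : ℂ × ℝ in 𝓝 (la, x), ‖z.1‖ ≤ ‖la‖ + 1 := by
    have h1 : Tendsto (fun z : ℂ × ℝ => ‖z.1‖) (𝓝 (la, x)) (𝓝 ‖la‖) :=
      (continuous_fst.norm).tendsto (la, x)
    exact (h1.eventually (gt_mem_nhds (by linarith : ‖la‖ < ‖la‖ + 1))).mono fun _ h => h.le
  refine squeeze_zero' (Eventually.of_forall fun _ => norm_nonneg _) ?_ hlim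
  filter_upwards [hev] with z hz
  have h1 := hb la z.1 (by linarith) hz (clamp z.2) (clamp_mem _)
  have h2 := norm_add_le (solution p q z.1 v (clamp z.2) - solution p q la v (clamp z.2))
    (solution p q la v (clamp z.2) - solution p q la v (clamp x))
  rw [sub_add_sub_cancel] at h2
  linarith

theorem pairing_eq_clamp (y z : ℝ → Fin 2 → ℂ) {x : ℝ} (hx : x ∈ Icc 0 Real.pi) :
    pairing y z x = ∫ s in 0..x, (y (clamp s) 0 * z (clamp s) 0 + y (clamp s) 1 * z (clamp s) 1) := by
  refine intervalIntegral.integral_congr fun s hs => ?_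
  rw [uIcc_of_le hx.1] at hs
  simp only [clamp_of_mem ⟨hs.1, hs.2.trans hx.2⟩]

theorem RegularCoeff.continuous_pairing (hpq : RegularCoeff p q) (la : ℂ) (v w : Fin 2 → ℂ) {x : ℝ}
    (hx : x ∈ Icc 0 Real.pi) :
    Continuous fun mu => pairing (solution p q la v) (solution p q mu w) x := by
  simp only [pairing_eq_clamp _ _ hx]
  apply intervalIntegral.continuous_parametric_intervalIntegral_of_continuous'
  have h1 : Continuous fun z : ℂ × ℝ => solution p q la v (clamp z.2) :=
    (hpq.continuous_solution_clamp v).comp (continuous_const.prodMk continuous_snd)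
  have h2 := hpq.continuous_solution_clamp w
  have h1' := continuous_pi_iff.1 h1
  have h2' := continuous_pi_iff.1 h2
  exact ((h1' 0).mul (h2' 0)).add ((h1' 1).mul (h2' 1))

theorem hasDerivAt_of_eq_add_mul {f g : ℂ → ℂ} {a : ℂ} (hg : ContinuousAt g a)
    (h : ∀ z, f z = f a + (z - a) * g z) : HasDerivAt f (g a) a := by
  rw [hasDerivAt_iff_tendsto_slope]
  refine (hg.tendsto.mono_left nhdsWithin_le_nhds).congr' ?_
  filter_upwards [self_mem_nhdsWithin] with z hz
  have : z - a ≠ 0 := sub_ne_zero.2 hz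
  rw [slope_def_field, h z]
  field_simp
  ring

/-- Variation of constants is already in Carathéodory form: increment equals `mu - la` times a
factor, and the factor is continuous in `mu`. -/
theorem RegularCoeff.hasDerivAt_solution (hpq : RegularCoeff p q) (la : ℂ) (v : Fin 2 → ℂ) {x : ℝ}
    (hx : x ∈ Icc 0 Real.pi) (i : Fin 2) :
    HasDerivAt (fun mu => solution p q mu v x i)
      (pairing (cSol p q la) (solution p q la v) x * sSol p q la x i -
        pairing (sSol p q la) (solution p q la v) x * cSol p q la x i) la := by
  refine hasDerivAt_of_eq_add_mul (g := fun mu =>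
    pairing (cSol p q la) (solution p q mu v) x * sSol p q la x i -
        pairing (sSol p q la) (solution p q mu v) x * cSol p q la x i) ?_ fun mu => ?_
  · exact (((hpq.continuous_pairing la _ v hx).mul continuous_const).sub
      ((hpq.continuous_pairing la _ v hx).mul continuous_const)).continuousAt
  · have e1 := (hpq.solution_spec mu v).1.variation_of_constants hpq (la := la) hx
    have e2 := (hpq.solution_spec la v).1.eq_smul_add_smul hpq hx
    rw [(hpq.solution_spec mu v).2] at e1
    rw [(hpq.solution_spec la v).2] at e2
    have := congrFun e1 i
    rw [← e2] at this
    simpa [smul_eq_mul] using this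

/-- The explicit shape matters: the same combination of the pairings appears when `α` is expanded in
Floquet solutions, and this is what turns `1/α` into `1/F'`. -/
theorem RegularCoeff.hasDerivAt_discriminant (hpq : RegularCoeff p q) (mu : ℂ) :
    HasDerivAt (discriminant p q)
      (pairing (cSol p q mu) (cSol p q mu) Real.pi * sSol p q mu Real.pi 0 -
        pairing (cSol p q mu) (sSol p q mu) Real.pi * cSol p q mu Real.pi 0 +
        pairing (cSol p q mu) (sSol p q mu) Real.pi * sSol p q mu Real.pi 1 -
        pairing (sSol p q mu) (sSol p q mu) Real.pi * cSol p q mu Real.pi 1) mu := by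
  have hpi : Real.pi ∈ Icc 0 Real.pi := ⟨Real.pi_pos.le, le_rfl⟩
  have h1 := hpq.hasDerivAt_solution mu ![1, 0] hpi 0
  have h2 := hpq.hasDerivAt_solution mu ![0, 1] hpi 1
  refine (h1.add h2).congr_deriv ?_
  change pairing (cSol p q mu) (cSol p q mu) Real.pi * _ -
    pairing (sSol p q mu) (cSol p q mu) Real.pi * _ +
    (pairing (cSol p q mu) (sSol p q mu) Real.pi * _ -
    pairing (sSol p q mu) (sSol p q mu) Real.pi * _) = _
  rw [pairing_comm (sSol p q mu) (cSol p q mu)]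
  ring

theorem RegularCoeff.differentiable_discriminant (hpq : RegularCoeff p q) :
    Differentiable ℂ (discriminant p q) :=
  fun mu => (hpq.hasDerivAt_discriminant mu).differentiableAt

theorem RegularCoeff.differentiable_sSol_zero (hpq : RegularCoeff p q) :
    Differentiable ℂ (fun mu => sSol p q mu Real.pi 0) := fun mu =>
  (hpq.hasDerivAt_solution mu ![0, 1] ⟨Real.pi_pos.le, le_rfl⟩ 0).differentiableAt

theorem RegularCoeff.charDet_eq (hpq : RegularCoeff p q) (mu t : ℂ) :
    charDet p q mu t = 1 + multiplier t ^ 2 - multiplier t * discriminant p q mu := by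
  have hW := hpq.wronskian_eq_one mu (x := Real.pi) ⟨Real.pi_pos.le, le_rfl⟩
  rw [charDet, Matrix.det_fin_two_of, discriminant]
  linear_combination hW

theorem multiplier_ne_zero (t : ℂ) : multiplier t ≠ 0 := Complex.exp_ne_zero _

theorem multiplier_add_inv (t : ℂ) :
    multiplier t + (multiplier t)⁻¹ = 2 * Complex.cos (Real.pi * t) := by
  rw [multiplier, ← Complex.exp_neg, Complex.two_cos]
  congr 2 <;> ring

theorem RegularCoeff.charDet_eq_zero_iff (hpq : RegularCoeff p q) (mu t : ℂ) :
    charDet p q mu t = 0 ↔ discriminant p q mu = 2 * Complex.cos (Real.pi * t) := by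
  rw [hpq.charDet_eq, ← multiplier_add_inv]
  have := multiplier_ne_zero t
  field_simp
  constructor
  · intro h; linear_combination -h
  · intro h; linear_combination -h

/-- The derivative of `Δ(·, t)` is `-e^{iπt} F'`. This is what gives access to the eigenfunctions of
a Bloch system, which are specified only at simple eigenvalues. -/
theorem RegularCoeff.multiplicity_eq_one (hpq : RegularCoeff p q) {mu t : ℂ}
    (h : charDet p q mu t = 0) (h' : deriv (discriminant p q) mu ≠ 0) :
    multiplicity p q t mu = 1 := by
  have hd := hpq.differentiable_discriminant
  have e : (fun z => charDet p q z t) =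
      fun z => 1 + multiplier t ^ 2 - multiplier t * discriminant p q z := by
    ext z; exact hpq.charDet_eq z t
  rw [multiplicity]
  apply AnalyticAt.analyticOrderAt_eq_one_of_zero_deriv_ne_zero
  · rw [e]
    exact (((differentiable_const _).sub ((differentiable_const _).mul hd))).analyticAt _
  · exact h
  · rw [e]
    have := ((hd mu).hasDerivAt.const_mul (multiplier t)).const_sub (1 + multiplier t ^ 2)
    rw [this.deriv]
    exact neg_ne_zero.2 (mul_ne_zero (multiplier_ne_zero t) h')

theorem IsBlochSystem.charDet_eq_zero {S : Set ℂ} {lam : ℤ → Fin 2 → ℂ → ℂ}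
    {Psi PsiStar : ℤ → Fin 2 → ℂ → ℝ → Fin 2 → ℂ}
    (hB : IsBlochSystem p q S lam Psi PsiStar) (k : ℤ) (j : Fin 2) {t : ℂ} (ht : t ∈ S) :
    charDet p q (lam k j t) t = 0 := by
  have h := hB.enum t ht (lam k j t)
  by_contra h0
  have : multiplicity p q t (lam k j t) = 0 := by
    rw [multiplicity, analyticOrderAt_eq_zero]
    exact Or.inr h0
  rw [this, Set.encard_eq_zero] at h
  exact (Set.eq_empty_iff_forall_notMem.1 h) (k, j) rfl

end Floquet

/-! ### The expansion term as a continuous function divided by the derivative of the discriminant -/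

section Expansion

variable {p q : ℝ → ℂ}

theorem RegularCoeff.conj (hpq : RegularCoeff p q) :
    RegularCoeff (fun x => conj (p x)) (fun x => conj (q x)) := by
  have hi : ∀ f : ℝ → ℂ, IntervalIntegrable f volume 0 Real.pi →
      IntervalIntegrable (fun x => (starRingEnd ℂ) (f x)) volume 0 Real.pi := by
    intro f hf
    exact ⟨(Complex.conjCLE : ℂ →L[ℝ] ℂ).integrable_comp hf.1,
      (Complex.conjCLE : ℂ →L[ℝ] ℂ).integrable_comp hf.2⟩
  obtain ⟨K, hK⟩ := hpq.bound_p
  obtain ⟨L, hL⟩ := hpq.bound_q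
  exact ⟨hi _ hpq.1, hi _ hpq.2, ⟨K, by simpa using hK⟩, ⟨L, by simpa using hL⟩⟩

theorem multiplier_conj (t : ℂ) : conj (multiplier (conj t)) = (multiplier t)⁻¹ := by
  rw [multiplier, multiplier, ← Complex.exp_conj, ← Complex.exp_neg]
  simp

theorem IsNormalizedEigenfunction.apply_zero_ne_zero (hpq : RegularCoeff p q) {t mu : ℂ}
    {y : ℝ → Fin 2 → ℂ} (hy : IsNormalizedEigenfunction p q t mu y) : y 0 ≠ 0 := by
  intro h0
  have h1 := hy.norm_eq
  have : ∫ x in (0 : ℝ)..Real.pi,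
      ∑ i, ‖Complex.exp (-(Complex.I * t * x)) * y x i‖ ^ 2 = ∫ x in (0 : ℝ)..Real.pi, (0 : ℝ) := by
    refine intervalIntegral.integral_congr fun x hx => ?_
    rw [uIcc_of_le Real.pi_pos.le] at hx
    have := hy.sol.eq_smul_add_smul hpq hx
    rw [h0] at this
    simp [this]
  rw [this] at h1
  simp at h1

/-- Here `(a, b)` and `(a', b')` are eigenvectors of the monodromy matrix for `m` and `n`. Each
product of a component of one with a component of the other, multiplied by `m - n`, is the
determinant `a'b - b'a` times an entry `s₁`, `n - c₁`, `s₂ - n` or `-c₂`. Since `α` and `D` are the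
same linear combination of products and of entries respectively, the determinant and both
normalizations drop out of the quotients by `α`. -/
theorem floquet_algebra {c₁ c₂ s₁ s₂ m n a b a' b' C X S : ℂ} (hmn : m ≠ n)
    (h1 : c₁ * a + s₁ * b = m * a) (h2 : c₂ * a + s₂ * b = m * b)
    (h3 : c₁ * a' + s₁ * b' = n * a') (h4 : c₂ * a' + s₂ * b' = n * b')
    (hab : ¬(a = 0 ∧ b = 0)) (hab' : ¬(a' = 0 ∧ b' = 0))
    (hF : C * s₁ - X * c₁ + X * s₂ - S * c₂ ≠ 0) (D : ℂ)
    (hD : D = C * s₁ - X * c₁ + X * s₂ - S * c₂)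
    (α : ℂ) (hα : α = a * a' * C + (a * b' + b * a') * X + b * b' * S) :
    α⁻¹ * (a * a') = s₁ / D ∧ α⁻¹ * (a * b') = (n - c₁) / D ∧
      α⁻¹ * (b * a') = (s₂ - n) / D ∧ α⁻¹ * (b * b') = -c₂ / D := by
  have e1 : (m - n) * (a * a') = (a' * b - b' * a) * s₁ := by
    linear_combination (-a') * h1 + a * h3
  have e2 : (m - n) * (a * b') = (a' * b - b' * a) * (n - c₁) := by
    linear_combination (-b') * h1 + b * h3
  have e3 : (m - n) * (b * a') = (a' * b - b' * a) * (s₂ - n) := by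
    linear_combination (-a') * h2 + a * h4
  have e4 : (m - n) * (b * b') = (a' * b - b' * a) * (-c₂) := by
    linear_combination (-b') * h2 + b * h4
  have hmn' : m - n ≠ 0 := sub_ne_zero.2 hmn
  -- If it vanished, all four products of components would vanish, so one of the two eigenvectors
  -- would be zero.
  have hW : a' * b - b' * a ≠ 0 := by
    intro hW
    rw [hW] at e1 e2 e3 e4
    simp only [zero_mul, mul_eq_zero, hmn', false_or] at e1 e2 e3 e4
    tauto
  have key : (m - n) * α = (a' * b - b' * a) * D := by
    rw [hα, hD]
    linear_combination C * e1 + X * e2 + X * e3 + S * e4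
  have hD0 : D ≠ 0 := hD ▸ hF
  have hα0 : α ≠ 0 := by
    intro h
    rw [h, mul_zero] at key
    exact mul_ne_zero hW hD0 key.symm
  have fin : ∀ u v : ℂ, (m - n) * u = (a' * b - b' * a) * v → α⁻¹ * u = v / D := by
    intro u v huv
    rw [inv_mul_eq_div, div_eq_div_iff hα0 hD0]
    apply mul_left_cancel₀ (mul_ne_zero hmn' hW)
    linear_combination ((a' * b - b' * a) * D) * huv - ((a' * b - b' * a) * v) * key
  exact ⟨fin _ _ e1, fin _ _ e2, fin _ _ e3, fin _ _ e4⟩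

/-- The pairing `∫ fₜ · y` of the Gelfand transform with a vector function. -/
def gelfandPairing (f : ℝ → Fin 2 → ℂ) (t : ℂ) (y : ℝ → Fin 2 → ℂ) : ℂ :=
  pairing (gelfand f t) y Real.pi

/-- The product of the expansion term with the derivative of the discriminant, written through
the fundamental solutions. -/
def residueTerm (p q : ℝ → ℂ) (f : ℝ → Fin 2 → ℂ) (x : ℝ) (mu t : ℂ) : Fin 2 → ℂ :=
  (sSol p q mu Real.pi 0 * gelfandPairing f t (cSol p q mu) +
    ((multiplier t)⁻¹ - cSol p q mu Real.pi 0) * gelfandPairing f t (sSol p q mu)) •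
      cSol p q mu x +
  ((sSol p q mu Real.pi 1 - (multiplier t)⁻¹) * gelfandPairing f t (cSol p q mu) +
    (-cSol p q mu Real.pi 1) * gelfandPairing f t (sSol p q mu)) • sSol p q mu x

theorem exists_finset_gelfand {f : ℝ → Fin 2 → ℂ} (hfc : HasCompactSupport f) :
    ∃ s : Finset ℤ, ∀ (t : ℂ), ∀ x ∈ Icc 0 Real.pi,
      gelfand f t x = ∑ k ∈ s, Complex.exp (-(Complex.I * k * Real.pi * t)) • f (x + k * Real.pi) := by
  obtain ⟨R, hR⟩ := hfc.isCompact.isBounded.subset_closedBall 0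
  obtain ⟨N, hN⟩ := exists_nat_gt (R / Real.pi + 1)
  refine ⟨Finset.Icc (-N : ℤ) N, fun t x hx => tsum_eq_sum fun k hk => ?_⟩
  have hpi := Real.pi_pos
  have hRN : R + Real.pi < N * Real.pi := by
    have := mul_lt_mul_of_pos_right hN hpi
    rw [add_mul, div_mul_cancel₀ _ hpi.ne'] at this
    linarith
  have : f (x + k * Real.pi) = 0 := by
    by_contra h0
    have h1 := hR (subset_tsupport f h0)
    rw [Metric.mem_closedBall, dist_zero_right, Real.norm_eq_abs, abs_le] at h1
    apply hk
    rw [Finset.mem_Icc]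
    constructor
    · by_contra hlt
      have h2 : (k : ℝ) ≤ -N - 1 := by
        have : k ≤ -(N : ℤ) - 1 := by omega
        exact_mod_cast this
      nlinarith [hx.1, hx.2]
    · by_contra hlt
      have h2 : (N : ℝ) + 1 ≤ k := by
        have : (N : ℤ) + 1 ≤ k := by omega
        exact_mod_cast this
      nlinarith [hx.1, hx.2]
  rw [this, smul_zero]

theorem continuous_gelfand_clamp {f : ℝ → Fin 2 → ℂ} (hf : Continuous f)
    (hfc : HasCompactSupport f) : Continuous fun z : ℂ × ℝ => gelfand f z.1 (clamp z.2) := by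
  obtain ⟨s, hs⟩ := exists_finset_gelfand hfc
  have : (fun z : ℂ × ℝ => gelfand f z.1 (clamp z.2)) = fun z : ℂ × ℝ => ∑ k ∈ s,
      Complex.exp (-(Complex.I * k * Real.pi * z.1)) • f (clamp z.2 + k * Real.pi) := by
    ext1 z
    exact hs z.1 _ (clamp_mem _)
  rw [this]
  have := continuous_clamp
  fun_prop

theorem RegularCoeff.continuous_gelfandPairing (hpq : RegularCoeff p q) {f : ℝ → Fin 2 → ℂ}
    (hf : Continuous f) (hfc : HasCompactSupport f) (v : Fin 2 → ℂ) :
    Continuous fun z : ℂ × ℂ => gelfandPairing f z.2 (solution p q z.1 v) := by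
  have hpi : Real.pi ∈ Icc 0 Real.pi := ⟨Real.pi_pos.le, le_rfl⟩
  simp only [gelfandPairing, pairing_eq_clamp _ _ hpi]
  apply intervalIntegral.continuous_parametric_intervalIntegral_of_continuous'
  have h1 : Continuous fun z : (ℂ × ℂ) × ℝ => gelfand f z.1.2 (clamp z.2) :=
    (continuous_gelfand_clamp hf hfc).comp
      ((continuous_snd.comp continuous_fst).prodMk continuous_snd)
  have h2 : Continuous fun z : (ℂ × ℂ) × ℝ => solution p q z.1.1 v (clamp z.2) :=
    (hpq.continuous_solution_clamp v).comp
      ((continuous_fst.comp continuous_fst).prodMk continuous_snd)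
  have h1' := continuous_pi_iff.1 h1
  have h2' := continuous_pi_iff.1 h2
  exact ((h1' 0).mul (h2' 0)).add ((h1' 1).mul (h2' 1))

theorem RegularCoeff.continuous_solution_apply (hpq : RegularCoeff p q) (v : Fin 2 → ℂ) {x : ℝ}
    (hx : x ∈ Icc 0 Real.pi) : Continuous fun mu => solution p q mu v x := by
  have : Continuous fun mu : ℂ => solution p q mu v (clamp x) :=
    (hpq.continuous_solution_clamp v).comp (continuous_id.prodMk continuous_const)
  rwa [clamp_of_mem hx] at this

/-- No singularity is left in this factor, not even at integer `t` or multiple eigenvalues. The sum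
defining the Gelfand transform is finite, over one index set valid for all `t` and all `x ∈ [0, π]`.
-/
theorem RegularCoeff.continuous_residueTerm (hpq : RegularCoeff p q) {f : ℝ → Fin 2 → ℂ}
    (hf : Continuous f) (hfc : HasCompactSupport f) {x : ℝ} (hx : x ∈ Icc 0 Real.pi) :
    Continuous fun z : ℂ × ℂ => residueTerm p q f x z.1 z.2 := by
  have hpi : Real.pi ∈ Icc 0 Real.pi := ⟨Real.pi_pos.le, le_rfl⟩
  have c1 : Continuous fun z : ℂ × ℂ => cSol p q z.1 Real.pi :=
    (hpq.continuous_solution_apply _ hpi).comp continuous_fst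
  have s1 : Continuous fun z : ℂ × ℂ => sSol p q z.1 Real.pi :=
    (hpq.continuous_solution_apply _ hpi).comp continuous_fst
  have cx : Continuous fun z : ℂ × ℂ => cSol p q z.1 x :=
    (hpq.continuous_solution_apply _ hx).comp continuous_fst
  have sx : Continuous fun z : ℂ × ℂ => sSol p q z.1 x :=
    (hpq.continuous_solution_apply _ hx).comp continuous_fst
  have gc : Continuous fun z : ℂ × ℂ => gelfandPairing f z.2 (cSol p q z.1) :=
    hpq.continuous_gelfandPairing hf hfc _
  have gs : Continuous fun z : ℂ × ℂ => gelfandPairing f z.2 (sSol p q z.1) :=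
    hpq.continuous_gelfandPairing hf hfc _
  have hm : Continuous fun z : ℂ × ℂ => (multiplier z.2)⁻¹ := by
    simp only [multiplier, ← Complex.exp_neg]
    fun_prop
  have c1' := continuous_pi_iff.1 c1
  have s1' := continuous_pi_iff.1 s1
  exact ((((s1' 0).mul gc).add ((hm.sub (c1' 0)).mul gs)).smul cx).add
    (((((s1' 1).sub hm).mul gc).add ((c1' 1).neg.mul gs)).smul sx)

theorem ip_eq_pairing (u v : ℝ → Fin 2 → ℂ) :
    ip u v = pairing u (fun x i => conj (v x i)) Real.pi := by
  simp [ip, pairing, Fin.sum_univ_two]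

theorem pairing_smul_add_smul {u y z w : ℝ → Fin 2 → ℂ} {a b : ℂ}
    (hu : ContinuousOn u (Icc 0 Real.pi))
    (hy : ContinuousOn y (Icc 0 Real.pi)) (hz : ContinuousOn z (Icc 0 Real.pi))
    (hw : ∀ x ∈ Icc 0 Real.pi, w x = a • y x + b • z x) :
    pairing u w Real.pi = a * pairing u y Real.pi + b * pairing u z Real.pi := by
  have hint : ∀ y : ℝ → Fin 2 → ℂ, ContinuousOn y (Icc 0 Real.pi) →
      IntervalIntegrable (fun s => u s 0 * y s 0 + u s 1 * y s 1) volume 0 Real.pi := by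
    intro y hy
    apply ContinuousOn.intervalIntegrable
    rw [uIcc_of_le Real.pi_pos.le]
    have cu := fun i => continuousOn_pi.1 hu i
    have cy := fun i => continuousOn_pi.1 hy i
    exact ((cu 0).mul (cy 0)).add ((cu 1).mul (cy 1))
  rw [pairing, pairing, pairing, ← intervalIntegral.integral_const_mul,
    ← intervalIntegral.integral_const_mul,
    ← intervalIntegral.integral_add ((hint y hy).const_mul a) ((hint z hz).const_mul b)]
  refine intervalIntegral.integral_congr fun s hs => ?_
  rw [uIcc_of_le Real.pi_pos.le] at hs
  simp only [hw s hs, Pi.add_apply, Pi.smul_apply, smul_eq_mul]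
  ring

theorem continuousOn_gelfand {f : ℝ → Fin 2 → ℂ} (hf : Continuous f)
    (hfc : HasCompactSupport f) (t : ℂ) : ContinuousOn (gelfand f t) (Icc 0 Real.pi) := by
  have h : Continuous fun x : ℝ => gelfand f t (clamp x) :=
    (continuous_gelfand_clamp hf hfc).comp (continuous_const.prodMk continuous_id)
  exact h.continuousOn.congr fun x hx => by simp only [clamp_of_mem hx]

/-- The conjugate `Z` of the adjoint eigenfunction is a Floquet solution of the original system with
the inverse multiplier. Expanding it and `psi` in `c` and `s` reduces the claim to the algebra of
two monodromy eigenvectors. -/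
theorem expansionTerm_eq (hpq : RegularCoeff p q) {f : ℝ → Fin 2 → ℂ} (hf : Continuous f)
    (hfc : HasCompactSupport f) {x : ℝ} (hx : x ∈ Icc 0 Real.pi) {t mu : ℂ}
    {psi psiStar : ℝ → Fin 2 → ℂ} (hpsi : IsNormalizedEigenfunction p q t mu psi)
    (hstar : IsNormalizedEigenfunction (fun x => conj (p x)) (fun x => conj (q x))
      (conj t) (conj mu) psiStar)
    (ht : multiplier t ≠ (multiplier t)⁻¹) (hmu : deriv (discriminant p q) mu ≠ 0) :
    expansionTerm f t psi psiStar x =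
      (deriv (discriminant p q) mu)⁻¹ • residueTerm p q f x mu t := by
  have hpi : Real.pi ∈ Icc 0 Real.pi := ⟨Real.pi_pos.le, le_rfl⟩
  set Z : ℝ → Fin 2 → ℂ := fun x i => conj (psiStar x i) with hZ
  have hZs : IsSolution p q mu Z := hstar.sol.conj
  have hZb : Z Real.pi = (multiplier t)⁻¹ • Z 0 := by
    ext i
    simp only [hZ, hstar.bdry, Pi.smul_apply, smul_eq_mul, map_mul, multiplier_conj]
  have hZ0 : Z 0 ≠ 0 := by
    intro h
    apply hstar.apply_zero_ne_zero hpq.conj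
    ext i
    have := congrFun h i
    simpa [hZ] using this
  have hP0 := hpsi.apply_zero_ne_zero hpq
  have hnz : ∀ v : Fin 2 → ℂ, v ≠ 0 → ¬(v 0 = 0 ∧ v 1 = 0) := by
    rintro v hv ⟨h0, h1⟩
    apply hv
    ext i
    fin_cases i <;> simp [h0, h1]
  have hPx := fun x hx => hpsi.sol.eq_smul_add_smul hpq (x := x) hx
  have hZx := fun x hx => hZs.eq_smul_add_smul hpq (x := x) hx
  have b1 := hPx _ hpi
  rw [hpsi.bdry] at b1
  have b2 := hZx _ hpi
  rw [hZb] at b2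
  have hc := (hpq.isSolution_cSol mu).continuousOn
  have hs := (hpq.isSolution_sSol mu).continuousOn
  have hF := (hpq.hasDerivAt_discriminant mu).deriv
  have hα : ip psi psiStar = psi 0 0 * Z 0 0 * pairing (cSol p q mu) (cSol p q mu) Real.pi +
      (psi 0 0 * Z 0 1 + psi 0 1 * Z 0 0) * pairing (cSol p q mu) (sSol p q mu) Real.pi +
      psi 0 1 * Z 0 1 * pairing (sSol p q mu) (sSol p q mu) Real.pi := by
    rw [ip_eq_pairing, pairing_smul_add_smul hpsi.sol.continuousOn hc hs hZx,
      pairing_comm psi, pairing_comm psi, pairing_smul_add_smul hc hc hs hPx,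
      pairing_smul_add_smul hs hc hs hPx, pairing_comm (sSol p q mu) (cSol p q mu)]
    ring
  obtain ⟨r1, r2, r3, r4⟩ := floquet_algebra ht
    (by simpa [mul_comm] using (congrFun b1 0).symm) (by simpa [mul_comm] using (congrFun b1 1).symm)
    (by simpa [mul_comm] using (congrFun b2 0).symm) (by simpa [mul_comm] using (congrFun b2 1).symm)
    (hnz _ hP0) (hnz _ hZ0) (hF ▸ hmu) _ hF _ hα
  have hg : ip (gelfand f t) psiStar = Z 0 0 * gelfandPairing f t (cSol p q mu) +
      Z 0 1 * gelfandPairing f t (sSol p q mu) := by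
    rw [ip_eq_pairing, pairing_smul_add_smul (continuousOn_gelfand hf hfc t) hc hs hZx]
    rfl
  rw [expansionTerm, hg, hPx x hx, residueTerm]
  ext i
  simp only [Pi.add_apply, Pi.smul_apply, smul_eq_mul]
  rw [div_eq_mul_inv] at r1 r2 r3 r4
  linear_combination
    (gelfandPairing f t (cSol p q mu) * cSol p q mu x i) * r1 +
    (gelfandPairing f t (sSol p q mu) * cSol p q mu x i) * r2 +
    (gelfandPairing f t (cSol p q mu) * sSol p q mu x i) * r3 +
    (gelfandPairing f t (sSol p q mu) * sSol p q mu x i) * r4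

theorem multiplier_ne_inv {t : ℂ} (ht : ∀ n : ℤ, t ≠ n) : multiplier t ≠ (multiplier t)⁻¹ := by
  intro h
  rw [multiplier, ← Complex.exp_neg, Complex.exp_eq_exp_iff_exists_int] at h
  obtain ⟨n, hn⟩ := h
  apply ht n
  have hpi : (Real.pi : ℂ) ≠ 0 := by exact_mod_cast Real.pi_ne_zero
  have h2 : (2 * Complex.I * Real.pi) * t = (2 * Complex.I * Real.pi) * n := by
    linear_combination hn
  exact mul_left_cancel₀ (by simp [hpi, Complex.I_ne_zero]) h2

theorem IsBlochSystem.expansionTerm_eq (hpq : RegularCoeff p q) {S : Set ℂ}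
    {lam : ℤ → Fin 2 → ℂ → ℂ} {Psi PsiStar : ℤ → Fin 2 → ℂ → ℝ → Fin 2 → ℂ}
    (hB : IsBlochSystem p q S lam Psi PsiStar) {f : ℝ → Fin 2 → ℂ} (hf : Continuous f)
    (hfc : HasCompactSupport f) {x : ℝ} (hx : x ∈ Icc 0 Real.pi) (k : ℤ) (j : Fin 2) {t : ℂ}
    (htS : t ∈ S) (ht : ∀ n : ℤ, t ≠ n) (h' : deriv (discriminant p q) (lam k j t) ≠ 0) :
    expansionTerm f t (Psi k j t) (PsiStar k j t) x =
      (deriv (discriminant p q) (lam k j t))⁻¹ • residueTerm p q f x (lam k j t) t := by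
  have hm := hpq.multiplicity_eq_one (hB.charDet_eq_zero k j htS) h'
  exact Dirac.expansionTerm_eq hpq hf hfc hx (hB.eigen k j t htS hm) (hB.eigenStar k j t htS hm)
    (multiplier_ne_inv ht) h'

/-- For real `t` the factor `e^{-itx}` is unimodular. The fundamental matrix has determinant one and
bounded entries, so `‖y 0‖ ≤ 2B ‖y s‖` for every `s`; integrating the square against the
normalization bounds `y 0`, and hence `y`. -/
theorem IsNormalizedEigenfunction.norm_le (hpq : RegularCoeff p q) (R : ℝ) :
    ∃ C > 0, ∀ (t : ℝ) (mu : ℂ) (y : ℝ → Fin 2 → ℂ), ‖mu‖ ≤ R →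
      IsNormalizedEigenfunction p q t mu y → ∀ x ∈ Icc 0 Real.pi, ‖y x‖ ≤ C := by
  obtain ⟨B, hB, hb⟩ := hpq.exists_norm_fundamental_le R
  refine ⟨2 * (2 * B) * B, by positivity, fun t mu y hmu hy x hx => ?_⟩
  have hexp : ∀ s : ℝ, ‖Complex.exp (-(Complex.I * t * s))‖ = 1 := fun s => by
    rw [Complex.norm_exp]; simp
  have hle : ∀ s ∈ Icc 0 Real.pi, ‖y 0‖ ≤ 2 * B * ‖y s‖ := by
    intro s hs
    have hW := hpq.wronskian_eq_one mu hs
    have e := hy.sol.eq_smul_add_smul hpq hs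
    have e0 : y s 0 = y 0 0 * cSol p q mu s 0 + y 0 1 * sSol p q mu s 0 := by
      simpa using congrFun e 0
    have e1 : y s 1 = y 0 0 * cSol p q mu s 1 + y 0 1 * sSol p q mu s 1 := by
      simpa using congrFun e 1
    obtain ⟨bc, bs⟩ := hb mu hmu s hs
    have bd : ∀ (w : Fin 2 → ℂ) (i j : Fin 2), ‖w‖ ≤ B → ‖w i * y s j‖ ≤ B * ‖y s‖ := by
      intro w i j hw
      rw [norm_mul]
      exact mul_le_mul ((norm_le_pi_norm w i).trans hw) (norm_le_pi_norm _ j) (norm_nonneg _) hB.le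
    rw [pi_norm_le_iff_of_nonneg (by positivity)]
    intro i
    fin_cases i
    · have : y 0 0 = sSol p q mu s 1 * y s 0 - sSol p q mu s 0 * y s 1 := by
        rw [e0, e1]; linear_combination -(y 0 0) * hW
      simp only [Fin.zero_eta]
      rw [this]
      have := norm_sub_le (sSol p q mu s 1 * y s 0) (sSol p q mu s 0 * y s 1)
      linarith [bd _ 1 0 bs, bd _ 0 1 bs]
    · have : y 0 1 = cSol p q mu s 0 * y s 1 - cSol p q mu s 1 * y s 0 := by
        rw [e0, e1]; linear_combination -(y 0 1) * hW
      simp only [Fin.mk_one]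
      rw [this]
      have := norm_sub_le (cSol p q mu s 0 * y s 1) (cSol p q mu s 1 * y s 0)
      linarith [bd _ 1 0 bc, bd _ 0 1 bc]
  have hsq : ∀ s ∈ Icc 0 Real.pi, ‖y 0‖ ^ 2 ≤
      (2 * B) ^ 2 * ∑ i, ‖Complex.exp (-(Complex.I * t * s)) * y s i‖ ^ 2 := by
    intro s hs
    have h1 : ‖y s‖ ^ 2 ≤ ∑ i, ‖Complex.exp (-(Complex.I * t * s)) * y s i‖ ^ 2 := by
      simp only [norm_mul, hexp, one_mul, Fin.sum_univ_two]
      obtain ⟨i, hi⟩ : ∃ i, ‖y s‖ = ‖y s i‖ := by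
        obtain ⟨i, -, hi⟩ := Finset.exists_mem_eq_sup' (s := Finset.univ) ⟨0, Finset.mem_univ _⟩
          (fun i => ‖y s i‖₊)
        refine ⟨i, ?_⟩
        rw [Pi.norm_def, ← Finset.sup'_eq_sup ⟨0, Finset.mem_univ _⟩, hi]
        rfl
      rw [hi]
      fin_cases i <;> simp
    calc ‖y 0‖ ^ 2 ≤ (2 * B * ‖y s‖) ^ 2 := by
          exact pow_le_pow_left₀ (norm_nonneg _) (hle s hs) 2
      _ = (2 * B) ^ 2 * ‖y s‖ ^ 2 := by ring
      _ ≤ _ := mul_le_mul_of_nonneg_left h1 (by positivity)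
  have hint : Real.pi * ‖y 0‖ ^ 2 ≤ (2 * B) ^ 2 := by
    have h1 : ∫ s in (0 : ℝ)..Real.pi, ‖y 0‖ ^ 2 ≤ ∫ s in (0 : ℝ)..Real.pi,
        (2 * B) ^ 2 * ∑ i, ‖Complex.exp (-(Complex.I * t * s)) * y s i‖ ^ 2 := by
      apply intervalIntegral.integral_mono_on Real.pi_pos.le intervalIntegrable_const ?_ hsq
      apply ContinuousOn.intervalIntegrable
      rw [uIcc_of_le Real.pi_pos.le]
      have cy := fun i => continuousOn_pi.1 hy.sol.continuousOn i
      refine continuousOn_const.mul (continuousOn_finsetSum _ fun i _ => ?_)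
      exact ((Continuous.continuousOn (by fun_prop)).mul (cy i)).norm.pow 2
    rw [intervalIntegral.integral_const_mul, hy.norm_eq] at h1
    simpa using h1
  have hy0 : ‖y 0‖ ≤ 2 * B := by
    have h3 : ‖y 0‖ ^ 2 ≤ (2 * B) ^ 2 := by nlinarith [Real.pi_gt_three, sq_nonneg ‖y 0‖]
    exact le_of_sq_le_sq h3 (by positivity)
  rw [hy.sol.eq_smul_add_smul hpq hx]
  refine (norm_add_le _ _).trans ?_
  rw [norm_smul, norm_smul]
  obtain ⟨bc, bs⟩ := hb mu hmu x hx
  have := mul_le_mul ((norm_le_pi_norm (y 0) 0).trans hy0) bc (norm_nonneg _) (by positivity)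
  have := mul_le_mul ((norm_le_pi_norm (y 0) 1).trans hy0) bs (norm_nonneg _) (by positivity)
  linarith

end Expansion

/-! ### Asymptotics of the monodromy matrix for large spectral parameter -/

section Asymptotics

theorem hasDerivAt_exp_mul_ofReal (c : ℂ) (x : ℝ) :
    HasDerivAt (fun x : ℝ => Complex.exp (c * x)) (c * Complex.exp (c * x)) x := by
  have h0 : HasDerivAt (fun r : ℝ => c * (r : ℂ)) c x := by
    simpa using (Complex.ofRealCLM.hasDerivAt (x := x)).const_mul c
  simpa [mul_comm] using h0.cexp

theorem absolutelyContinuousOnInterval_exp (c : ℂ) (a b : ℝ) :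
    AbsolutelyContinuousOnInterval (fun x : ℝ => Complex.exp (c * x)) a b := by
  apply ContDiffOn.absolutelyContinuousOnInterval
  apply ContDiff.contDiffOn
  have : ContDiff ℝ 1 (fun x : ℝ => (x : ℂ)) := Complex.ofRealCLM.contDiff
  fun_prop

/-- The rescaled first-order system `u' = iλu + aw`, `w' = -iλw + bu`. -/
structure IsZSSolution (a b : ℝ → ℂ) (la : ℂ) (u w : ℝ → ℂ) : Prop where
  ac_u : AbsolutelyContinuousOnInterval u 0 Real.pi
  ac_w : AbsolutelyContinuousOnInterval w 0 Real.pi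
  deriv_u : ∀ᵐ x, x ∈ uIcc 0 Real.pi →
    HasDerivAt u (Complex.I * la * u x + a x * w x) x
  deriv_w : ∀ᵐ x, x ∈ uIcc 0 Real.pi →
    HasDerivAt w (-(Complex.I * la) * w x + b x * u x) x

variable {a b : ℝ → ℂ}

/-- This symmetry reduces the lower half plane to the upper one. -/
theorem IsZSSolution.swap {la : ℂ} {u w : ℝ → ℂ} (h : IsZSSolution a b la u w) :
    IsZSSolution b a (-la) w u := by
  refine ⟨h.ac_w, h.ac_u, ?_, ?_⟩
  · filter_upwards [h.deriv_w] with x hx hxI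
    refine (hx hxI).congr_deriv ?_
    ring
  · filter_upwards [h.deriv_u] with x hx hxI
    refine (hx hxI).congr_deriv ?_
    ring

theorem IsZSSolution.w_eq (hb : IntervalIntegrable b volume 0 Real.pi) {la : ℂ} {u w : ℝ → ℂ}
    (h : IsZSSolution a b la u w) {x : ℝ} (hx : x ∈ Icc 0 Real.pi) :
    Complex.exp (Complex.I * la * x) * w x =
      w 0 + ∫ s in 0..x, b s * (Complex.exp (Complex.I * la * s) * u s) := by
  have hac : AbsolutelyContinuousOnInterval (fun x : ℝ => Complex.exp (Complex.I * la * x) * w x)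
    0 Real.pi := (absolutelyContinuousOnInterval_exp (Complex.I * la) 0 Real.pi).smul h.ac_w
  have := eq_add_integral_of_absolutelyContinuous
    (f' := fun s => b s * (Complex.exp (Complex.I * la * s) * u s)) hac ?_ ?_
    (x := x) (by rwa [uIcc_of_le Real.pi_pos.le])
  · simpa using this
  · filter_upwards [h.deriv_w] with s hs hsI
    refine ((hasDerivAt_exp_mul_ofReal (Complex.I * la) s).mul (hs hsI)).congr_deriv ?_
    ring
  · exact hb.mul_continuousOn
      ((Continuous.continuousOn (by fun_prop)).mul h.ac_u.continuousOn)

/-- Multiplying both components by `e^{iλx}` removes the exponential growth: the kernel becomes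
`e^{2iλ(x-s)}` with `s ≤ x`, bounded by one in the closed upper half plane. -/
theorem IsZSSolution.u_eq (ha : IntervalIntegrable a volume 0 Real.pi) {la : ℂ} {u w : ℝ → ℂ}
    (h : IsZSSolution a b la u w) {x : ℝ} (hx : x ∈ Icc 0 Real.pi) :
    Complex.exp (Complex.I * la * x) * u x = Complex.exp (2 * Complex.I * la * x) * u 0 +
      ∫ s in 0..x, Complex.exp (-(2 * Complex.I * la) * s + 2 * Complex.I * la * x) * a s *
        (Complex.exp (Complex.I * la * s) * w s) := by
  have hac : AbsolutelyContinuousOnInterval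
    (fun x : ℝ => Complex.exp (-(Complex.I * la) * x) * u x)
    0 Real.pi := (absolutelyContinuousOnInterval_exp (-(Complex.I * la)) 0 Real.pi).smul h.ac_u
  have key := eq_add_integral_of_absolutelyContinuous
    (f' := fun s => a s * (Complex.exp (-(Complex.I * la) * s) * w s)) hac ?_ ?_
    (x := x) (by rwa [uIcc_of_le Real.pi_pos.le])
  · have e1 : ∫ s in 0..x, Complex.exp (-(2 * Complex.I * la) * s + 2 * Complex.I * la * x) * a s *
        (Complex.exp (Complex.I * la * s) * w s) = Complex.exp (2 * Complex.I * la * x) *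
        ∫ s in 0..x, a s * (Complex.exp (-(Complex.I * la) * s) * w s) := by
      rw [← intervalIntegral.integral_const_mul]
      congr 1
      ext s
      have : Complex.exp (-(Complex.I * la) * s) =
          Complex.exp (-(2 * Complex.I * la) * s) * Complex.exp (Complex.I * la * s) := by
        rw [← Complex.exp_add]; congr 1; ring
      rw [this, Complex.exp_add]
      ring
    have e2 : Complex.exp (Complex.I * la * x) =
        Complex.exp (2 * Complex.I * la * x) * Complex.exp (-(Complex.I * la) * x) := by
      rw [← Complex.exp_add]; congr 1; ring
    rw [e1, e2, mul_assoc, key]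
    simp [mul_add]
  · filter_upwards [h.deriv_u] with s hs hsI
    refine ((hasDerivAt_exp_mul_ofReal (-(Complex.I * la)) s).mul (hs hsI)).congr_deriv ?_
    ring
  · exact ha.mul_continuousOn
      ((Continuous.continuousOn (by fun_prop)).mul h.ac_w.continuousOn)

theorem norm_exp_two_mul_le {la : ℂ} (hla : 0 ≤ la.im) {x : ℝ} (hx : 0 ≤ x) :
    ‖Complex.exp (2 * Complex.I * la * x)‖ ≤ 1 := by
  rw [Complex.norm_exp, Real.exp_le_one_iff]
  have : (2 * Complex.I * la * x).re = -2 * (la.im * x) := by simp [mul_assoc]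
  rw [this]
  nlinarith [mul_nonneg hla hx]

theorem norm_exp_sub_le {la : ℂ} (hla : 0 ≤ la.im) {s x : ℝ} (hx : s ≤ x) :
    ‖Complex.exp (-(2 * Complex.I * la) * s + 2 * Complex.I * la * x)‖ ≤ 1 := by
  have : -(2 * Complex.I * la) * s + 2 * Complex.I * la * x =
    2 * Complex.I * la * ((x - s : ℝ) : ℂ) := by push_cast; ring
  rw [this]
  exact norm_exp_two_mul_le hla (by linarith)

/-- Gronwall for the rescaled components; the constant does not depend on `la`. -/
theorem IsZSSolution.norm_le {K : ℝ} (ha : IntervalIntegrable a volume 0 Real.pi)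
    (hb : IntervalIntegrable b volume 0 Real.pi) (hK : 0 ≤ K)
    (haK : ∀ x ∈ Icc 0 Real.pi, ‖a x‖ ≤ K) (hbK : ∀ x ∈ Icc 0 Real.pi, ‖b x‖ ≤ K)
    {la : ℂ} (hla : 0 ≤ la.im) {u w : ℝ → ℂ} (h : IsZSSolution a b la u w) {x : ℝ}
    (hx : x ∈ Icc 0 Real.pi) :
    ‖Complex.exp (Complex.I * la * x) * u x‖ + ‖Complex.exp (Complex.I * la * x) * w x‖ ≤
      (‖u 0‖ + ‖w 0‖) * Real.exp (K * Real.pi) := by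
  set U : ℝ → ℂ := fun x => Complex.exp (Complex.I * la * x) * u x with hU
  set W : ℝ → ℂ := fun x => Complex.exp (Complex.I * la * x) * w x with hW
  have cE : Continuous fun x : ℝ => Complex.exp (Complex.I * la * x) := by fun_prop
  have cU : ContinuousOn U (Icc 0 Real.pi) := by
    have := h.ac_u.continuousOn
    rw [uIcc_of_le Real.pi_pos.le] at this
    exact cE.continuousOn.mul this
  have cW : ContinuousOn W (Icc 0 Real.pi) := by
    have := h.ac_w.continuousOn
    rw [uIcc_of_le Real.pi_pos.le] at this
    exact cE.continuousOn.mul this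
  have hii : ∀ V : ℝ → ℂ, ContinuousOn V (Icc 0 Real.pi) → ∀ x ∈ Icc 0 Real.pi,
      IntervalIntegrable (fun s => ‖V s‖) volume 0 x := fun V hV x hx => by
    apply ContinuousOn.intervalIntegrable
    rw [uIcc_of_le hx.1]
    exact (hV.mono (Icc_subset_Icc le_rfl hx.2)).norm
  have := le_mul_exp_of_le_add_integral (φ := fun x => ‖U x‖ + ‖W x‖) (b := Real.pi)
    (c := ‖u 0‖ + ‖w 0‖) (K := K) (cU.norm.add cW.norm) hK ?_ x hx
  · refine this.trans ?_
    have hle : K * x ≤ K * Real.pi := mul_le_mul_of_nonneg_left hx.2 hK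
    exact mul_le_mul_of_nonneg_left (Real.exp_le_exp.2 hle) (by positivity)
  · intro x hx
    have h1 : ‖U x‖ ≤ ‖u 0‖ + K * ∫ s in 0..x, ‖W s‖ := by
      simp only [hU]
      rw [h.u_eq ha hx, ← intervalIntegral.integral_const_mul]
      refine (norm_add_le _ _).trans (add_le_add ?_ ?_)
      · rw [norm_mul]
        exact mul_le_of_le_one_left (norm_nonneg _) (norm_exp_two_mul_le hla hx.1)
      · apply intervalIntegral.norm_integral_le_of_norm_le hx.1
        · refine Eventually.of_forall fun s hs => ?_
          rw [norm_mul, norm_mul]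
          refine mul_le_mul_of_nonneg_right ?_ (norm_nonneg _)
          exact (mul_le_of_le_one_left (norm_nonneg _) (norm_exp_sub_le hla hs.2)).trans
            (haK s ⟨hs.1.le, hs.2.trans hx.2⟩)
        · exact (hii W cW x hx).const_mul K
    have h2 : ‖W x‖ ≤ ‖w 0‖ + K * ∫ s in 0..x, ‖U s‖ := by
      simp only [hW]
      rw [h.w_eq hb hx, ← intervalIntegral.integral_const_mul]
      refine (norm_add_le _ _).trans (add_le_add le_rfl ?_)
      apply intervalIntegral.norm_integral_le_of_norm_le hx.1
      · refine Eventually.of_forall fun s hs => ?_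
        rw [norm_mul]
        exact mul_le_mul_of_nonneg_right (hbK s ⟨hs.1.le, hs.2.trans hx.2⟩) (norm_nonneg _)
      · exact (hii U cU x hx).const_mul K
    rw [intervalIntegral.integral_add (hii U cU x hx) (hii W cW x hx)]
    linarith

/-- Integration by parts against the tail primitive `∫_s^x k`, which is uniformly small and vanishes
at `s = x`. Smallness of oscillatory integrals thus survives a factor `W` that varies with the
parameter, as long as its derivative stays bounded. -/
theorem norm_integral_mul_le_of_norm_integral_le {k W W' : ℝ → ℂ} {x η A : ℝ} (hx : 0 ≤ x)
    (hk : IntervalIntegrable k volume 0 x)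
    (hη : ∀ s ∈ Icc 0 x, ‖∫ r in s..x, k r‖ ≤ η)
    (hW : AbsolutelyContinuousOnInterval W 0 x)
    (hW' : ∀ᵐ s, s ∈ uIcc 0 x → HasDerivAt W (W' s) s) (hWi : IntervalIntegrable W' volume 0 x)
    (hA : ∀ s ∈ Icc 0 x, ‖W' s‖ ≤ A) :
    ‖∫ s in 0..x, k s * W s‖ ≤ η * ‖W 0‖ + η * A * x := by
  have hη0 : 0 ≤ η := (norm_nonneg _).trans (hη 0 ⟨le_rfl, hx⟩)
  set P : ℝ → ℂ := fun s => (∫ r in 0..x, k r) - ∫ r in 0..s, k r with hP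
  have hPs : ∀ s ∈ Icc 0 x, P s = ∫ r in s..x, k r := fun s hs =>
    intervalIntegral.integral_interval_sub_left hk
      (hk.mono_set (uIcc_subset_uIcc left_mem_uIcc (by rwa [uIcc_of_le hx])))
  have acI := absolutelyContinuousOnInterval_integral hk
  have acP : AbsolutelyContinuousOnInterval P 0 x :=
    (ContDiffOn.absolutelyContinuousOnInterval contDiffOn_const).sub acI
  have hi1 : IntervalIntegrable (fun s => k s * W s) volume 0 x :=
    hk.mul_continuousOn hW.continuousOn
  have hi2 : IntervalIntegrable (fun s => P s * W' s) volume 0 x :=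
    hWi.continuousOn_mul acP.continuousOn
  have key := eq_add_integral_of_absolutelyContinuous (f := fun s => P s * W s)
    (f' := fun s => -(k s * W s) + P s * W' s) (acP.smul hW) ?_ (hi1.neg.add hi2)
    (x := x) right_mem_uIcc
  · have esum : ∫ s in 0..x, (-(k s * W s) + P s * W' s) =
        -(∫ s in 0..x, k s * W s) + ∫ s in 0..x, P s * W' s := by
      rw [← intervalIntegral.integral_neg]
      exact intervalIntegral.integral_add hi1.neg hi2
    rw [esum] at key
    have hPx : P x = 0 := by simp [hP]
    rw [hPx, zero_mul] at key
    have e : ∫ s in 0..x, k s * W s = P 0 * W 0 + ∫ s in 0..x, P s * W' s := by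
      linear_combination key
    rw [e]
    refine (norm_add_le _ _).trans (add_le_add ?_ ?_)
    · rw [norm_mul, hPs 0 ⟨le_rfl, hx⟩]
      exact mul_le_mul_of_nonneg_right (hη 0 ⟨le_rfl, hx⟩) (norm_nonneg _)
    · have := intervalIntegral.norm_integral_le_of_norm_le_const (a := 0) (b := x)
        (f := fun s => P s * W' s) (C := η * A) ?_
      · rwa [sub_zero, abs_of_nonneg hx] at this
      · intro s hs
        rw [uIoc_of_le hx] at hs
        have hs' : s ∈ Icc 0 x := ⟨hs.1.le, hs.2⟩
        rw [norm_mul, hPs s hs']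
        exact mul_le_mul (hη s hs') (hA s hs') (norm_nonneg _) hη0
  · filter_upwards [hk.ae_hasDerivAt_integral, hW'] with s h1 h2 hs
    have := ((h1 hs 0 left_mem_uIcc).const_sub (∫ r in 0..x, k r)).mul (h2 hs)
    refine this.congr_deriv ?_
    ring

/-- After rescaling, `W' = bU` is bounded independently of `la`, so the oscillatory integral in the
equation for `U` is small uniformly in `x`. Inserting the leading term of `U` into the equation for
`W` leaves a second Riemann–Lebesgue integral, with `b`, and a small remainder. -/
theorem exists_zs_asymptotic_upper {K ε : ℝ} (ha : IntervalIntegrable a volume 0 Real.pi)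
    (hb : IntervalIntegrable b volume 0 Real.pi) (hK : 0 ≤ K)
    (haK : ∀ x ∈ Icc 0 Real.pi, ‖a x‖ ≤ K) (hbK : ∀ x ∈ Icc 0 Real.pi, ‖b x‖ ≤ K) (hε : 0 < ε) :
    ∃ R > 0, ∀ la : ℂ, 0 ≤ la.im → R ≤ ‖la‖ → ∀ u w, IsZSSolution a b la u w →
      ‖u Real.pi - Complex.exp (Complex.I * la * Real.pi) * u 0‖ ≤
        ε * Real.exp (Real.pi * la.im) * (‖u 0‖ + ‖w 0‖) ∧
      ‖w Real.pi - Complex.exp (-(Complex.I * la * Real.pi)) * w 0‖ ≤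
        ε * Real.exp (Real.pi * la.im) * (‖u 0‖ + ‖w 0‖) := by
  have hpi := Real.pi_pos
  set Γ := Real.exp (K * Real.pi) with hΓ
  have hΓ0 : 0 < Γ := Real.exp_pos _
  set L := 1 + K * Γ * Real.pi with hL
  have hL0 : 0 < L := by positivity
  -- The two summands of the denominator are the constants in the errors of `U` and of `W`, so each
  -- error is at most `ε` times the size of the initial data.
  set η := ε / (L + (1 + Real.pi * K * L)) with hη
  have hη0 : 0 < η := by positivity
  have hηε : η * L + η * (1 + Real.pi * K * L) = ε := by
    rw [← mul_add, hη, div_mul_cancel₀]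
    positivity
  have hη1 : 0 ≤ η * L := by positivity
  have hη2 : 0 ≤ η * (1 + Real.pi * K * L) := by positivity
  obtain ⟨Ra, hRa, hA⟩ := exists_norm_integral_exp_mul_le hpi.le hη0 ha
  obtain ⟨Rb, hRb, hB⟩ := exists_norm_integral_exp_mul_le hpi.le hη0 hb
  refine ⟨max Ra Rb, lt_max_of_lt_left hRa, fun la him hla u w h => ?_⟩
  set S := ‖u 0‖ + ‖w 0‖ with hS
  have hS0 : 0 ≤ S := by positivity
  have hu0 : ‖u 0‖ ≤ S := by rw [hS]; linarith [norm_nonneg (w 0)]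
  have hw0 : ‖w 0‖ ≤ S := by rw [hS]; linarith [norm_nonneg (u 0)]
  have hn : ‖2 * Complex.I * la‖ = 2 * ‖la‖ := by simp
  have hn' : ‖-(2 * Complex.I * la)‖ = 2 * ‖la‖ := by rw [norm_neg, hn]
  have hla1 : Ra ≤ 2 * ‖la‖ := by linarith [le_max_left Ra Rb, norm_nonneg la]
  have hla2 : Rb ≤ 2 * ‖la‖ := by linarith [le_max_right Ra Rb, norm_nonneg la]
  set U : ℝ → ℂ := fun x => Complex.exp (Complex.I * la * x) * u x with hU
  set W : ℝ → ℂ := fun x => Complex.exp (Complex.I * la * x) * w x with hW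
  have hUW : ∀ x ∈ Icc 0 Real.pi, ‖U x‖ + ‖W x‖ ≤ S * Γ := fun x hx =>
    h.norm_le ha hb hK haK hbK him hx
  have hacW : AbsolutelyContinuousOnInterval W 0 Real.pi :=
    (absolutelyContinuousOnInterval_exp (Complex.I * la) 0 Real.pi).smul h.ac_w
  have hacU : AbsolutelyContinuousOnInterval U 0 Real.pi :=
    (absolutelyContinuousOnInterval_exp (Complex.I * la) 0 Real.pi).smul h.ac_u
  have hbU : IntervalIntegrable (fun s => b s * U s) volume 0 Real.pi :=
    hb.mul_continuousOn hacU.continuousOn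
  have hbUle : ∀ s ∈ Icc 0 Real.pi, ‖b s * U s‖ ≤ K * (S * Γ) := fun s hs => by
    rw [norm_mul]
    exact mul_le_mul (hbK s hs) (by linarith [hUW s hs, norm_nonneg (W s)]) (norm_nonneg _) hK
  have hUest : ∀ x ∈ Icc 0 Real.pi,
      ‖U x - Complex.exp (2 * Complex.I * la * x) * u 0‖ ≤ η * L * S := by
    intro x hx
    have hsub : uIcc 0 x ⊆ uIcc 0 Real.pi :=
      uIcc_subset_uIcc left_mem_uIcc (by rwa [uIcc_of_le hpi.le])
    have e := h.u_eq ha hx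
    change U x = _ at e
    rw [e, add_sub_cancel_left]
    have := norm_integral_mul_le_of_norm_integral_le
      (k := fun s => Complex.exp (-(2 * Complex.I * la) * s + 2 * Complex.I * la * x) * a s)
      (W := W) (W' := fun s => b s * U s) (η := η) (A := K * (S * Γ)) hx.1
      ((ha.mono_set hsub).continuousOn_mul (Continuous.continuousOn (by fun_prop)))
      (fun s hs => hA _ _ (by rw [hn']; exact hla1) s x hs.1 hs.2 hx.2
        fun r hr => norm_exp_sub_le him hr.2)
      (hacW.mono hsub) ?_ (hbU.mono_set hsub) (fun s hs => hbUle s ⟨hs.1, hs.2.trans hx.2⟩)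
    · refine this.trans ?_
      have hW0 : ‖W 0‖ ≤ S := by simpa [hW] using hw0
      have t1 : η * ‖W 0‖ ≤ η * S := mul_le_mul_of_nonneg_left hW0 hη0.le
      have t2 : η * (K * (S * Γ)) * x ≤ η * (K * (S * Γ)) * Real.pi :=
        mul_le_mul_of_nonneg_left hx.2 (by positivity)
      have : η * L * S = η * S + η * (K * (S * Γ)) * Real.pi := by rw [hL]; ring
      linarith
    · filter_upwards [h.deriv_w] with s hs hsI
      refine ((hasDerivAt_exp_mul_ofReal (Complex.I * la) s).mul (hs (hsub hsI))).congr_deriv ?_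
      simp only [hU]
      ring
  have hpiI : Real.pi ∈ Icc 0 Real.pi := ⟨hpi.le, le_rfl⟩
  have hWest : ‖W Real.pi - w 0‖ ≤ η * (1 + Real.pi * K * L) * S := by
    have e := h.w_eq hb hpiI
    change W Real.pi = w 0 + ∫ s in 0..Real.pi, b s * U s at e
    have hcE : Continuous fun s : ℝ => Complex.exp (2 * Complex.I * la * s) := by fun_prop
    have i1 : IntervalIntegrable (fun s => (Complex.exp (2 * Complex.I * la * s) * b s) * u 0)
        volume 0 Real.pi := (hb.continuousOn_mul hcE.continuousOn).mul_const _
    have e2 : ∫ s in 0..Real.pi, b s * U s =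
        (∫ s in 0..Real.pi, Complex.exp (2 * Complex.I * la * s) * b s) * u 0 +
        ∫ s in 0..Real.pi, b s * (U s - Complex.exp (2 * Complex.I * la * s) * u 0) := by
      have i2 : IntervalIntegrable
          (fun s => b s * (U s - Complex.exp (2 * Complex.I * la * s) * u 0)) volume 0 Real.pi :=
        hb.mul_continuousOn (hacU.continuousOn.sub (hcE.mul continuous_const).continuousOn)
      rw [← intervalIntegral.integral_mul_const, ← intervalIntegral.integral_add i1 i2]
      congr 1
      ext s
      ring
    rw [e, add_sub_cancel_left, e2]
    refine (norm_add_le _ _).trans ?_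
    have t1 : ‖(∫ s in 0..Real.pi, Complex.exp (2 * Complex.I * la * s) * b s) * u 0‖ ≤ η * S := by
      rw [norm_mul]
      have := hB (2 * Complex.I * la) 0 (by rw [hn]; exact hla2) 0 Real.pi le_rfl hpi.le le_rfl
        (fun r hr => by rw [add_zero]; exact norm_exp_two_mul_le him hr.1)
      simp only [add_zero] at this
      exact mul_le_mul this hu0 (norm_nonneg _) hη0.le
    have t2 : ‖∫ s in 0..Real.pi, b s * (U s - Complex.exp (2 * Complex.I * la * s) * u 0)‖ ≤
        K * (η * L * S) * |Real.pi - 0| := by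
      apply intervalIntegral.norm_integral_le_of_norm_le_const
      intro s hs
      rw [uIoc_of_le hpi.le] at hs
      have hs' : s ∈ Icc 0 Real.pi := ⟨hs.1.le, hs.2⟩
      rw [norm_mul]
      exact mul_le_mul (hbK s hs') (hUest s hs') (norm_nonneg _) hK
    rw [sub_zero, abs_of_pos hpi] at t2
    have : η * (1 + Real.pi * K * L) * S = η * S + K * (η * L * S) * Real.pi := by ring
    linarith
  have hinv : ‖Complex.exp (-(Complex.I * la * Real.pi))‖ = Real.exp (Real.pi * la.im) := by
    rw [Complex.norm_exp]
    congr 1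
    simp
    ring
  have hEE : Complex.exp (-(Complex.I * la * Real.pi)) * Complex.exp (Complex.I * la * Real.pi) = 1 := by
    rw [← Complex.exp_add]; simp
  have hE2 : Complex.exp (-(Complex.I * la * Real.pi)) * Complex.exp (2 * Complex.I * la * Real.pi) =
      Complex.exp (Complex.I * la * Real.pi) := by
    rw [← Complex.exp_add]; congr 1; ring
  constructor
  · have e : u Real.pi - Complex.exp (Complex.I * la * Real.pi) * u 0 =
        Complex.exp (-(Complex.I * la * Real.pi)) *
          (U Real.pi - Complex.exp (2 * Complex.I * la * Real.pi) * u 0) := by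
      simp only [hU]
      linear_combination (-u Real.pi) * hEE + u 0 * hE2
    rw [e, norm_mul, hinv, mul_comm ε, mul_assoc (Real.exp _)]
    refine mul_le_mul_of_nonneg_left ((hUest _ hpiI).trans ?_) (Real.exp_pos _).le
    exact mul_le_mul_of_nonneg_right (by linarith) hS0
  · have e : w Real.pi - Complex.exp (-(Complex.I * la * Real.pi)) * w 0 =
        Complex.exp (-(Complex.I * la * Real.pi)) * (W Real.pi - w 0) := by
      simp only [hW]
      linear_combination (-w Real.pi) * hEE
    rw [e, norm_mul, hinv, mul_comm ε, mul_assoc (Real.exp _)]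
    refine mul_le_mul_of_nonneg_left (hWest.trans ?_) (Real.exp_pos _).le
    exact mul_le_mul_of_nonneg_right (by linarith) hS0

theorem exists_zs_asymptotic {K ε : ℝ} (ha : IntervalIntegrable a volume 0 Real.pi)
    (hb : IntervalIntegrable b volume 0 Real.pi) (hK : 0 ≤ K)
    (haK : ∀ x ∈ Icc 0 Real.pi, ‖a x‖ ≤ K) (hbK : ∀ x ∈ Icc 0 Real.pi, ‖b x‖ ≤ K) (hε : 0 < ε) :
    ∃ R > 0, ∀ la : ℂ, R ≤ ‖la‖ → ∀ u w, IsZSSolution a b la u w →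
      ‖u Real.pi - Complex.exp (Complex.I * la * Real.pi) * u 0‖ ≤
        ε * Real.exp (Real.pi * |la.im|) * (‖u 0‖ + ‖w 0‖) ∧
      ‖w Real.pi - Complex.exp (-(Complex.I * la * Real.pi)) * w 0‖ ≤
        ε * Real.exp (Real.pi * |la.im|) * (‖u 0‖ + ‖w 0‖) := by
  obtain ⟨R, hR, h1⟩ := exists_zs_asymptotic_upper ha hb hK haK hbK hε
  obtain ⟨R', hR', h2⟩ := exists_zs_asymptotic_upper hb ha hK hbK haK hε
  refine ⟨max R R', lt_max_of_lt_left hR, fun la hla u w h => ?_⟩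
  rcases le_total 0 la.im with him | him
  · rw [abs_of_nonneg him]
    exact h1 la him ((le_max_left _ _).trans hla) u w h
  · have := h2 (-la) (by simpa using him) (by rw [norm_neg]; exact (le_max_right _ _).trans hla)
      w u h.swap
    rw [abs_of_nonpos him, add_comm ‖u 0‖]
    obtain ⟨t1, t2⟩ := this
    simp only [Complex.neg_im, mul_neg, neg_mul, neg_neg] at t1 t2 ⊢
    exact ⟨t2, t1⟩

variable {p q : ℝ → ℂ}

/-- The combinations `y₁ ± i y₂` diagonalize `J`, which makes the free part of the system scalar
exponentials. -/
theorem IsSolution.isZSSolution {mu : ℂ} {y : ℝ → Fin 2 → ℂ} (hy : IsSolution p q mu y) :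
    IsZSSolution (fun x => q x - Complex.I * p x) (fun x => q x + Complex.I * p x) mu
      (fun x => y x 0 + Complex.I * y x 1) (fun x => y x 0 - Complex.I * y x 1) := by
  have ac := fun i => AbsolutelyContinuousOnInterval.apply_fin hy.ac i
  refine ⟨(ac 0).add ((ac 1).const_smul Complex.I), (ac 0).sub ((ac 1).const_smul Complex.I), ?_, ?_⟩
  · filter_upwards [hy.ae_hasDerivAt] with x hx hxI
    have d := fun i => hasDerivAt_pi.1 (hx hxI) i
    refine ((d 0).add ((d 1).const_mul Complex.I)).congr_deriv ?_
    simp only [coeff_apply, Matrix.cons_val_zero, Matrix.cons_val_one]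
    linear_combination -(mu * y x 1 + p x * y x 1) * Complex.I_sq
  · filter_upwards [hy.ae_hasDerivAt] with x hx hxI
    have d := fun i => hasDerivAt_pi.1 (hx hxI) i
    refine ((d 0).sub ((d 1).const_mul Complex.I)).congr_deriv ?_
    simp only [coeff_apply, Matrix.cons_val_zero, Matrix.cons_val_one]
    linear_combination -(mu * y x 1 + p x * y x 1) * Complex.I_sq

theorem RegularCoeff.exists_asymptotic (hpq : RegularCoeff p q) {ε : ℝ} (hε : 0 < ε) :
    ∃ R > 0, ∀ mu : ℂ, R ≤ ‖mu‖ →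
      ‖discriminant p q mu - 2 * Complex.cos (Real.pi * mu)‖ ≤
        ε * Real.exp (Real.pi * |mu.im|) ∧
      ‖sSol p q mu Real.pi 0 + Complex.sin (Real.pi * mu)‖ ≤
        ε * Real.exp (Real.pi * |mu.im|) := by
  obtain ⟨K, hK⟩ := hpq.bound_p
  obtain ⟨L, hL⟩ := hpq.bound_q
  have hK0 : 0 ≤ K := (norm_nonneg _).trans (hK 0 ⟨le_rfl, Real.pi_pos.le⟩)
  have hL0 : 0 ≤ L := (norm_nonneg _).trans (hL 0 ⟨le_rfl, Real.pi_pos.le⟩)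
  -- For `c` and `s` both rescaled initial components have modulus one, so each of the four errors
  -- below is at most `ε/2` times the exponential, and the discriminant collects half their sum.
  obtain ⟨R, hR, h⟩ := exists_zs_asymptotic (K := L + K) (ε := ε / 4)
    (hpq.intervalIntegrable_q.sub (hpq.intervalIntegrable_p.const_mul Complex.I))
    (hpq.intervalIntegrable_q.add (hpq.intervalIntegrable_p.const_mul Complex.I))
    (by positivity)
    (fun x hx => by
      have := norm_sub_le (q x) (Complex.I * p x)
      rw [norm_mul, Complex.norm_I, one_mul] at this
      linarith [hK x hx, hL x hx])
    (fun x hx => by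
      have := norm_add_le (q x) (Complex.I * p x)
      rw [norm_mul, Complex.norm_I, one_mul] at this
      linarith [hK x hx, hL x hx]) (by positivity)
  refine ⟨R, hR, fun mu hmu => ?_⟩
  obtain ⟨c1, c2⟩ := h mu hmu _ _ (hpq.isSolution_cSol mu).isZSSolution
  obtain ⟨s1, s2⟩ := h mu hmu _ _ (hpq.isSolution_sSol mu).isZSSolution
  simp only [hpq.cSol_zero, hpq.sSol_zero, Matrix.cons_val_zero, Matrix.cons_val_one, mul_zero,
    add_zero, sub_zero, mul_one, zero_add, zero_sub, norm_one, norm_neg, Complex.norm_I]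
    at c1 c2 s1 s2
  have hcos : Complex.cos (Real.pi * mu) = (Complex.exp (Complex.I * mu * Real.pi) +
      Complex.exp (-(Complex.I * mu * Real.pi))) / 2 := by
    rw [Complex.cos]; congr 3 <;> ring
  have hsin : Complex.sin (Real.pi * mu) = (Complex.exp (-(Complex.I * mu * Real.pi)) -
      Complex.exp (Complex.I * mu * Real.pi)) * Complex.I / 2 := by
    rw [Complex.sin]; congr 4 <;> ring
  set e₁ := Complex.exp (Complex.I * mu * Real.pi)
  set e₂ := Complex.exp (-(Complex.I * mu * Real.pi))
  set X := Real.exp (Real.pi * |mu.im|)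
  set A := cSol p q mu Real.pi 0 + Complex.I * cSol p q mu Real.pi 1 - e₁ with hA
  set B := cSol p q mu Real.pi 0 - Complex.I * cSol p q mu Real.pi 1 - e₂ with hB
  set C := sSol p q mu Real.pi 0 + Complex.I * sSol p q mu Real.pi 1 - e₁ * Complex.I with hC
  set D := sSol p q mu Real.pi 0 - Complex.I * sSol p q mu Real.pi 1 - e₂ * -Complex.I with hD
  have n1 : ‖(1 / 2 : ℂ)‖ = 1 / 2 := by simp
  have n2 : ‖(Complex.I / 2 : ℂ)‖ = 1 / 2 := by simp
  constructor
  · have e : discriminant p q mu - 2 * Complex.cos (Real.pi * mu) =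
        1 / 2 * (A + B) + Complex.I / 2 * (D - C) := by
      rw [hcos, discriminant, hA, hB, hC, hD]
      linear_combination (sSol p q mu Real.pi 1 - (e₁ + e₂) / 2) * Complex.I_sq
    rw [e]
    have t := norm_add_le (1 / 2 * (A + B)) (Complex.I / 2 * (D - C))
    rw [norm_mul, norm_mul, n1, n2] at t
    linarith [norm_add_le A B, norm_sub_le D C]
  · have e : sSol p q mu Real.pi 0 + Complex.sin (Real.pi * mu) = 1 / 2 * (C + D) := by
      rw [hsin, hC, hD]
      ring
    rw [e, norm_mul, n1]
    have : 0 ≤ ε * X := by positivity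
    linarith [norm_add_le C D]

end Asymptotics

/-! ### Entire functions asymptotic to the cosine and the continuation of their level branches -/

section CosineType

/-- `F` is entire and differs from `2 cos πz` by `o(e^{π |Im z|})`. -/
structure IsCosineType (F : ℂ → ℂ) : Prop where
  differentiable : Differentiable ℂ F
  asymptotic : ∀ ε > 0, ∃ R > 0, ∀ z : ℂ, R ≤ ‖z‖ →
    ‖F z - 2 * Complex.cos (Real.pi * z)‖ ≤ ε * Real.exp (Real.pi * |z.im|)

variable {F : ℂ → ℂ}

theorem two_cos_eq_exp (z : ℂ) : 2 * Complex.cos (Real.pi * z) =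
    Complex.exp (Complex.I * Real.pi * z) * (1 + Complex.exp (-(2 * Complex.I * Real.pi * z))) := by
  rw [mul_add, mul_one, ← Complex.exp_add, Complex.two_cos]
  congr 2 <;> ring

theorem norm_exp_I_pi_mul (z : ℂ) :
    ‖Complex.exp (Complex.I * Real.pi * z)‖ = Real.exp (-(Real.pi * z.im)) := by
  rw [Complex.norm_exp]; congr 1; simp

theorem norm_two_cos_ge (z : ℂ) :
    Real.exp (Real.pi * |z.im|) - 1 ≤ ‖2 * Complex.cos (Real.pi * z)‖ := by
  have h1 : 2 * Complex.cos (Real.pi * z) = Complex.exp (Complex.I * Real.pi * z) +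
      Complex.exp (Complex.I * Real.pi * (-z)) := by
    rw [Complex.two_cos]; congr 2 <;> ring
  rw [h1]
  have t1 := norm_sub_norm_le (Complex.exp (Complex.I * Real.pi * z))
    (-Complex.exp (Complex.I * Real.pi * (-z)))
  have t2 := norm_sub_norm_le (Complex.exp (Complex.I * Real.pi * (-z)))
    (-Complex.exp (Complex.I * Real.pi * z))
  rw [norm_neg, sub_neg_eq_add, norm_exp_I_pi_mul, norm_exp_I_pi_mul] at t1 t2
  rw [add_comm (Complex.exp (Complex.I * Real.pi * (-z)))] at t2
  simp only [Complex.neg_im, mul_neg, neg_neg] at t1 t2 ⊢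
  rcases le_total 0 z.im with h | h
  · rw [abs_of_nonneg h]
    have : Real.exp (-(Real.pi * z.im)) ≤ 1 :=
      Real.exp_le_one_iff.2 (by nlinarith [mul_nonneg Real.pi_pos.le h])
    linarith
  · rw [abs_of_nonpos h, mul_neg]
    have : Real.exp (Real.pi * z.im) ≤ 1 :=
      Real.exp_le_one_iff.2 (by nlinarith [mul_nonneg Real.pi_pos.le (neg_nonneg.2 h)])
    linarith

theorem norm_two_cos_of_re_int {z : ℂ} {n : ℤ} (hz : z.re = n) :
    ‖2 * Complex.cos (Real.pi * z)‖ = Real.exp (-(Real.pi * z.im)) + Real.exp (Real.pi * z.im) := by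
  have h1 : Complex.exp (-(2 * Complex.I * Real.pi * z)) =
      ((Real.exp (2 * (Real.pi * z.im)) : ℝ) : ℂ) := by
    have hz' : z = n + z.im * Complex.I := by
      apply Complex.ext <;> simp [hz]
    have : -(2 * Complex.I * Real.pi * z) = ((2 * (Real.pi * z.im) : ℝ) : ℂ) +
        ((-n : ℤ) : ℂ) * (2 * Real.pi * Complex.I) := by
      nth_rewrite 1 [hz']
      push_cast
      linear_combination (-2 * (Real.pi : ℂ) * z.im) * Complex.I_sq
    rw [this, Complex.exp_periodic.int_mul, Complex.ofReal_exp]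
  rw [two_cos_eq_exp, norm_mul, norm_exp_I_pi_mul, h1, ← Complex.ofReal_one, ← Complex.ofReal_add,
    Complex.norm_real, Real.norm_of_nonneg (by positivity), mul_add, mul_one, ← Real.exp_add]
  congr 2
  ring

/-- Off a horizontal strip `|2 cos πz|` grows like `e^{π|Im z|}` and the error is at most half of
that, so `|F| ≤ 2` is impossible there. -/
theorem IsCosineType.exists_im_bound (hF : IsCosineType F) :
    ∃ Y > 0, ∀ z : ℂ, ‖F z‖ ≤ 2 → |z.im| ≤ Y := by
  obtain ⟨R, hR, h⟩ := hF.asymptotic (1 / 2) (by norm_num)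
  refine ⟨max R 2, lt_max_of_lt_left hR, fun z hz => ?_⟩
  by_contra! hlt
  have h1 := h z (((le_max_left R 2).trans hlt.le).trans (Complex.abs_im_le_norm z))
  have h2 := norm_two_cos_ge z
  have h3 := norm_sub_norm_le (2 * Complex.cos (Real.pi * z)) (F z)
  rw [norm_sub_rev] at h3
  have h4 : 2 ≤ |z.im| := (le_max_right R 2).trans hlt.le
  have h5 := Real.add_one_le_exp (Real.pi * |z.im|)
  have h6 : 6 < Real.pi * |z.im| := by nlinarith [Real.pi_gt_three]
  linarith

/-- Far vertical lines through integers are barriers: on them `|2 cos πz|` is exactly `2 cosh(π Im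
z) ≥ 2`. -/
theorem IsCosineType.exists_re_int_bound (hF : IsCosineType F) {κ : ℝ} (hκ : κ < 1) :
    ∃ N : ℝ, ∀ z : ℂ, ∀ n : ℤ, z.re = n → N ≤ |(n : ℝ)| → 2 * κ < ‖F z‖ := by
  -- With this error and `κ ≥ 0`, `|F| ≥ (1 + κ)/2 · 2 cosh(π Im z) ≥ 1 + κ > 2κ`; a negative `κ` is
  -- trivial.
  obtain ⟨R, hR, h⟩ := hF.asymptotic ((1 - κ) / 2) (by linarith)
  refine ⟨R, fun z n hz hn => ?_⟩
  have h1 := h z ((hz ▸ hn : R ≤ |z.re|).trans (Complex.abs_re_le_norm z))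
  have h2 := norm_two_cos_of_re_int hz
  have h3 := norm_sub_norm_le (2 * Complex.cos (Real.pi * z)) (F z)
  rw [norm_sub_rev] at h3
  have h4 : Real.exp (Real.pi * |z.im|) ≤
      Real.exp (-(Real.pi * z.im)) + Real.exp (Real.pi * z.im) := by
    rcases abs_choice z.im with h | h <;> rw [h]
    · linarith [Real.exp_pos (-(Real.pi * z.im))]
    · rw [mul_neg]; linarith [Real.exp_pos (Real.pi * z.im)]
  have h5 : 2 ≤ Real.exp (-(Real.pi * z.im)) + Real.exp (Real.pi * z.im) := by
    linarith [Real.add_one_le_exp (-(Real.pi * z.im)), Real.add_one_le_exp (Real.pi * z.im)]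
  rcases lt_or_ge κ 0 with hneg | hpos
  · linarith [norm_nonneg (F z)]
  · nlinarith

/-- Cauchy's estimate on the unit circle around `z`; moving by at most one in the imaginary
direction costs the factor `e^π`. -/
theorem IsCosineType.deriv_asymptotic (hF : IsCosineType F) {ε : ℝ} (hε : 0 < ε) :
    ∃ R > 0, ∀ z : ℂ, R ≤ ‖z‖ →
      ‖deriv F z + 2 * Real.pi * Complex.sin (Real.pi * z)‖ ≤ ε * Real.exp (Real.pi * |z.im|) := by
  obtain ⟨R, hR, h⟩ := hF.asymptotic (ε / Real.exp Real.pi) (by positivity)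
  refine ⟨R + 1, by linarith, fun z hz => ?_⟩
  have hd : ∀ z, HasDerivAt (fun z => F z - 2 * Complex.cos (Real.pi * z))
      (deriv F z + 2 * Real.pi * Complex.sin (Real.pi * z)) z := by
    intro z
    have h1 : HasDerivAt (fun z : ℂ => (Real.pi : ℂ) * z) Real.pi z := by
      simpa using (hasDerivAt_id z).const_mul (Real.pi : ℂ)
    have := (hF.differentiable z).hasDerivAt.sub (h1.ccos.const_mul 2)
    refine this.congr_deriv ?_
    ring
  have hdc : DiffContOnCl ℂ (fun z => F z - 2 * Complex.cos (Real.pi * z)) (Metric.ball z 1) :=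
    Differentiable.diffContOnCl fun w => (hd w).differentiableAt
  have := Complex.norm_deriv_le_of_forall_mem_sphere_norm_le one_pos hdc
    (C := ε * Real.exp (Real.pi * |z.im|)) ?_
  · rwa [(hd z).deriv, div_one] at this
  · intro w hw
    rw [mem_sphere_iff_norm] at hw
    have hwR : R ≤ ‖w‖ := by
      have := norm_sub_norm_le z w
      rw [norm_sub_rev] at this
      linarith
    refine (h w hwR).trans ?_
    have him : |w.im| ≤ |z.im| + 1 := by
      have h1 := Complex.abs_im_le_norm (w - z)
      rw [Complex.sub_im] at h1
      have h2 := abs_sub_abs_le_abs_sub w.im z.im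
      linarith
    have : Real.exp (Real.pi * |w.im|) ≤ Real.exp Real.pi * Real.exp (Real.pi * |z.im|) := by
      rw [← Real.exp_add, Real.exp_le_exp]
      nlinarith [Real.pi_pos]
    calc ε / Real.exp Real.pi * Real.exp (Real.pi * |w.im|)
        ≤ ε / Real.exp Real.pi * (Real.exp Real.pi * Real.exp (Real.pi * |z.im|)) :=
          mul_le_mul_of_nonneg_left this (by positivity)
      _ = ε * Real.exp (Real.pi * |z.im|) := by
          have := (Real.exp_pos Real.pi).ne'
          field_simp

theorem exists_ne_zero_of_sin_asymptotic {g : ℂ → ℂ} {c : ℂ} (hc : c ≠ 0)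
    (hg : ∀ ε > 0, ∃ R > 0, ∀ z : ℂ, R ≤ ‖z‖ →
      ‖g z + c * Complex.sin (Real.pi * z)‖ ≤ ε * Real.exp (Real.pi * |z.im|)) :
    ∃ z, g z ≠ 0 := by
  obtain ⟨R, hR, h⟩ := hg (‖c‖ / 2) (half_pos (norm_pos_iff.2 hc))
  obtain ⟨n, hn⟩ := exists_nat_ge R
  refine ⟨((n + 1 / 2 : ℝ) : ℂ), fun h0 => ?_⟩
  have h1 := h ((n + 1 / 2 : ℝ) : ℂ) (by
    rw [Complex.norm_real, Real.norm_of_nonneg (by positivity)]; linarith)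
  have hsin : ‖Complex.sin (Real.pi * ((n + 1 / 2 : ℝ) : ℂ))‖ = 1 := by
    rw [← Complex.ofReal_mul, ← Complex.ofReal_sin, Complex.norm_real, mul_add, mul_comm Real.pi n,
      add_comm, mul_one_div, Real.sin_add_nat_mul_pi, Real.sin_pi_div_two]
    simp
  rw [h0, zero_add, norm_mul, hsin] at h1
  simp at h1
  linarith [norm_pos_iff.2 hc]

theorem finite_zeros_inter_of_isCompact {g : ℂ → ℂ} (hg : Differentiable ℂ g) (h0 : ∃ z, g z ≠ 0)
    {K : Set ℂ} (hK : IsCompact K) : (K ∩ {z | g z = 0}).Finite := by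
  have hev : ∀ w, ∀ᶠ z in 𝓝[≠] w, g z ≠ 0 := by
    intro w
    rcases (hg.analyticAt w).eventually_eq_zero_or_eventually_ne_zero with h | h
    · obtain ⟨z, hz⟩ := h0
      exact absurd (AnalyticOnNhd.eqOn_zero_of_preconnected_of_eventuallyEq_zero
        (fun z _ => hg.analyticAt z) isPreconnected_univ (mem_univ w) h (mem_univ z)) hz
    · exact h
  refine IsCompact.induction_on (p := fun K => (K ∩ {z | g z = 0}).Finite) hK (by simp)
    (fun s t hst ht => ht.subset (inter_subset_inter_left _ hst))
    (fun s t hs ht => by rw [union_inter_distrib_right]; exact hs.union ht) fun w _ => ?_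
  have := eventually_nhdsWithin_iff.1 (hev w)
  refine ⟨{z | z ∈ ({w}ᶜ : Set ℂ) → g z ≠ 0}, mem_nhdsWithin_of_mem_nhds this, ?_⟩
  refine (finite_singleton w).subset fun z hz => ?_
  by_contra hne
  exact hz.1 hne hz.2

theorem IsCosineType.deriv_eventually_ne (hF : IsCosineType F) (w : ℂ) :
    ∀ᶠ z in 𝓝[≠] w, deriv F z ≠ 0 := by
  have hd : Differentiable ℂ (deriv F) := hF.differentiable.deriv
  rcases (hd.analyticAt w).eventually_eq_zero_or_eventually_ne_zero with h | h
  · obtain ⟨z, hz⟩ := exists_ne_zero_of_sin_asymptotic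
      (c := 2 * Real.pi) (by simp [Real.pi_ne_zero]) (fun ε hε => hF.deriv_asymptotic hε)
    exact absurd (AnalyticOnNhd.eqOn_zero_of_preconnected_of_eventuallyEq_zero
      (fun z _ => hd.analyticAt z) isPreconnected_univ (mem_univ w) h (mem_univ z)) hz
  · exact h

theorem norm_two_cos_le (t : ℝ) : ‖2 * Complex.cos (Real.pi * t)‖ ≤ 2 := by
  rw [← Complex.ofReal_mul, ← Complex.ofReal_cos, norm_mul, Complex.norm_real, Real.norm_eq_abs]
  have := Real.abs_cos_le_one (Real.pi * t)
  simp
  linarith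

/-- At a far zero of `g` the value `sin πz` is small, while `F z = 2 cos πt` makes `cos πz` close to
`cos πt`. Then `sin πt` would be small too, contradicting the lower bound `δ`. It is applied to `F'`
and to `s₁(π, ·)`. -/
theorem IsCosineType.exists_bound_of_sin_asymptotic (hF : IsCosineType F) {g : ℂ → ℂ} {c : ℂ}
    (hc : c ≠ 0) (hg : ∀ ε > 0, ∃ R > 0, ∀ z : ℂ, R ≤ ‖z‖ →
      ‖g z + c * Complex.sin (Real.pi * z)‖ ≤ ε * Real.exp (Real.pi * |z.im|)) {δ : ℝ} (hδ : 0 < δ) :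
    ∃ R, ∀ (z : ℂ) (t : ℝ), F z = 2 * Complex.cos (Real.pi * t) → g z = 0 →
      δ ≤ |Real.sin (Real.pi * t)| → ‖z‖ ≤ R := by
  obtain ⟨Y, hY, him⟩ := hF.exists_im_bound
  have hE := Real.exp_pos (Real.pi * Y)
  set E := Real.exp (Real.pi * Y) with hEdef
  have hc' := norm_pos_iff.2 hc
  -- The errors combine to `sin² πt ≤ 2η² + 2η ≤ 4η`, which is strictly below `8η ≤ δ²`.
  set η := min 1 (δ ^ 2) / 8 with hη
  have hη0 : 0 < η := by positivity
  have hη1 : η ≤ 1 := by have := min_le_left 1 (δ ^ 2); rw [hη]; linarith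
  have hηδ : 8 * η ≤ δ ^ 2 := by have := min_le_right 1 (δ ^ 2); rw [hη]; linarith
  obtain ⟨R₁, hR₁, h1⟩ := hF.asymptotic (2 * η / E) (by positivity)
  obtain ⟨R₂, hR₂, h2⟩ := hg (‖c‖ * η / E) (by positivity)
  refine ⟨max R₁ R₂, fun z t hz hg0 ht => ?_⟩
  by_contra! hlt
  have hzY := him z (hz ▸ norm_two_cos_le t)
  have hexp : Real.exp (Real.pi * |z.im|) ≤ E :=
    Real.exp_le_exp.2 (mul_le_mul_of_nonneg_left hzY Real.pi_pos.le)
  have a1 : ‖2 * Complex.cos (Real.pi * t) - 2 * Complex.cos (Real.pi * z)‖ ≤ 2 * η := by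
    rw [← hz]
    refine (h1 z ((le_max_left _ _).trans hlt.le)).trans ?_
    have := mul_le_mul_of_nonneg_left hexp (by positivity : 0 ≤ 2 * η / E)
    rwa [div_mul_cancel₀ _ hE.ne'] at this
  have a2 : ‖c‖ * ‖Complex.sin (Real.pi * z)‖ ≤ ‖c‖ * η := by
    have h := h2 z ((le_max_right _ _).trans hlt.le)
    rw [hg0, zero_add, norm_mul] at h
    refine h.trans ?_
    have := mul_le_mul_of_nonneg_left hexp (by positivity : 0 ≤ ‖c‖ * η / E)
    rwa [div_mul_cancel₀ _ hE.ne'] at this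
  have a2' := le_of_mul_le_mul_left a2 hc'
  have a1' : ‖Complex.cos (Real.pi * t) - Complex.cos (Real.pi * z)‖ ≤ η := by
    rw [← mul_sub, norm_mul] at a1
    simp at a1
    linarith
  have hcosle : ‖Complex.cos (Real.pi * t)‖ ≤ 1 := by
    have := norm_two_cos_le t
    rw [norm_mul] at this
    simp at this
    linarith
  have key : Complex.sin (Real.pi * t) ^ 2 = Complex.sin (Real.pi * z) ^ 2 -
      (Complex.cos (Real.pi * t) - Complex.cos (Real.pi * z)) *
        (2 * Complex.cos (Real.pi * t) - (Complex.cos (Real.pi * t) - Complex.cos (Real.pi * z))) := by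
    linear_combination Complex.sin_sq_add_cos_sq ((Real.pi : ℂ) * t) -
      Complex.sin_sq_add_cos_sq ((Real.pi : ℂ) * z)
  have n1 : ‖Complex.sin (Real.pi * t) ^ 2‖ = |Real.sin (Real.pi * t)| ^ 2 := by
    rw [← Complex.ofReal_mul, ← Complex.ofReal_sin, norm_pow, Complex.norm_real, Real.norm_eq_abs]
  have n2 : ‖Complex.sin (Real.pi * t) ^ 2‖ ≤ η ^ 2 + η * (2 + η) := by
    rw [key]
    refine (norm_sub_le _ _).trans (add_le_add ?_ ?_)
    · rw [norm_pow]; exact pow_le_pow_left₀ (norm_nonneg _) a2' 2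
    · rw [norm_mul]
      refine mul_le_mul a1' ((norm_sub_le _ _).trans (add_le_add ?_ a1')) (norm_nonneg _) hη0.le
      rw [norm_mul]
      simp
      linarith
  rw [n1] at n2
  have n3 : δ ^ 2 ≤ |Real.sin (Real.pi * t)| ^ 2 := pow_le_pow_left₀ hδ.le ht 2
  nlinarith

/-- By the intermediate value theorem the real part of the branch cannot cross a barrier line, and
the imaginary part lies in the strip. -/
theorem IsCosineType.exists_norm_bound_of_continuousOn (hF : IsCosineType F) {la : ℝ → ℂ}
    {a b κ : ℝ} (hla : ContinuousOn la (Ioo a b))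
    (h : ∀ t ∈ Ioo a b, F (la t) = 2 * Complex.cos (Real.pi * t)) (hκ : κ < 1)
    (hcos : ∀ t ∈ Ioo a b, |Real.cos (Real.pi * t)| ≤ κ) :
    ∃ R, ∀ t ∈ Ioo a b, ‖la t‖ ≤ R := by
  rcases (Ioo a b).eq_empty_or_nonempty with he | ⟨t₁, ht₁⟩
  · exact ⟨0, by simp [he]⟩
  obtain ⟨Y, hY, him⟩ := hF.exists_im_bound
  obtain ⟨N, hN⟩ := hF.exists_re_int_bound hκ
  obtain ⟨M, hM⟩ := exists_nat_ge (max N |(la t₁).re|)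
  have hM1 : N ≤ M := (le_max_left _ _).trans hM
  have hM2 := abs_le.1 ((le_max_right _ _).trans hM)
  have hre : ContinuousOn (fun t => (la t).re) (Ioo a b) :=
    Complex.continuous_re.comp_continuousOn hla
  have hnorm : ∀ t ∈ Ioo a b, ‖F (la t)‖ ≤ 2 * κ := by
    intro t ht
    rw [h t ht, ← Complex.ofReal_mul, ← Complex.ofReal_cos, norm_mul, Complex.norm_real,
      Real.norm_eq_abs]
    simpa using hcos t ht
  have hno : ∀ n : ℤ, N ≤ |(n : ℝ)| → (n : ℝ) ∉ (fun t => (la t).re) '' Ioo a b := by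
    rintro n hn ⟨t, ht, hte⟩
    exact absurd (hnorm t ht) (not_le.2 (hN (la t) n hte hn))
  have hup : ∀ t ∈ Ioo a b, (la t).re ≤ M := by
    intro t ht
    by_contra! hlt
    refine hno (M : ℤ) (by simpa using hM1) ?_
    exact isPreconnected_Ioo.intermediate_value ht₁ ht hre ⟨by simpa using hM2.2, by simpa using hlt.le⟩
  have hlow : ∀ t ∈ Ioo a b, -(M : ℝ) ≤ (la t).re := by
    intro t ht
    by_contra! hlt
    refine hno (-M : ℤ) (by simpa using hM1) ?_
    exact isPreconnected_Ioo.intermediate_value ht ht₁ hre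
      ⟨by simpa using hlt.le, by simpa using hM2.1⟩
  refine ⟨M + Y, fun t ht => ?_⟩
  have h1 := Complex.norm_le_abs_re_add_abs_im (la t)
  have h2 := him (la t) (h t ht ▸ norm_two_cos_le t)
  have h3 : |(la t).re| ≤ M := abs_le.2 ⟨hlow t ht, hup t ht⟩
  linarith

theorem hasDerivAt_two_cos (a : ℝ) :
    HasDerivAt (fun t : ℝ => 2 * Complex.cos (Real.pi * t))
      (-(2 * Real.pi * Complex.sin (Real.pi * a))) a := by
  have h0 : HasDerivAt (fun r : ℂ => (Real.pi : ℂ) * r) Real.pi (a : ℂ) := by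
    simpa using (hasDerivAt_id (a : ℂ)).const_mul (Real.pi : ℂ)
  refine ((h0.ccos.const_mul 2).comp_ofReal).congr_deriv ?_
  ring

theorem sin_pi_mul_ne_zero {a : ℝ} (ha : ∀ n : ℤ, a ≠ n) : Real.sin (Real.pi * a) ≠ 0 := by
  rw [Real.sin_ne_zero_iff]
  intro n hn
  apply ha n
  rw [mul_comm] at hn
  exact (mul_left_cancel₀ Real.pi_ne_zero hn).symm

theorem two_cos_deriv_ne_zero {a : ℝ} (ha : ∀ n : ℤ, a ≠ n) :
    -(2 * Real.pi * Complex.sin (Real.pi * a)) ≠ 0 := by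
  have := sin_pi_mul_ne_zero ha
  rw [← Complex.ofReal_mul, ← Complex.ofReal_sin]
  have hpi : (Real.pi : ℂ) ≠ 0 := by exact_mod_cast Real.pi_ne_zero
  have h2 : ((Real.sin (Real.pi * a) : ℝ) : ℂ) ≠ 0 := by exact_mod_cast this
  exact neg_ne_zero.2 (mul_ne_zero (mul_ne_zero two_ne_zero hpi) h2)

theorem IsCosineType.eventually_ne (hF : IsCosineType F) (w c : ℂ) :
    ∀ᶠ z in 𝓝[≠] w, F z ≠ c := by
  have hd : Differentiable ℂ fun z => F z - c := hF.differentiable.sub_const c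
  rcases (hd.analyticAt w).eventually_eq_zero_or_eventually_ne_zero with h | h
  · have hzero : ∀ᶠ z in 𝓝 w, deriv F z = 0 := by
      filter_upwards [eventually_eventually_nhds.2 h] with z hz
      have : F =ᶠ[𝓝 z] fun _ => c := hz.mono fun _ h => sub_eq_zero.1 h
      rw [this.deriv_eq, deriv_const]
    exact ((hF.deriv_eventually_ne w).and (hzero.filter_mono nhdsWithin_le_nhds)).exists.elim
      fun z hz => absurd hz.2 hz.1
  · exact h.mono fun z hz => sub_ne_zero.1 hz

/-- As `a` is not an integer, `|cos πt|` stays below some `κ < 1` nearby, so the branch is bounded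
and has a cluster point `l`. Solutions of `F = F(l)` are isolated, so on a small circle around `l`
the function `F` stays away from `2 cos πa`; for `t` near `a` the branch cannot meet that circle and
is trapped inside it. -/
theorem IsCosineType.exists_tendsto_right (hF : IsCosineType F) {la : ℝ → ℂ} {a b : ℝ} (hab : a < b)
    (hla : ContinuousOn la (Ioo a b))
    (h : ∀ t ∈ Ioo a b, F (la t) = 2 * Complex.cos (Real.pi * t)) (ha : ∀ n : ℤ, a ≠ n) :
    ∃ l, Tendsto la (𝓝[>] a) (𝓝 l) ∧ F l = 2 * Complex.cos (Real.pi * a) := by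
  have hcosc : Continuous fun t : ℝ => 2 * Complex.cos (Real.pi * t) := by fun_prop
  have hca : |Real.cos (Real.pi * a)| < 1 := by
    rw [← sq_lt_one_iff_abs_lt_one]
    have h1 := Real.sin_sq_add_cos_sq (Real.pi * a)
    have h2 := pow_pos (abs_pos.2 (sin_pi_mul_ne_zero ha)) 2
    rw [sq_abs] at h2
    linarith
  obtain ⟨κ, hκ1, hκ2⟩ := exists_between hca
  have hev : ∀ᶠ t in 𝓝 a, |Real.cos (Real.pi * t)| < κ := by
    have : Continuous fun t : ℝ => |Real.cos (Real.pi * t)| := by fun_prop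
    exact this.continuousAt.eventually (gt_mem_nhds hκ1)
  obtain ⟨c, hac, hc⟩ := (mem_nhdsGE_iff_exists_Ico_subset' hab).1
    (mem_nhdsWithin_of_mem_nhds hev)
  have hbd : ∃ R, ∀ t ∈ Ioo a (min b c), ‖la t‖ ≤ R := by
    have hsub : Ioo a (min b c) ⊆ Ioo a b := Ioo_subset_Ioo_right (min_le_left _ _)
    exact hF.exists_norm_bound_of_continuousOn (hla.mono hsub) (fun t ht => h t (hsub ht)) hκ2
      fun t ht => (hc ⟨ht.1.le, ht.2.trans_le (min_le_right _ _)⟩).le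
  obtain ⟨R, hR⟩ := hbd
  have hlt : a < min b c := lt_min hab hac
  have hmem : Ioo a (min b c) ∈ 𝓝[>] a := Ioo_mem_nhdsGT hlt
  have hmap : map la (𝓝[>] a) ≤ 𝓟 (Metric.closedBall 0 R) := by
    rw [le_principal_iff, mem_map]
    exact mem_of_superset hmem fun t ht => by simpa using hR t ht
  obtain ⟨l, -, hl⟩ := (isCompact_closedBall (0 : ℂ) R).exists_mapClusterPt hmap
  have hFt : Tendsto (F ∘ la) (𝓝[>] a) (𝓝 (2 * Complex.cos (Real.pi * a))) := by
    refine ((hcosc.tendsto a).mono_left nhdsWithin_le_nhds).congr' ?_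
    filter_upwards [Ioo_mem_nhdsGT hab] with t ht
    exact (h t ht).symm
  have hFl : F l = 2 * Complex.cos (Real.pi * a) := by
    have hcl : MapClusterPt (F l) (𝓝[>] a) (F ∘ la) :=
      hl.tendsto_comp (hF.differentiable.continuous.tendsto l)
    have : ClusterPt (F l) (𝓝 (2 * Complex.cos (Real.pi * a))) :=
      ClusterPt.mono hcl hFt
    exact eq_of_nhds_neBot this
  refine ⟨l, ?_, hFl⟩
  rw [Metric.tendsto_nhds]
  intro ε hε
  obtain ⟨r, hr, hrs⟩ := Metric.mem_nhdsWithin_iff.1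
    (hF.eventually_ne l (2 * Complex.cos (Real.pi * a)))
  set ρ := min ε (r / 2) with hρ
  have hρ0 : 0 < ρ := lt_min hε (half_pos hr)
  have hρr : ρ < r := (min_le_right _ _).trans_lt (half_lt_self hr)
  have hsne : (Metric.sphere l ρ).Nonempty := NormedSpace.sphere_nonempty.2 hρ0.le
  have hcont : Continuous fun z => ‖F z - 2 * Complex.cos (Real.pi * a)‖ :=
    (hF.differentiable.continuous.sub continuous_const).norm
  -- The minimum on the circle is positive and beats `|2 cos πt - 2 cos πa|` for `t` near `a`.
  obtain ⟨z₀, hz₀, hmin⟩ := (isCompact_sphere l ρ).exists_isMinOn hsne hcont.continuousOn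
  have hm0 : 0 < ‖F z₀ - 2 * Complex.cos (Real.pi * a)‖ := by
    rw [norm_pos_iff, sub_ne_zero]
    refine hrs ⟨?_, ?_⟩
    · rw [Metric.mem_ball, Metric.mem_sphere.1 hz₀]; exact hρr
    · intro he
      rw [mem_singleton_iff.1 he, Metric.mem_sphere, dist_self] at hz₀
      exact hρ0.ne hz₀
  have hev2 : ∀ᶠ t : ℝ in 𝓝 a, ‖2 * Complex.cos (Real.pi * t) - 2 * Complex.cos (Real.pi * a)‖ <
      ‖F z₀ - 2 * Complex.cos (Real.pi * a)‖ := by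
    have h1 : Continuous fun t : ℝ =>
      ‖2 * Complex.cos (Real.pi * t) - 2 * Complex.cos (Real.pi * a)‖ := by fun_prop
    refine h1.continuousAt.eventually (gt_mem_nhds ?_)
    simpa using hm0
  obtain ⟨d, had, hd⟩ := (mem_nhdsGE_iff_exists_Ico_subset' hab).1
    (mem_nhdsWithin_of_mem_nhds hev2)
  set e := min b d with he
  have hae : a < e := lt_min hab had
  have hsub : Ioo a e ⊆ Ioo a b := Ioo_subset_Ioo_right (min_le_left _ _)
  have hnot : ρ ∉ (fun t => dist (la t) l) '' Ioo a e := by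
    rintro ⟨t, ht, hte⟩
    have h1 := hmin (Metric.mem_sphere.2 hte)
    simp only [mem_ofPred_eq] at h1
    rw [h t (hsub ht)] at h1
    exact absurd (hd ⟨ht.1.le, ht.2.trans_le (min_le_right _ _)⟩) (not_lt.2 h1)
  have hdist : ContinuousOn (fun t => dist (la t) l) (Ioo a e) :=
    continuous_dist.comp_continuousOn ((hla.mono hsub).prodMk continuousOn_const)
  have hfreq : ∃ᶠ t in 𝓝[>] a, la t ∈ Metric.ball l ρ :=
    hl.frequently (Metric.ball_mem_nhds l hρ0)
  obtain ⟨t₁, ht₁, ht₁e⟩ := (hfreq.and_eventually (Ioo_mem_nhdsGT hae)).exists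
  filter_upwards [Ioo_mem_nhdsGT hae] with t ht
  by_contra! hle
  refine hnot (isPreconnected_Ioo.intermediate_value ht₁e ht hdist ⟨?_, ?_⟩)
  · exact (Metric.mem_ball.1 ht₁).le
  · exact (min_le_left _ _).trans hle

end CosineType

/-! ### Integrability of the reciprocal derivative along a branch -/

section LocalIntegrability

variable {F : ℂ → ℂ} {E : Type*} [NormedAddCommGroup E] [NormedSpace ℂ E]

/-- If `F'` vanishes to order `m` at `l`, then `F - F(l)` vanishes to order `m + 1`; the exponent is
`θ = m / (m + 1)`, strictly below one. -/
theorem exists_rpow_le_norm_deriv {l : ℂ} (hF : Differentiable ℂ F)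
    (hne : ∀ᶠ z in 𝓝[≠] l, F z ≠ F l) :
    ∃ θ : ℝ, 0 ≤ θ ∧ θ < 1 ∧ ∃ c > 0, ∀ᶠ z in 𝓝 l, c * ‖F z - F l‖ ^ θ ≤ ‖deriv F z‖ := by
  have hA := hF.analyticAt l
  have hA' : AnalyticAt ℂ (fun z => F z - F l) l := hA.sub analyticAt_const
  have htop : analyticOrderAt (fun z => F z - F l) l ≠ ⊤ := by
    rw [Ne, analyticOrderAt_eq_top]
    intro h
    obtain ⟨z, h1, h2⟩ := ((h.filter_mono nhdsWithin_le_nhds).and hne).exists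
    exact h2 (sub_eq_zero.1 h1)
  have hord := hA.analyticOrderAt_deriv_add_one
  have htop' : analyticOrderAt (deriv F) l ≠ ⊤ := by
    intro h
    rw [h] at hord
    exact htop hord.symm
  obtain ⟨m, hm⟩ := ENat.ne_top_iff_exists.1 htop'
  obtain ⟨g, hg, hg0, hgz⟩ := (hA.deriv.analyticOrderAt_eq_natCast).1 hm.symm
  have hm1 : analyticOrderAt (fun z => F z - F l) l = ((m + 1 : ℕ) : ℕ∞) := by
    rw [← hord, ← hm]; rfl
  obtain ⟨k, hk, hk0, hkz⟩ := (hA'.analyticOrderAt_eq_natCast).1 hm1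
  set θ : ℝ := m / (m + 1) with hθ
  have hθ0 : 0 ≤ θ := by positivity
  have hA0 : 0 < ‖k l‖ + 1 := by positivity
  have hB0 : 0 < ‖g l‖ / 2 := half_pos (norm_pos_iff.2 hg0)
  refine ⟨θ, hθ0, by rw [hθ, div_lt_one (by positivity)]; linarith,
    (‖g l‖ / 2) / (‖k l‖ + 1) ^ θ, by positivity, ?_⟩
  have e1 : ∀ᶠ z in 𝓝 l, ‖k z‖ < ‖k l‖ + 1 :=
    hk.continuousAt.norm.eventually (gt_mem_nhds (by linarith))
  have e2 : ∀ᶠ z in 𝓝 l, ‖g l‖ / 2 < ‖g z‖ :=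
    hg.continuousAt.norm.eventually (lt_mem_nhds (by linarith))
  filter_upwards [hgz, hkz, e1, e2] with z h1 h2 h3 h4
  rw [h1, h2, norm_smul, norm_smul, norm_pow, norm_pow,
    Real.mul_rpow (by positivity) (norm_nonneg _), ← Real.rpow_natCast, ← Real.rpow_mul (norm_nonneg _)]
  have hexp : ((m + 1 : ℕ) : ℝ) * θ = m := by
    rw [hθ]; push_cast; field_simp
  rw [hexp, Real.rpow_natCast]
  have h5 : ‖k z‖ ^ θ ≤ (‖k l‖ + 1) ^ θ := Real.rpow_le_rpow (norm_nonneg _) h3.le hθ0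
  have h6 : 0 < (‖k l‖ + 1) ^ θ := by positivity
  calc ‖g l‖ / 2 / (‖k l‖ + 1) ^ θ * (‖z - l‖ ^ m * ‖k z‖ ^ θ)
      ≤ ‖g l‖ / 2 / (‖k l‖ + 1) ^ θ * (‖z - l‖ ^ m * (‖k l‖ + 1) ^ θ) := by gcongr
    _ = ‖z - l‖ ^ m * (‖g l‖ / 2) := by field_simp
    _ ≤ ‖z - l‖ ^ m * ‖g z‖ := by gcongr

theorem exists_lower_bound_of_hasDerivAt {f : ℝ → ℂ} {f' : ℂ} {a : ℝ} (hf : HasDerivAt f f' a)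
    (hf' : f' ≠ 0) : ∃ c > 0, ∀ᶠ t in 𝓝 a, c * |t - a| ≤ ‖f t - f a‖ := by
  have hpos : 0 < ‖f'‖ / 2 := half_pos (norm_pos_iff.2 hf')
  refine ⟨‖f'‖ / 2, hpos, ?_⟩
  filter_upwards [(hasDerivAt_iff_isLittleO.1 hf).def hpos] with t ht
  have h1 := norm_sub_norm_le ((t - a) • f') (f t - f a)
  rw [norm_smul] at h1
  rw [norm_sub_rev] at ht
  rw [Real.norm_eq_abs] at ht h1
  linarith

/-- Along the branch `F(la t) - F(l)` is the increment of `2 cos πt`, at least linear in `t - a`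
since `a` is not an integer. So `1/|F'|` is dominated by a multiple of `(t - a)^{-θ}` with `θ < 1`,
and the same bound shows that `F'` does not vanish just to the right of `a`. -/
theorem IsCosineType.exists_integrableOn_right (hF : IsCosineType F) {la : ℝ → ℂ} {a b : ℝ}
    (hab : a < b) (hla : ContinuousOn la (Ioo a b))
    (h : ∀ t ∈ Ioo a b, F (la t) = 2 * Complex.cos (Real.pi * t)) (ha : ∀ n : ℤ, a ≠ n)
    {G : ℂ × ℂ → E} (hG : Continuous G) :
    ∃ c > a, (∀ t ∈ Ioo a c, deriv F (la t) ≠ 0) ∧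
      IntegrableOn (fun t : ℝ => (deriv F (la t))⁻¹ • G (la t, t)) (Ioo a c) := by
  obtain ⟨l, hl, hFl⟩ := hF.exists_tendsto_right hab hla h ha
  obtain ⟨θ, hθ0, hθ1, c₁, hc₁, hlow⟩ :=
    exists_rpow_le_norm_deriv hF.differentiable (hF.eventually_ne l (F l))
  obtain ⟨c₂, hc₂, hcos⟩ :=
    exists_lower_bound_of_hasDerivAt (hasDerivAt_two_cos a) (two_cos_deriv_ne_zero ha)
  have hcG : Tendsto (fun t : ℝ => ‖G (la t, t)‖) (𝓝[>] a) (𝓝 ‖G (l, a)‖) := by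
    have h1 : Tendsto (fun t : ℝ => (t : ℂ)) (𝓝[>] a) (𝓝 (a : ℂ)) :=
      (Complex.continuous_ofReal.tendsto a).mono_left nhdsWithin_le_nhds
    exact ((hG.tendsto (l, (a : ℂ))).comp (hl.prodMk_nhds h1)).norm
  have ev : ∀ᶠ t in 𝓝[>] a, (c₁ * ‖F (la t) - F l‖ ^ θ ≤ ‖deriv F (la t)‖ ∧
      c₂ * |t - a| ≤ ‖2 * Complex.cos (Real.pi * t) - 2 * Complex.cos (Real.pi * a)‖) ∧
      ‖G (la t, t)‖ < ‖G (l, a)‖ + 1 :=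
    ((hl.eventually hlow).and (hcos.filter_mono nhdsWithin_le_nhds)).and
      (hcG.eventually (gt_mem_nhds (by linarith)))
  obtain ⟨d, had, hd⟩ := (mem_nhdsGT_iff_exists_Ioo_subset' hab).1 ev
  set c := min b d with hc
  have hac : a < c := lt_min hab had
  have hcb : Ioo a c ⊆ Ioo a b := Ioo_subset_Ioo_right (min_le_left _ _)
  have hbound : ∀ t ∈ Ioo a c, c₁ * c₂ ^ θ * (t - a) ^ θ ≤ ‖deriv F (la t)‖ := by
    intro t ht
    obtain ⟨⟨h1, h2⟩, -⟩ := hd ⟨ht.1, ht.2.trans_le (min_le_right _ _)⟩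
    rw [h t (hcb ht), hFl] at h1
    rw [abs_of_pos (sub_pos.2 ht.1)] at h2
    refine le_trans ?_ h1
    rw [mul_assoc, ← Real.mul_rpow hc₂.le (sub_pos.2 ht.1).le]
    exact mul_le_mul_of_nonneg_left
      (Real.rpow_le_rpow (mul_nonneg hc₂.le (sub_pos.2 ht.1).le) h2 hθ0) hc₁.le
  have hpos : ∀ t ∈ Ioo a c, 0 < c₁ * c₂ ^ θ * (t - a) ^ θ := fun t ht => by
    have := Real.rpow_pos_of_pos (sub_pos.2 ht.1) θ
    positivity
  have hne : ∀ t ∈ Ioo a c, deriv F (la t) ≠ 0 := fun t ht =>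
    norm_pos_iff.1 ((hpos t ht).trans_le (hbound t ht))
  refine ⟨c, hac, hne, ?_⟩
  have hcontG : ContinuousOn (fun t : ℝ => G (la t, t)) (Ioo a c) :=
    hG.comp_continuousOn ((hla.mono hcb).prodMk Complex.continuous_ofReal.continuousOn)
  have hcontF : ContinuousOn (fun t : ℝ => deriv F (la t)) (Ioo a c) :=
    hF.differentiable.deriv.continuous.comp_continuousOn (hla.mono hcb)
  have hcont : ContinuousOn (fun t : ℝ => (deriv F (la t))⁻¹ • G (la t, t)) (Ioo a c) :=
    (hcontF.inv₀ hne).smul hcontG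
  have hint : IntegrableOn (fun t : ℝ => (c₁ * c₂ ^ θ)⁻¹ * (‖G (l, a)‖ + 1) * (t - a) ^ (-θ))
      (Ioo a c) := by
    have h1 : IntervalIntegrable (fun x : ℝ => x ^ (-θ)) volume 0 (c - a) :=
      intervalIntegral.intervalIntegrable_rpow' (by linarith)
    have h2 := h1.comp_sub_right a
    rw [zero_add, sub_add_cancel] at h2
    exact ((intervalIntegrable_iff_integrableOn_Ioo_of_le hac.le).1 h2).const_mul _
  refine Integrable.mono' hint (hcont.aestronglyMeasurable measurableSet_Ioo) ?_
  refine (ae_restrict_iff' measurableSet_Ioo).2 (Eventually.of_forall fun t ht => ?_)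
  rw [norm_smul, norm_inv, Real.rpow_neg (sub_pos.2 ht.1).le]
  have h1 := inv_anti₀ (hpos t ht) (hbound t ht)
  have h2 := (hd ⟨ht.1, ht.2.trans_le (min_le_right _ _)⟩).2.le
  calc ‖deriv F (la t)‖⁻¹ * ‖G (la t, t)‖
      ≤ (c₁ * c₂ ^ θ * (t - a) ^ θ)⁻¹ * (‖G (l, a)‖ + 1) :=
        mul_le_mul h1 h2 (norm_nonneg _) (inv_nonneg.2 (hpos t ht).le)
    _ = (c₁ * c₂ ^ θ)⁻¹ * (‖G (l, a)‖ + 1) * ((t - a) ^ θ)⁻¹ := by rw [mul_inv]; ring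

theorem IsCosineType.exists_integrableOn_left (hF : IsCosineType F) {la : ℝ → ℂ} {a b : ℝ}
    (hab : b < a) (hla : ContinuousOn la (Ioo b a))
    (h : ∀ t ∈ Ioo b a, F (la t) = 2 * Complex.cos (Real.pi * t)) (ha : ∀ n : ℤ, a ≠ n)
    {G : ℂ × ℂ → E} (hG : Continuous G) :
    ∃ c < a, (∀ t ∈ Ioo c a, deriv F (la t) ≠ 0) ∧
      IntegrableOn (fun t : ℝ => (deriv F (la t))⁻¹ • G (la t, t)) (Ioo c a) := by
  have hneg : ∀ {u v t : ℝ}, t ∈ Ioo (-v) (-u) → -t ∈ Ioo u v := fun ht =>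
    ⟨by linarith [ht.2], by linarith [ht.1]⟩
  obtain ⟨c, hc, h1, h2⟩ := hF.exists_integrableOn_right (la := fun t => la (-t)) (a := -a) (b := -b)
    (neg_lt_neg hab)
    (hla.comp continuous_neg.continuousOn fun t ht => hneg ht)
    (fun t ht => by rw [h (-t) (hneg ht)]; push_cast; rw [mul_neg, Complex.cos_neg])
    (fun n hn => ha (-n) (by push_cast; linarith))
    (G := fun z => G (z.1, -z.2)) (by fun_prop)
  refine ⟨-c, by linarith, fun t ht => ?_, ?_⟩
  · have := h1 (-t) ⟨by linarith [ht.2], by linarith [ht.1]⟩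
    rwa [neg_neg] at this
  · have hmp := Measure.measurePreserving_neg (volume : Measure ℝ)
    rw [← hmp.integrableOn_comp_preimage (Homeomorph.neg ℝ).measurableEmbedding]
    have hset : Neg.neg ⁻¹' Ioo (-c) a = Ioo (-a) c := by
      ext t
      simp only [mem_preimage, mem_Ioo]
      constructor <;> rintro ⟨_, _⟩ <;> constructor <;> linarith
    rw [hset]
    refine h2.congr_fun (fun t _ => ?_) measurableSet_Ioo
    simp

end LocalIntegrability

/-- The local condition is required at every point of the compact set, including the points missing
from `S`: these are where the integrand may blow up. -/
theorem integrableOn_of_forall_integrableAtFilter {E : Type*} [NormedAddCommGroup E] {g : ℝ → E} {S K : Set ℝ} (hK : IsCompact K)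
    (hSK : S ⊆ K) (h : ∀ t ∈ K, IntegrableAtFilter g (𝓝[S] t)) : IntegrableOn g S := by
  have := IsCompact.induction_on (p := fun s => IntegrableOn g (s ∩ S) volume) hK (by simp)
    (fun s t hst ht => ht.mono_set (inter_subset_inter_left _ hst))
    (fun s t hs ht => by rw [union_inter_distrib_right]; exact hs.union ht) (fun t ht => ?_)
  · rwa [inter_eq_right.2 hSK] at this
  · obtain ⟨s, hs, hi⟩ := h t ht
    obtain ⟨u, hu, hus⟩ := mem_nhdsWithin_iff_exists_mem_nhds_inter.1 hs
    exact ⟨u, mem_nhdsWithin_of_mem_nhds hu, hi.mono_set hus⟩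

theorem integrableAtFilter_of_punctured {E : Type*} [NormedAddCommGroup E] {g : ℝ → E} {S : Set ℝ} {t : ℝ}
    (hr : ∃ c > t, IntegrableOn g (S ∩ Ioo t c)) (hl : ∃ c < t, IntegrableOn g (S ∩ Ioo c t)) :
    IntegrableAtFilter g (𝓝[S] t) := by
  obtain ⟨c, hc, hic⟩ := hr
  obtain ⟨d, hd, hid⟩ := hl
  refine ⟨S ∩ Ioo d c, inter_mem self_mem_nhdsWithin
    (mem_nhdsWithin_of_mem_nhds (Ioo_mem_nhds hd hc)), ?_⟩
  have h0 : IntegrableOn g {t} := by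
    rw [IntegrableOn, Measure.restrict_eq_zero.2 (by simp)]
    exact integrable_zero_measure
  refine ((hic.union hid).union h0).mono_set ?_
  rintro s ⟨hs, hs1, hs2⟩
  rcases lt_trichotomy s t with h | h | h
  · exact Or.inl (Or.inr ⟨hs, hs1, h⟩)
  · exact Or.inr h
  · exact Or.inl (Or.inl ⟨hs, h, hs2⟩)

/-! ### Bloch systems: regular points, semicircles and integer quasimomenta -/

section Bloch

variable {p q : ℝ → ℂ}

theorem RegularCoeff.isCosineType (hpq : RegularCoeff p q) : IsCosineType (discriminant p q) :=
  ⟨hpq.differentiable_discriminant, fun ε hε => by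
    obtain ⟨R, hR, h⟩ := hpq.exists_asymptotic hε
    exact ⟨R, hR, fun z hz => (h z hz).1⟩⟩

/-- For `t` near `a` the relevant zeros of `F'` and `s₁(π, ·)` lie in a fixed disc, so there are
finitely many. Each produces one value of `2 cos πt`, and the cosine, having non-zero derivative at
`a`, avoids it on a punctured neighbourhood. -/
theorem RegularCoeff.eventually_notMem_exceptional (hpq : RegularCoeff p q) (h : ℝ) {a : ℝ}
    (ha : ∀ n : ℤ, a ≠ n) : ∀ᶠ t : ℝ in 𝓝[≠] a, (t : ℂ) ∉ exceptional p q h := by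
  have hF := hpq.isCosineType
  have hδ : 0 < |Real.sin (Real.pi * a)| := abs_pos.2 (sin_pi_mul_ne_zero ha)
  set δ := |Real.sin (Real.pi * a)| with hδdef
  have hs : ∀ ε > 0, ∃ R > 0, ∀ z : ℂ, R ≤ ‖z‖ →
      ‖sSol p q z Real.pi 0 + 1 * Complex.sin (Real.pi * z)‖ ≤ ε * Real.exp (Real.pi * |z.im|) := by
    intro ε hε
    obtain ⟨R, hR, h⟩ := hpq.exists_asymptotic hε
    exact ⟨R, hR, fun z hz => by rw [one_mul]; exact (h z hz).2⟩
  have hc : (2 * Real.pi : ℂ) ≠ 0 := by simp [Real.pi_ne_zero]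
  have hd : ∀ ε > 0, ∃ R > 0, ∀ z : ℂ, R ≤ ‖z‖ →
      ‖deriv (discriminant p q) z + 2 * Real.pi * Complex.sin (Real.pi * z)‖ ≤
        ε * Real.exp (Real.pi * |z.im|) := fun ε hε => hF.deriv_asymptotic hε
  obtain ⟨R₁, hR₁⟩ := hF.exists_bound_of_sin_asymptotic one_ne_zero hs (half_pos hδ)
  obtain ⟨R₂, hR₂⟩ := hF.exists_bound_of_sin_asymptotic hc hd (half_pos hδ)
  have f1 := finite_zeros_inter_of_isCompact hpq.differentiable_sSol_zero
    (exists_ne_zero_of_sin_asymptotic one_ne_zero hs) (isCompact_closedBall (0 : ℂ) R₁)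
  have f2 := finite_zeros_inter_of_isCompact hF.differentiable.deriv
    (exists_ne_zero_of_sin_asymptotic hc hd) (isCompact_closedBall (0 : ℂ) R₂)
  have hne : ∀ c : ℂ, ∀ᶠ t : ℝ in 𝓝[≠] a, 2 * Complex.cos (Real.pi * t) ≠ c := fun c =>
    (hasDerivAt_two_cos a).eventually_ne (two_cos_deriv_ne_zero ha)
  have e1 := (eventually_all_finite f1).2 fun z _ => hne (discriminant p q z)
  have e2 := (eventually_all_finite f2).2 fun z _ => hne (discriminant p q z)
  have e3 : ∀ᶠ t : ℝ in 𝓝[≠] a, δ / 2 < |Real.sin (Real.pi * t)| := by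
    have : Continuous fun t : ℝ => |Real.sin (Real.pi * t)| := by fun_prop
    exact (this.continuousAt.eventually (lt_mem_nhds (half_lt_self hδ))).filter_mono
      nhdsWithin_le_nhds
  filter_upwards [e1, e2, e3] with t h1 h2 h3
  rintro ⟨-, mu, hmu, hz⟩
  rw [hpq.charDet_eq_zero_iff] at hmu
  rcases hz with hz | hz
  · exact h2 mu ⟨by simpa using hR₂ mu t hmu hz h3.le, hz⟩ hmu.symm
  · exact h1 mu ⟨by simpa using hR₁ mu t hmu hz h3.le, hz⟩ hmu.symm

variable {S : Set ℝ} {lam : ℤ → Fin 2 → ℂ → ℂ} {Psi PsiStar : ℤ → Fin 2 → ℂ → ℝ → Fin 2 → ℂ}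
  {f : ℝ → Fin 2 → ℂ} {k : ℤ} {j : Fin 2} {x : ℝ}

theorem IsBlochSystem.continuousOn_ofReal
    (hB : IsBlochSystem p q (Complex.ofReal '' S) lam Psi PsiStar) (k : ℤ) (j : Fin 2) :
    ContinuousOn (fun t : ℝ => lam k j t) S :=
  (hB.cont k j).comp Complex.continuous_ofReal.continuousOn fun _ ht => mem_image_of_mem _ ht

theorem IsBlochSystem.discriminant_eq (hpq : RegularCoeff p q)
    (hB : IsBlochSystem p q (Complex.ofReal '' S) lam Psi PsiStar) {t : ℝ} (ht : t ∈ S) :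
    discriminant p q (lam k j t) = 2 * Complex.cos (Real.pi * t) :=
  (hpq.charDet_eq_zero_iff _ _).1 (hB.charDet_eq_zero k j (mem_image_of_mem _ ht))

theorem eventually_ne_int (a : ℝ) : ∀ᶠ t : ℝ in 𝓝[≠] a, ∀ n : ℤ, (t : ℂ) ≠ n := by
  have h1 : ∀ᶠ t : ℝ in 𝓝[≠] a, t ∈ Ioo (a - 1 / 2) (a + 1 / 2) :=
    mem_nhdsWithin_of_mem_nhds (Ioo_mem_nhds (by linarith) (by linarith))
  have hround : ∀ c : ℤ, ∀ᶠ t : ℝ in 𝓝[≠] a, t ≠ (c : ℝ) := by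
    intro c
    by_cases h : a = c
    · filter_upwards [self_mem_nhdsWithin] with t ht
      rw [← h]; exact ht
    · exact (eventually_ne_nhds h).filter_mono nhdsWithin_le_nhds
  filter_upwards [h1, hround (round a), hround (round a - 1), hround (round a + 1)] with t ht t1 t2 t3 n hn
  have hn' : t = n := by exact_mod_cast hn
  have hra := abs_le.1 (abs_sub_round a)
  have h4 : (n : ℝ) < round a + 2 := by rw [← hn']; linarith [ht.2]
  have h5 : (round a : ℝ) - 2 < n := by rw [← hn']; linarith [ht.1]
  have h4' : n < round a + 2 := by exact_mod_cast h4
  have h5' : round a - 2 < n := by exact_mod_cast h5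
  have : n = round a ∨ n = round a - 1 ∨ n = round a + 1 := by omega
  rcases this with rfl | rfl | rfl
  · exact t1 hn'
  · exact t2 hn'
  · exact t3 hn'

/-- On each side of `a` the set either contains a full interval, where the one-sided estimate
applies, or is absent. Neither `a ∈ S` nor agreement of the branches on the two sides is needed. -/
theorem IsBlochSystem.integrableAtFilter (hpq : RegularCoeff p q)
    (hB : IsBlochSystem p q (Complex.ofReal '' S) lam Psi PsiStar) (hf : Continuous f)
    (hfc : HasCompactSupport f) (hx : x ∈ Icc 0 Real.pi) {a : ℝ} (ha : ∀ n : ℤ, a ≠ n)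
    (hr : (∀ᶠ t in 𝓝[>] a, t ∈ S) ∨ ∀ᶠ t in 𝓝[>] a, t ∉ S)
    (hl : (∀ᶠ t in 𝓝[<] a, t ∈ S) ∨ ∀ᶠ t in 𝓝[<] a, t ∉ S) :
    IntegrableAtFilter (fun t : ℝ => expansionTerm f t (Psi k j t) (PsiStar k j t) x) (𝓝[S] a) := by
  have hF := hpq.isCosineType
  have hG := hpq.continuous_residueTerm hf hfc hx
  have hla := hB.continuousOn_ofReal k j
  have hint := eventually_ne_int a
  apply integrableAtFilter_of_punctured
  · rcases hr with hr | hr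
    · obtain ⟨b, hab, hb⟩ := (mem_nhdsGT_iff_exists_Ioo_subset' (lt_add_one a)).1
        (hr.and (hint.filter_mono (nhdsWithin_mono a fun t (ht : a < t) => ne_of_gt ht)))
      have hbS : Ioo a b ⊆ S := fun t ht => (hb ht).1
      obtain ⟨c, hc, h1, h2⟩ := hF.exists_integrableOn_right hab (hla.mono hbS)
        (fun t ht => hB.discriminant_eq hpq (hbS ht)) ha hG
      refine ⟨min b c, lt_min hab hc, ?_⟩
      refine IntegrableOn.mono_set ?_ inter_subset_right
      refine (h2.mono_set (Ioo_subset_Ioo_right (min_le_right b c))).congr_fun (fun t ht => ?_)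
        measurableSet_Ioo
      have ht1 : t ∈ Ioo a b := ⟨ht.1, ht.2.trans_le (min_le_left _ _)⟩
      exact (hB.expansionTerm_eq hpq hf hfc hx k j (mem_image_of_mem _ (hbS ht1)) (hb ht1).2
        (h1 t ⟨ht.1, ht.2.trans_le (min_le_right _ _)⟩)).symm
    · obtain ⟨b, hab, hb⟩ := (mem_nhdsGT_iff_exists_Ioo_subset' (lt_add_one a)).1 hr
      refine ⟨b, hab, ?_⟩
      have : S ∩ Ioo a b = ∅ := eq_empty_of_forall_notMem fun t ht => hb ht.2 ht.1
      rw [this]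
      exact integrableOn_empty
  · rcases hl with hl | hl
    · obtain ⟨b, hab, hb⟩ := (mem_nhdsLT_iff_exists_Ioo_subset' (sub_one_lt a)).1
        (hl.and (hint.filter_mono (nhdsWithin_mono a fun t (ht : t < a) => ne_of_lt ht)))
      have hbS : Ioo b a ⊆ S := fun t ht => (hb ht).1
      obtain ⟨c, hc, h1, h2⟩ := hF.exists_integrableOn_left hab (hla.mono hbS)
        (fun t ht => hB.discriminant_eq hpq (hbS ht)) ha hG
      refine ⟨max b c, max_lt hab hc, ?_⟩
      refine IntegrableOn.mono_set ?_ inter_subset_right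
      refine (h2.mono_set (Ioo_subset_Ioo_left (le_max_right b c))).congr_fun (fun t ht => ?_)
        measurableSet_Ioo
      have ht1 : t ∈ Ioo b a := ⟨(le_max_left _ _).trans_lt ht.1, ht.2⟩
      exact (hB.expansionTerm_eq hpq hf hfc hx k j (mem_image_of_mem _ (hbS ht1)) (hb ht1).2
        (h1 t ⟨(le_max_right _ _).trans_lt ht.1, ht.2⟩)).symm
    · obtain ⟨b, hab, hb⟩ := (mem_nhdsLT_iff_exists_Ioo_subset' (sub_one_lt a)).1 hl
      refine ⟨b, hab, ?_⟩
      have : S ∩ Ioo b a = ∅ := eq_empty_of_forall_notMem fun t ht => hb ht.2 ht.1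
      rw [this]
      exact integrableOn_empty

theorem eventually_mem_Icc_or_notMem_right (a b t : ℝ) :
    (∀ᶠ s in 𝓝[>] t, s ∈ Icc a b) ∨ ∀ᶠ s in 𝓝[>] t, s ∉ Icc a b := by
  rcases lt_or_ge t a with h | h
  · right
    filter_upwards [Ioo_mem_nhdsGT h] with s hs hs'
    linarith [hs.2, hs'.1]
  · rcases lt_or_ge t b with h' | h'
    · left
      filter_upwards [Ioo_mem_nhdsGT h'] with s hs
      exact ⟨h.trans hs.1.le, hs.2.le⟩
    · right
      filter_upwards [self_mem_nhdsWithin] with s hs hs'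
      have : t < s := hs
      linarith [hs'.2]

theorem eventually_mem_Icc_or_notMem_left (a b t : ℝ) :
    (∀ᶠ s in 𝓝[<] t, s ∈ Icc a b) ∨ ∀ᶠ s in 𝓝[<] t, s ∉ Icc a b := by
  rcases lt_or_ge b t with h | h
  · right
    filter_upwards [Ioo_mem_nhdsLT h] with s hs hs'
    linarith [hs.1, hs'.2]
  · rcases lt_or_ge a t with h' | h'
    · left
      filter_upwards [Ioo_mem_nhdsLT h'] with s hs
      exact ⟨hs.1.le, hs.2.le.trans h⟩
    · right
      filter_upwards [self_mem_nhdsWithin] with s hs hs'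
      have : s < t := hs
      linarith [hs'.1]

theorem eventually_mem_union_or_notMem {l : Filter ℝ} {A B : Set ℝ}
    (hA : (∀ᶠ s in l, s ∈ A) ∨ ∀ᶠ s in l, s ∉ A) (hB : (∀ᶠ s in l, s ∈ B) ∨ ∀ᶠ s in l, s ∉ B) :
    (∀ᶠ s in l, s ∈ A ∪ B) ∨ ∀ᶠ s in l, s ∉ A ∪ B := by
  rcases hA with hA | hA
  · exact Or.inl (hA.mono fun _ h => Or.inl h)
  · rcases hB with hB | hB
    · exact Or.inl (hB.mono fun _ h => Or.inr h)
    · exact Or.inr ((hA.and hB).mono fun _ h h' => h'.elim h.1 h.2)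

theorem IsBlochSystem.integrableOn_setE (hpq : RegularCoeff p q) {h : ℝ} (h_pos : 0 < h)
    (hB : IsBlochSystem p q (Complex.ofReal '' setE p q h) lam Psi PsiStar) (hf : Continuous f)
    (hfc : HasCompactSupport f) (hx : x ∈ Icc 0 Real.pi) :
    IntegrableOn (fun t : ℝ => expansionTerm f t (Psi k j t) (PsiStar k j t) x) (setE p q h) := by
  refine integrableOn_of_forall_integrableAtFilter
    (K := Icc h (1 - h) ∪ Icc (1 + h) (2 - h)) (isCompact_Icc.union isCompact_Icc)
    (fun t ht => ht.1) fun a ha => ?_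
  have hne : ∀ n : ℤ, a ≠ n := by
    rintro n rfl
    rcases ha with ha | ha
    · have h1 : (0 : ℝ) < n := h_pos.trans_le ha.1
      have h2 : (n : ℝ) < 1 := by linarith [ha.2]
      have h1' : 0 < n := by exact_mod_cast h1
      have h2' : n < 1 := by exact_mod_cast h2
      omega
    · have h1 : (1 : ℝ) < n := by linarith [ha.1]
      have h2 : (n : ℝ) < 2 := by linarith [ha.2]
      have h1' : 1 < n := by exact_mod_cast h1
      have h2' : n < 2 := by exact_mod_cast h2
      omega
  have hex := hpq.eventually_notMem_exceptional h hne
  -- Removing isolated exceptional points does not change the one-sided behaviour of a union of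
  -- intervals.
  have aux : ∀ l : Filter ℝ, l ≤ 𝓝[≠] a →
      ((∀ᶠ t in l, t ∈ Icc h (1 - h) ∪ Icc (1 + h) (2 - h)) ∨
        ∀ᶠ t in l, t ∉ Icc h (1 - h) ∪ Icc (1 + h) (2 - h)) →
      (∀ᶠ t in l, t ∈ setE p q h) ∨ ∀ᶠ t in l, t ∉ setE p q h := by
    intro l hl hd
    rcases hd with hd | hd
    · exact Or.inl ((hd.and (hex.filter_mono hl)).mono fun t ht => ht)
    · exact Or.inr (hd.mono fun t ht ht' => ht ht'.1)
  exact hB.integrableAtFilter hpq hf hfc hx hne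
    (aux _ (nhdsWithin_mono a fun t (ht : a < t) => ne_of_gt ht)
      (eventually_mem_union_or_notMem (eventually_mem_Icc_or_notMem_right _ _ _)
        (eventually_mem_Icc_or_notMem_right _ _ _)))
    (aux _ (nhdsWithin_mono a fun t (ht : t < a) => ne_of_lt ht)
      (eventually_mem_union_or_notMem (eventually_mem_Icc_or_notMem_left _ _ _)
        (eventually_mem_Icc_or_notMem_left _ _ _)))

theorem continuousOn_inv_smul_comp {X E : Type*} [TopologicalSpace X] [NormedAddCommGroup E]
    [NormedSpace ℂ E] {s : Set X} {D : ℂ → ℂ} {G : ℂ × ℂ → E} {u v : X → ℂ} (hD : Continuous D)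
    (hG : Continuous G) (hu : ContinuousOn u s) (hv : ContinuousOn v s)
    (hne : ∀ t ∈ s, D (u t) ≠ 0) : ContinuousOn (fun t => (D (u t))⁻¹ • G (u t, v t)) s :=
  ((hD.comp_continuousOn hu).inv₀ hne).smul (hG.comp_continuousOn (hu.prodMk hv))

theorem IsBlochSystem.continuousOn_expansionTerm (hpq : RegularCoeff p q) {S s : Set ℂ}
    (hB : IsBlochSystem p q S lam Psi PsiStar) (hf : Continuous f) (hfc : HasCompactSupport f)
    (hx : x ∈ Icc 0 Real.pi) (hs : s ⊆ S) (hint : ∀ t ∈ s, ∀ n : ℤ, t ≠ n)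
    (hne : ∀ t ∈ s, deriv (discriminant p q) (lam k j t) ≠ 0) :
    ContinuousOn (fun t : ℂ => expansionTerm f t (Psi k j t) (PsiStar k j t) x) s := by
  have h1 := continuousOn_inv_smul_comp hpq.differentiable_discriminant.deriv.continuous
    (hpq.continuous_residueTerm hf hfc hx) ((hB.cont k j).mono hs) continuousOn_id hne
  exact h1.congr fun t ht => hB.expansionTerm_eq hpq hf hfc hx k j (hs ht) (hint t ht) (hne t ht)

theorem circleMap_mem_semicircle {a h θ : ℝ} (hh : 0 < h) (hθ : θ ∈ Icc 0 Real.pi) :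
    circleMap a h θ ∈ semicircle a h := by
  constructor
  · simp [circleMap, abs_of_pos hh]
  · have : (circleMap a h θ).im = h * Real.sin θ := by
      simp [circleMap, Complex.exp_ofReal_mul_I_im]
    rw [this]
    exact mul_nonneg hh.le (Real.sin_nonneg_of_mem_Icc hθ)

theorem IsBlochSystem.semicircleIntegrable (hpq : RegularCoeff p q) {h : ℝ} {a : ℤ}
    (h_pos : 0 < h) (h_lt : h < 1 / 10) (ha : a = 0 ∨ a = 1)
    (hB : IsBlochSystem p q (semicircle a h) lam Psi PsiStar)
    (hdisj : Disjoint (semicircle a h) (exceptional p q h)) (hf : Continuous f)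
    (hfc : HasCompactSupport f) (hx : x ∈ Icc 0 Real.pi) :
    SemicircleIntegrable (fun t : ℂ => expansionTerm f t (Psi k j t) (PsiStar k j t) x) a h := by
  have hmem : ∀ θ ∈ Icc 0 Real.pi, circleMap a h θ ∈ semicircle a h := fun θ hθ => by
    have := circleMap_mem_semicircle (a := a) h_pos hθ
    simpa using this
  have hne : ∀ t ∈ semicircle a h, deriv (discriminant p q) (lam k j t) ≠ 0 := by
    intro t ht h0
    -- A zero of `F'` on the arc would make `t` exceptional; what remains is that the arc lies in
    -- `D_h`, where `h < 1/10` enters.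
    refine disjoint_left.1 hdisj ht ⟨?_, lam k j t, hB.charDet_eq_zero k j ht, Or.inl h0⟩
    have hn : ‖t - a‖ = h := by simpa using ht.1
    have h1 := Complex.abs_re_le_norm (t - a)
    have h2 := Complex.abs_im_le_norm (t - a)
    rw [hn] at h1 h2
    simp only [Complex.sub_re, Complex.sub_im, Complex.intCast_re, Complex.intCast_im,
      sub_zero] at h1 h2
    rw [abs_le] at h1
    rcases ha with rfl | rfl
    · simp only [Int.cast_zero, sub_zero] at h1
      exact ⟨by linarith, by linarith, by linarith⟩
    · simp only [Int.cast_one] at h1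
      exact ⟨by linarith, by linarith, by linarith⟩
  have hint : ∀ t ∈ semicircle a h, ∀ n : ℤ, t ≠ n := by
    rintro t ht n rfl
    have hn : ‖(n : ℂ) - a‖ = h := by simpa using ht.1
    rw [← Int.cast_sub, Complex.norm_intCast] at hn
    have h1 : (0 : ℝ) < |((n - a : ℤ) : ℝ)| := by linarith
    have h2 : |((n - a : ℤ) : ℝ)| < 1 := by linarith
    rw [← Int.cast_abs] at h1 h2
    have h1' : 0 < |n - a| := by exact_mod_cast h1
    have h2' : |n - a| < 1 := by exact_mod_cast h2
    omega
  apply ContinuousOn.intervalIntegrable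
  rw [uIcc_of_le Real.pi_pos.le]
  exact (hB.continuousOn_expansionTerm hpq hf hfc hx subset_rfl hint hne).comp
    (continuous_circleMap _ _).continuousOn hmem

theorem eventually_norm_ip_gelfand_le (hpq : RegularCoeff p q) (hf : Continuous f)
    (hfc : HasCompactSupport f) (R : ℝ) (a : ℝ) :
    ∃ C, ∀ᶠ t : ℝ in 𝓝 a, ∀ (mu : ℂ) (y : ℝ → Fin 2 → ℂ), ‖mu‖ ≤ R →
      IsNormalizedEigenfunction p q t mu y → ‖ip (gelfand f t) y‖ ≤ C := by
  obtain ⟨C, hC, hy⟩ := IsNormalizedEigenfunction.norm_le hpq R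
  have hcont : Continuous fun z : ℝ × ℝ => gelfand f z.1 (clamp z.2) :=
    (continuous_gelfand_clamp hf hfc).comp
      ((Complex.continuous_ofReal.comp continuous_fst).prodMk continuous_snd)
  obtain ⟨B, hB⟩ := ((isCompact_Icc (a := a - 1) (b := a + 1)).prod
    (isCompact_Icc (a := (0 : ℝ)) (b := Real.pi))).exists_bound_of_continuousOn hcont.continuousOn
  refine ⟨2 * |B| * C * Real.pi, ?_⟩
  filter_upwards [Icc_mem_nhds (by linarith : a - 1 < a) (by linarith : a < a + 1)] with t ht mu y hmu hn
  rw [ip_eq_pairing]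
  refine norm_pairing_le (abs_nonneg B) (fun s hs => ?_) (fun s hs => ?_) ⟨Real.pi_pos.le, le_rfl⟩
  · have := hB (t, s) ⟨ht, hs⟩
    rw [clamp_of_mem hs] at this
    exact this.trans (le_abs_self _)
  · refine (pi_norm_le_iff_of_nonneg hC.le).2 fun i => ?_
    rw [RCLike.norm_conj]
    exact (norm_le_pi_norm _ i).trans (hy t mu y hmu hn s hs)

/-- Without an ESS, `1/α` is integrable near `a`, and it dominates the term because `(f_t, Ψ*)` and
`Ψ(x)` are bounded for bounded eigenvalues. Arbitrary phases leave `Ψ` and `α` possibly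
non-measurable separately, so measurability of the whole term comes from its phase-free formula off
`a`. -/
theorem IsBlochSystem.integrableAtFilter_of_not_isESS (hpq : RegularCoeff p q) {a b c : ℝ}
    (hac : a ∈ Ioo b c)
    (hB : IsBlochSystem p q (Complex.ofReal '' Ioo b c) lam Psi PsiStar) (hf : Continuous f)
    (hfc : HasCompactSupport f) (hx : x ∈ Icc 0 Real.pi)
    (hcosne : ∀ᶠ t : ℝ in 𝓝[≠] a, 2 * Complex.cos (Real.pi * t) ≠ 2 * Complex.cos (Real.pi * a))
    (hess : ¬ IsESS lam Psi PsiStar a (lam k j a)) :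
    IntegrableAtFilter (fun t : ℝ => expansionTerm f t (Psi k j t) (PsiStar k j t) x)
      (𝓝[Ioo b c] a) := by
  have hF := hpq.isCosineType
  have hla := hB.continuousOn_ofReal k j
  have hlaa : ContinuousAt (fun t : ℝ => lam k j t) a := hla.continuousAt (Ioo_mem_nhds hac.1 hac.2)
  obtain ⟨ε, hε, hint⟩ : ∃ ε > 0, IntegrableOn
      (fun t : ℝ => ‖(ip (Psi k j t) (PsiStar k j t))⁻¹‖) (Ioo (a - ε) (a + ε)) := by
    by_contra! hcon
    exact hess ⟨k, j, rfl, fun ε hε => hcon ε hε⟩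
  set R := ‖lam k j a‖ + 1 with hR
  obtain ⟨C₁, hC₁, hpsi⟩ := IsNormalizedEigenfunction.norm_le hpq R
  obtain ⟨C₂, hip⟩ := eventually_norm_ip_gelfand_le hpq.conj hf hfc R a
  have hmem : ∀ᶠ t in 𝓝[≠] a, t ∈ Ioo b c :=
    mem_nhdsWithin_of_mem_nhds (Ioo_mem_nhds hac.1 hac.2)
  have hbdd : ∀ᶠ t : ℝ in 𝓝[≠] a, ‖lam k j t‖ ≤ R :=
    (hlaa.norm.eventually (gt_mem_nhds (by linarith : ‖lam k j a‖ < R))).filter_mono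
      nhdsWithin_le_nhds |>.mono fun _ h => h.le
  -- `F'` may vanish at `lam k j a` itself, but its zeros are isolated, so it is enough that the
  -- branch leaves that value; it does, because `2 cos πt` does.
  have hlane : ∀ᶠ t : ℝ in 𝓝[≠] a, lam k j t ≠ lam k j a := by
    filter_upwards [hmem, hcosne] with t ht hne heq
    apply hne
    rw [← hB.discriminant_eq hpq (k := k) (j := j) ht, ← hB.discriminant_eq hpq (k := k) (j := j) hac,
      heq]
  have hderiv : ∀ᶠ t : ℝ in 𝓝[≠] a, deriv (discriminant p q) (lam k j t) ≠ 0 := by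
    have h1 : Tendsto (fun t : ℝ => lam k j t) (𝓝[≠] a) (𝓝[≠] (lam k j a)) :=
      tendsto_nhdsWithin_iff.2 ⟨hlaa.tendsto.mono_left nhdsWithin_le_nhds, hlane⟩
    exact h1.eventually (hF.deriv_eventually_ne _)
  have hall := ((hmem.and (eventually_ne_int a)).and (hderiv.and hbdd)).and
    (hip.filter_mono nhdsWithin_le_nhds)
  obtain ⟨δ, hδ, hδs⟩ := Metric.mem_nhdsWithin_iff.1 hall
  set ρ := min δ ε with hρ
  have hρ0 : 0 < ρ := lt_min hδ hε
  have key : ∀ I : Set ℝ, MeasurableSet I → I ⊆ Ioo (a - ρ) (a + ρ) → a ∉ I →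
      IntegrableOn (fun t : ℝ => expansionTerm f t (Psi k j t) (PsiStar k j t) x) I := by
    intro I hI hIs haI
    have hP : ∀ t ∈ I, ((t ∈ Ioo b c ∧ ∀ n : ℤ, (t : ℂ) ≠ n) ∧
        deriv (discriminant p q) (lam k j t) ≠ 0 ∧ ‖lam k j t‖ ≤ R) ∧
        ∀ (mu : ℂ) (y : ℝ → Fin 2 → ℂ), ‖mu‖ ≤ R → IsNormalizedEigenfunction
          (fun x => conj (p x)) (fun x => conj (q x)) t mu y → ‖ip (gelfand f t) y‖ ≤ C₂ := by
      intro t ht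
      refine hδs ⟨?_, fun hta => haI (hta ▸ ht)⟩
      rw [Metric.mem_ball, Real.dist_eq, abs_lt]
      have := min_le_left δ ε
      constructor <;> linarith [(hIs ht).1, (hIs ht).2]
    have hIε : I ⊆ Ioo (a - ε) (a + ε) := fun t ht => by
      have := min_le_right δ ε
      exact ⟨by linarith [(hIs ht).1], by linarith [(hIs ht).2]⟩
    have hIbc : I ⊆ Ioo b c := fun t ht => (hP t ht).1.1.1
    have hcont : ContinuousOn
        (fun t : ℝ => expansionTerm f t (Psi k j t) (PsiStar k j t) x) I :=
      (hB.continuousOn_expansionTerm hpq (k := k) (j := j) (s := Complex.ofReal '' I) hf hfc hx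
        (image_mono hIbc) (forall_mem_image.2 fun t ht => (hP t ht).1.1.2)
        (forall_mem_image.2 fun t ht => (hP t ht).1.2.1)).comp
        Complex.continuous_ofReal.continuousOn (mapsTo_image _ _)
    refine Integrable.mono' ((hint.mono_set hIε).mul_const (C₂ * C₁))
      (hcont.aestronglyMeasurable hI) ?_
    refine (ae_restrict_iff' hI).2 (Eventually.of_forall fun t ht => ?_)
    obtain ⟨⟨⟨h1, h2⟩, h3, h4⟩, h5⟩ := hP t ht
    have htS : (t : ℂ) ∈ Complex.ofReal '' Ioo b c := mem_image_of_mem _ h1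
    have hm := hpq.multiplicity_eq_one (hB.charDet_eq_zero k j htS) h3
    have e1 := hB.eigen k j t htS hm
    have e2 := hB.eigenStar k j t htS hm
    -- For real `t` the adjoint quasimomentum is `t` itself, so the bounds for normalized
    -- eigenfunctions with conjugate coefficients apply.
    rw [Complex.conj_ofReal] at e2
    have b1 := hpsi t _ _ h4 e1 x hx
    have b2 := h5 _ _ (by rwa [RCLike.norm_conj]) e2
    rw [expansionTerm, norm_smul, norm_mul, mul_assoc]
    exact mul_le_mul_of_nonneg_left (mul_le_mul b2 b1 (norm_nonneg _) ((norm_nonneg _).trans b2))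
      (norm_nonneg _)
  apply integrableAtFilter_of_punctured
  · refine ⟨a + ρ, by linarith, (key (Ioo a (a + ρ)) measurableSet_Ioo ?_ ?_).mono_set
      inter_subset_right⟩
    · exact Ioo_subset_Ioo_left (by linarith)
    · simp
  · refine ⟨a - ρ, by linarith, (key (Ioo (a - ρ) a) measurableSet_Ioo ?_ ?_).mono_set
      inter_subset_right⟩
    · exact Ioo_subset_Ioo_right (by linarith)
    · simp

theorem eventually_two_cos_ne_at_int (n : ℤ) : ∀ᶠ t : ℝ in 𝓝[≠] (n : ℝ),
    2 * Complex.cos (Real.pi * t) ≠ 2 * Complex.cos (Real.pi * (n : ℝ)) := by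
  filter_upwards [eventually_ne_int n] with t ht heq
  have h1 : Complex.cos (Real.pi * t) = Complex.cos (Real.pi * (n : ℝ)) :=
    mul_left_cancel₀ two_ne_zero heq
  have h2 : Real.cos (Real.pi * t) = Real.cos (Real.pi * n) := by exact_mod_cast h1
  have h3 : Real.sin (Real.pi * n) = 0 := by rw [mul_comm]; exact Real.sin_int_mul_pi n
  have h4 := Real.sin_sq_add_cos_sq (Real.pi * t)
  have h5 := Real.sin_sq_add_cos_sq (Real.pi * n)
  rw [h2] at h4
  rw [h3] at h5
  have h6 : Real.sin (Real.pi * t) = 0 := by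
    have : Real.sin (Real.pi * t) ^ 2 = 0 := by linarith
    exact pow_eq_zero_iff (two_ne_zero) |>.1 this
  exact sin_pi_mul_ne_zero (fun m hm => ht m (by exact_mod_cast hm)) h6

/-- Only the centre `n` uses the absence of an ESS. All other points of the closed interval, its
endpoints included, are non-integers and fall under the local power estimate. -/
theorem IsBlochSystem.integrableOn_Ioo_of_not_isESS (hpq : RegularCoeff p q) {h : ℝ} (n : ℤ)
    (h_pos : 0 < h) (h_lt : h < 1 / 10)
    (hB : IsBlochSystem p q (Complex.ofReal '' Ioo (n - h) (n + h)) lam Psi PsiStar)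
    (hf : Continuous f) (hfc : HasCompactSupport f) (hx : x ∈ Icc 0 Real.pi)
    (hess : ¬ IsESS lam Psi PsiStar n (lam k j (n : ℝ))) :
    IntegrableOn (fun t : ℝ => expansionTerm f t (Psi k j t) (PsiStar k j t) x)
      (Ioo (n - h) (n + h)) := by
  refine integrableOn_of_forall_integrableAtFilter (K := Icc (n - h) (n + h)) isCompact_Icc
    Ioo_subset_Icc_self fun a ha => ?_
  by_cases han : a = n
  · subst han
    exact hB.integrableAtFilter_of_not_isESS hpq ⟨by linarith, by linarith⟩ hf hfc hx
      (eventually_two_cos_ne_at_int n) hess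
  · have hne : ∀ m : ℤ, a ≠ m := by
      rintro m rfl
      apply han
      have h1 : (n : ℝ) - 1 < m := by linarith [ha.1]
      have h2 : (m : ℝ) < n + 1 := by linarith [ha.2]
      have h1' : n - 1 < m := by exact_mod_cast h1
      have h2' : m < n + 1 := by exact_mod_cast h2
      have : m = n := by omega
      rw [this]
    refine hB.integrableAtFilter hpq hf hfc hx hne ?_ ?_
    · rcases lt_or_ge a (n + h) with h1 | h1
      · left
        filter_upwards [Ioo_mem_nhdsGT h1] with s hs
        exact ⟨ha.1.trans_lt hs.1, hs.2⟩
      · right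
        filter_upwards [self_mem_nhdsWithin] with s hs hs'
        have : a < s := hs
        linarith [hs'.2]
    · rcases lt_or_ge (n - h) a with h1 | h1
      · left
        filter_upwards [Ioo_mem_nhdsLT h1] with s hs
        exact ⟨hs.1, hs.2.trans_le ha.2⟩
      · right
        filter_upwards [self_mem_nhdsWithin] with s hs hs'
        have : s < a := hs
        linarith [hs'.1]

end Bloch

end Dirac

end

theorem theorem4 (p q : ℝ → ℂ)
    (hp : Function.Periodic p Real.pi) (hq : Function.Periodic q Real.pi)
    (hpv : BoundedVariationOn p (Icc 0 Real.pi)) (hqv : BoundedVariationOn q (Icc 0 Real.pi))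
    (h : ℝ) (h_pos : 0 < h) (h_lt : h < 1 / 10)
    (h_avoid : Disjoint (Dirac.semicircle 0 h ∪ Dirac.semicircle 1 h) (Dirac.exceptional p q h))
    (f : ℝ → Fin 2 → ℂ) (hf : Continuous f) (hfc : HasCompactSupport f)
    (lam : ℤ → Fin 2 → ℂ → ℂ) (Psi PsiStar : ℤ → Fin 2 → ℂ → ℝ → Fin 2 → ℂ)
    (k : ℤ) (j : Fin 2) (x : ℝ) (hx : x ∈ Icc 0 Real.pi) :
    (Dirac.IsBlochSystem p q (Complex.ofReal '' Dirac.setE p q h) lam Psi PsiStar →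
      IntegrableOn
        (fun t : ℝ => Dirac.expansionTerm f t (Psi k j t) (PsiStar k j t) x)
        (Dirac.setE p q h)) ∧
    (Dirac.IsBlochSystem p q (Dirac.semicircle 0 h) lam Psi PsiStar →
      Dirac.SemicircleIntegrable
        (fun t : ℂ => Dirac.expansionTerm f t (Psi k j t) (PsiStar k j t) x) 0 h) ∧
    (Dirac.IsBlochSystem p q (Dirac.semicircle 1 h) lam Psi PsiStar →
      Dirac.SemicircleIntegrable
        (fun t : ℂ => Dirac.expansionTerm f t (Psi k j t) (PsiStar k j t) x) 1 h) ∧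
    (Dirac.IsBlochSystem p q (Complex.ofReal '' Ioo (-h) h) lam Psi PsiStar →
      ¬ Dirac.IsESS lam Psi PsiStar 0 (lam k j 0) →
      IntegrableOn
        (fun t : ℝ => Dirac.expansionTerm f t (Psi k j t) (PsiStar k j t) x)
        (Ioo (-h) h)) ∧
    (Dirac.IsBlochSystem p q (Complex.ofReal '' Ioo (1 - h) (1 + h)) lam Psi PsiStar →
      ¬ Dirac.IsESS lam Psi PsiStar 1 (lam k j 1) →
      IntegrableOn
        (fun t : ℝ => Dirac.expansionTerm f t (Psi k j t) (PsiStar k j t) x)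
        (Ioo (1 - h) (1 + h))) := by
  have hpq := Dirac.regularCoeff_of_boundedVariationOn hpv hqv
  obtain ⟨h_avoid₀, h_avoid₁⟩ := disjoint_union_left.1 h_avoid
  refine ⟨fun hB => hB.integrableOn_setE hpq h_pos hf hfc hx, fun hB => ?_, fun hB => ?_,
    fun hB hess => ?_, fun hB hess => ?_⟩
  · have key := Dirac.IsBlochSystem.semicircleIntegrable (lam := lam) (Psi := Psi)
      (PsiStar := PsiStar) (f := f) (k := k) (j := j) (x := x) hpq (a := 0) h_pos h_lt (Or.inl rfl)
    simp only [Int.cast_zero] at key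
    exact key hB h_avoid₀ hf hfc hx
  · have key := Dirac.IsBlochSystem.semicircleIntegrable (lam := lam) (Psi := Psi)
      (PsiStar := PsiStar) (f := f) (k := k) (j := j) (x := x) hpq (a := 1) h_pos h_lt (Or.inr rfl)
    simp only [Int.cast_one] at key
    exact key hB h_avoid₁ hf hfc hx
  · have key := Dirac.IsBlochSystem.integrableOn_Ioo_of_not_isESS (lam := lam) (Psi := Psi)
      (PsiStar := PsiStar) (f := f) (k := k) (j := j) (x := x) hpq (h := h) 0 h_pos h_lt
    simp only [Int.cast_zero, zero_sub, zero_add, Complex.ofReal_zero] at key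
    exact key hB hf hfc hx hess
  · have key := Dirac.IsBlochSystem.integrableOn_Ioo_of_not_isESS (lam := lam) (Psi := Psi)
      (PsiStar := PsiStar) (f := f) (k := k) (j := j) (x := x) hpq (h := h) 1 h_pos h_lt
    simp only [Int.cast_one, Complex.ofReal_one] at key
    exact key hB hf hfc hx hess
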